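/- **Setting.** Let $(X,d)$ be a complete metric space with a dense sequence $(a_i)$ such that $d(a_i,a_j)$ is uniformly computable, and let $\mu$ be a computable Borel probability measure on $X$: the measures of effectively open ($\Sigma^0_1$) sets are uniformly lower semicomputable. (A $\Sigma^0_1$ set is a computable union of balls $B(a_i,r)$, $r\in\mathbb Q_{>0}$; complements of $\Sigma^0_1$ sets are called $\Pi^0_1$.) Let $\mathcal A$ be an a.e. decidable cell decomposition: a computable sequence of pairs of disjoint $\Sigma^0_1$ sets $(U_i,V_i)$ with $\mu(U_i\cup V_i)=1$, such that each $\Sigma^0_1$ set is, effectively from its code, $\mu$-a.e. equal to the union of a c.e. family of finite Boolean combinations of these sets. For $\sigma\in 2^{<\omega}$ the cell $[\sigma]_{\mathcal A}$ is $\bigcap_{i<|\sigma|}A_i^{\sigma(i)}$ with $A_i^0=U_i$, $A_i^1=V_i$, and $x\upharpoonright_{\mathcal A}n$ is the unique $\sigma$ of length $n$ with $x\in[\sigma]_{\mathcal A}$. The point $x$ is *unrepresented* if $x\upharpoonright_{\mathcal A}n$ does not exist for some $n$, it is *in a null cell* if $x\in[\sigma]_{\mathcal A}$ for some $\sigma$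 with $\mu([\sigma]_{\mathcal A})=0$, and *the cells shrink to $x$* if for every open $O\ni x$ there is a cell $[\sigma]_{\mathcal A}\ni x$ with $\mu([\sigma]_{\mathcal A}\setminus O)=0$. A computable measure $\nu$ is a computable $\nu:2^{<\omega}\to[0,\infty)$ with $\nu(\sigma0)+\nu(\sigma1)=\nu(\sigma)$. **Theorem.** (a) Suppose that $x\in X$ is neither unrepresented nor in a null cell, and that the cells shrink to $x$. Then the following are equivalent. 1. There is a partial computable $M:2^{<\omega}\to[0,\infty)$, with $M(\sigma)$ defined iff $\mu([\sigma]_{\mathcal A})>0$, such that $M(\sigma0)\mu([\sigma0]_{\mathcal A})+M(\sigma1)\mu([\sigma1]_{\mathcal A})=M(\sigma)\mu([\sigma]_{\mathcal A})$ for all $\sigma$ (where $\mathrm{undefined}\cdot0=0$) and $\limsup_n M(x\upharpoonright_{\mathcal A}n)=\infty$. 2. There are $N$ satisfying the conditions on $M$ in 1 and a partial computable $f:2^{<\omega}\to[0,\infty)$, with $f(\sigma)$ defined iff $\mu([\sigma]_{\mathcal A})>0$, such that $f(\sigma)\le N(\sigma)\le f(\sigma)+1$, $f(\sigma)\le f(\tau)$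 whenever $\sigma\preceq\tau$ (where defined), and $\lim_n N(x\upharpoonright_{\mathcal A}n)=\infty$. 3. There are a computable measure $\nu$ and a lower semicomputable $g:X\to[0,\infty]$ (a supremum of a computable sequence of computable functions $X\to[0,\infty)$) with $\int_{[\sigma]_{\mathcal A}}g\,d\mu\le\nu(\sigma)$ for all $\sigma$ and $g(x)=\infty$. 4. There are a computable measure $\nu$ and a computable sequence $(U_n)$ of $\Sigma^0_1$ sets with $\mu(U_n)\le2^{-n}$, with $\mu(U_n\cap[\sigma]_{\mathcal A})\le2^{-n}\nu(\sigma)$ for all $n,\sigma$, and with $x\in\bigcap_nU_n$. 5. There are a computable measure $\nu$ and a computable sequence $(V_n)$ of $\Sigma^0_1$ sets with $\sum_n\mu(V_n)<\infty$, with $\sum_n\mu(V_n\cap[\sigma]_{\mathcal A})\le\nu(\sigma)$ for all $\sigma$, and with $x\in V_n$ for infinitely many $n$. They are also equivalent to each of 3, 4, 5 with the additional requirement that $\nu$ is a probability measure and that, for some $\mu$-integrable $h$, $\nu(\sigma)\le\int_{[\sigma]_{\mathcal A}}h\,d\mu$ for all $\sigma$. (b) Each test is uniformly computable from any other: for any two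 of the five kinds there is a computable function that maps codes of tests of the first kind to codes of tests of the second kind (with $\nu$, if there is one, satisfying the additional requirement), such that every $x$ that is neither unrepresented nor in a null cell and fails the first test (i.e. satisfies the condition on $x$ in it) fails the second one; only when the first kind is one of 3–5 and the second is 1 or 2 is this restricted to those $x$ to which the cells shrink. (c) Every Kurtz random point $x$ (a point in no $\mu$-null $\Pi^0_1$ set) is neither unrepresented nor in a null cell, and the cells shrink to $x$. -/

import Mathlib

open MeasureTheory Filter
open scoped ENNReal Topology

noncomputable section

namespace CompRand

open Nat.Partrec (Code)

/-- A surjective numbering of the rational numbers by natural numbers. -/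
def ratCode (n : ℕ) : ℚ :=
  ((n.unpair.1.unpair.1 : ℚ) - (n.unpair.1.unpair.2 : ℚ)) / ((n.unpair.2 : ℚ) + 1)

/-- A family of reals is uniformly computable: an algorithm gives, from the index and `k`,
a rational approximation within `2 ^ (-k)`. -/
def UniformlyComputableReal {ι : Type*} [Primcodable ι] (f : ι → ℝ) : Prop :=
  ∃ F : ι × ℕ → ℕ, Computable F ∧ ∀ i k, |(ratCode (F (i, k)) : ℝ) - f i| ≤ (2⁻¹ : ℝ) ^ k

/-- The effectively open (`Σ⁰₁`) set with code `e`, in a metric space with simple points `a`: the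
union of all basic open balls `B(a i, ratCode n)` with `(i, n)` in the c.e. set with code `e`.
(Balls of nonpositive radius are empty.) -/
def effOpen {X : Type*} [PseudoMetricSpace X] (a : ℕ → X) (e : Code) : Set X :=
  {x | ∃ i n : ℕ, (e.eval (Nat.pair i n)).Dom ∧ dist x (a i) < (ratCode n : ℝ)}

/-- The rational points of `ℝ`, as the simple points of the computable Polish space `ℝ`. -/
def realPts (n : ℕ) : ℝ := (ratCode n : ℝ)

/-- `a` makes the complete metric space `X` a computable Polish space. -/
structure IsComputablePolish {X : Type*} [MetricSpace X] [CompleteSpace X] (a : ℕ → X) :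
    Prop where
  dense : DenseRange a
  dist_computable : UniformlyComputableReal fun p : ℕ × ℕ => dist (a p.1) (a p.2)

/-- A computable finite Borel measure: its total mass is computable, and the measure of an
effectively open set is lower semicomputable, uniformly in the code. -/
structure IsComputableMeasure {X : Type*} [MetricSpace X] [MeasurableSpace X] (a : ℕ → X)
    (μ : Measure X) : Prop where
  finite : IsFiniteMeasure μ
  mass_computable : UniformlyComputableReal fun _ : Unit => μ.real Set.univ
  lower : REPred fun p : Code × ℕ => (ratCode p.2 : ℝ) < μ.real (effOpen a p.1)

/-- `x` is Kurtz random: it lies in no null effectively closed set. -/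
def IsKurtzRandom {X : Type*} [MetricSpace X] [MeasurableSpace X] (a : ℕ → X) (μ : Measure X)
    (x : X) : Prop :=
  ∀ e : Code, μ (effOpen a e)ᶜ = 0 → x ∉ (effOpen a e)ᶜ

/-- An a.e. decidable generator `(A i)` of `(X, μ)`, which is the same thing as an a.e. decidable
cell decomposition.  The set `A i` is given by its code, an a.e. decidable pair of effectively open
sets `U i` (with code `code i false`) and `V i` (with code `code i true`).  Boolean combinations of
the `A i` are given, up to null sets, in disjunctive normal form. -/
structure CellDecomposition {X : Type*} [MetricSpace X] [MeasurableSpace X] (a : ℕ → X)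
    (μ : Measure X) where
  code : ℕ → Bool → Code
  code_computable : Computable₂ code
  disjoint : ∀ i, Disjoint (effOpen a (code i false)) (effOpen a (code i true))
  full : ∀ i, μ (effOpen a (code i false) ∪ effOpen a (code i true)) = 1
  generates : ∃ G : Code → Code, Computable G ∧ ∀ e : Code,
    effOpen a e =ᵐ[μ] {x | ∃ D : List (List (ℕ × Bool)), ((G e).eval (Encodable.encode D)).Dom ∧
      ∃ C ∈ D, ∀ l ∈ C, x ∈ effOpen a (code l.1 l.2)}

/-- The initial segment of length `n` of an infinite binary string. -/
def initSeg (y : ℕ → Bool) (n : ℕ) : List Bool := (List.range n).map y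

namespace CellDecomposition

variable {X : Type*} [MetricSpace X] [MeasurableSpace X] {a : ℕ → X} {μ : Measure X}

/-- The cell of a finite binary string `σ`: the intersection over `i < |σ|` of `U i` if `σ i = 0`
and `V i` if `σ i = 1`. -/
def cell (A : CellDecomposition a μ) (σ : List Bool) : Set X :=
  {x | ∀ (i : ℕ) (h : i < σ.length), x ∈ effOpen a (A.code i σ[i])}

/-- `y` is the name of `x`: the string `y ↾ n` is the `σ` of length `n` with `x` in the cell of `σ`
(unique, because cells of distinct strings of equal length are disjoint). -/
def IsName (A : CellDecomposition a μ) (x : X) (y : ℕ → Bool) : Prop :=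
  ∀ n, x ∈ A.cell (initSeg y n)

def Unrepresented (A : CellDecomposition a μ) (x : X) : Prop := ¬ ∃ y, A.IsName x y

def InNullCell (A : CellDecomposition a μ) (x : X) : Prop := ∃ σ, x ∈ A.cell σ ∧ μ (A.cell σ) = 0

/-- Every open neighbourhood of `x` contains, up to a null set, a cell of `x`. -/
def CellsShrinkTo (A : CellDecomposition a μ) (x : X) : Prop :=
  ∀ O : Set X, IsOpen O → x ∈ O → ∃ σ, x ∈ A.cell σ ∧ μ (A.cell σ \ O) = 0

end CellDecomposition

/-! ### Codes of computable objects -/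

/-- `c` computes the partial function `f` from finite strings to reals: it gives rational
approximations of any precision where `f` is defined and diverges elsewhere. -/
def Computes (c : Code) (f : List Bool →. ℝ) : Prop :=
  ∀ (σ : List Bool) (k : ℕ),
    ((c.eval (Encodable.encode (σ, k))).Dom ↔ (f σ).Dom) ∧
    ∀ n ∈ c.eval (Encodable.encode (σ, k)), ∀ v ∈ f σ,
      |(ratCode n : ℝ) - v| ≤ (2⁻¹ : ℝ) ^ k

/-- `c` computes the measure `ν` on Cantor space, given by its values on finite strings. -/
def ComputesMeasure (c : Code) (ν : List Bool → ℝ) : Prop :=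
  Computes c (fun σ => Part.some (ν σ)) ∧ (∀ σ, 0 ≤ ν σ) ∧
    ∀ σ, ν (σ ++ [false]) + ν (σ ++ [true]) = ν σ

section Space

variable {X : Type*} [MetricSpace X] [MeasurableSpace X]

/-- `d` computes the sequence `f` of computable functions `X → ℝ`: from `n` and a code of an
effectively open `W ⊆ ℝ` it finds a code of the effectively open set `f n ⁻¹' W`. -/
def ComputesFunctions (a : ℕ → X) (d : Code) (f : ℕ → X → ℝ) : Prop :=
  ∀ (n : ℕ) (e : Code), ∃ m ∈ d.eval (Nat.pair n (Encodable.encode e)),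
    f n ⁻¹' effOpen realPts e = effOpen a (Denumerable.ofNat Code m)

/-- `d` is a code of the lower semicomputable function `g : X → [0, ∞]`: it computes a sequence of
computable functions `X → [0, ∞)` with supremum `g`. -/
def ComputesLower (a : ℕ → X) (d : Code) (g : X → ℝ≥0∞) : Prop :=
  ∃ f : ℕ → X → ℝ, (∀ n x, 0 ≤ f n x) ∧ ComputesFunctions a d f ∧
    ∀ x, g x = ⨆ n, ENNReal.ofReal (f n x)

/-- `c` is a code of the computable sequence `U` of effectively open sets. -/
def ComputesOpens (a : ℕ → X) (c : Code) (U : ℕ → Set X) : Prop :=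
  ∀ n, ∃ m ∈ c.eval n, U n = effOpen a (Denumerable.ofNat Code m)

/-! ### Martingales -/

open Classical in
/-- The value of a partial function, under the convention that `undefined` counts as `0`; it
realizes the convention `undefined * 0 = 0` of the fairness condition. -/
def val (M : List Bool →. ℝ) (σ : List Bool) : ℝ := (M σ).getOrElse 0

variable {a : ℕ → X} {μ : Measure X}

/-- `M` is a martingale on the cells of `A`. -/
structure IsMartingale (A : CellDecomposition a μ) (M : List Bool →. ℝ) : Prop where
  nonneg : ∀ σ, ∀ v ∈ M σ, 0 ≤ v
  fair : ∀ σ, val M (σ ++ [false]) * μ.real (A.cell (σ ++ [false])) +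
    val M (σ ++ [true]) * μ.real (A.cell (σ ++ [true])) = val M σ * μ.real (A.cell σ)
  dom : ∀ σ, (M σ).Dom ↔ 0 < μ (A.cell σ)

/-- `f` is a savings function for `N`. -/
structure IsSavings (A : CellDecomposition a μ) (N f : List Bool →. ℝ) : Prop where
  nonneg : ∀ σ, ∀ v ∈ f σ, 0 ≤ v
  le : ∀ σ, ∀ v ∈ f σ, ∀ w ∈ N σ, v ≤ w ∧ w ≤ v + 1
  mono : ∀ σ τ, σ <+: τ → ∀ v ∈ f σ, ∀ w ∈ f τ, v ≤ w
  dom : ∀ σ, (f σ).Dom ↔ 0 < μ (A.cell σ)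

/-! ### The five tests

Each test is a predicate on `c` and `S`, saying that `c` is a code (a pair of codes) of a test of
that kind, and that `S` is the set of the points that fail the test. The predicate `P` stands for
an additional requirement on the bounding measure `ν`. -/

/-- Martingale test. Only the first component of the code is used. -/
def MartingaleTest (A : CellDecomposition a μ) (c : Code × Code) (S : Set X) : Prop :=
  ∃ M : List Bool →. ℝ, Computes c.1 M ∧ IsMartingale A M ∧
    S = {x | ∃ y, A.IsName x y ∧
      limsup (fun n => ENNReal.ofReal (val M (initSeg y n))) atTop = ⊤}

/-- Martingale test with savings property. -/
def SavingsTest (A : CellDecomposition a μ) (c : Code × Code) (S : Set X) : Prop :=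
  ∃ N f : List Bool →. ℝ, Computes c.1 N ∧ IsMartingale A N ∧ Computes c.2 f ∧ IsSavings A N f ∧
    S = {x | ∃ y, A.IsName x y ∧ Tendsto (fun n => val N (initSeg y n)) atTop atTop}

/-- Integral test bounded by a computable measure. -/
def IntegralTest (A : CellDecomposition a μ) (P : (List Bool → ℝ) → Prop) (c : Code × Code)
    (S : Set X) : Prop :=
  ∃ (ν : List Bool → ℝ) (g : X → ℝ≥0∞), ComputesMeasure c.1 ν ∧ P ν ∧ ComputesLower a c.2 g ∧
    (∀ σ, ∫⁻ x in A.cell σ, g x ∂μ ≤ ENNReal.ofReal (ν σ)) ∧ S = {x | g x = ⊤}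

/-- Bounded Martin-Löf test. -/
def BoundedMLTest (A : CellDecomposition a μ) (P : (List Bool → ℝ) → Prop) (c : Code × Code)
    (S : Set X) : Prop :=
  ∃ (ν : List Bool → ℝ) (U : ℕ → Set X), ComputesMeasure c.1 ν ∧ P ν ∧ ComputesOpens a c.2 U ∧
    (∀ n, μ.real (U n) ≤ (2⁻¹ : ℝ) ^ n) ∧
    (∀ n σ, μ.real (U n ∩ A.cell σ) ≤ (2⁻¹ : ℝ) ^ n * ν σ) ∧ S = {x | ∀ n, x ∈ U n}

/-- Bounded Vitali cover test. -/
def VitaliTest (A : CellDecomposition a μ) (P : (List Bool → ℝ) → Prop) (c : Code × Code)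
    (S : Set X) : Prop :=
  ∃ (ν : List Bool → ℝ) (V : ℕ → Set X), ComputesMeasure c.1 ν ∧ P ν ∧ ComputesOpens a c.2 V ∧
    (∑' n, μ (V n) < ⊤) ∧
    (∀ σ, ∑' n, μ (V n ∩ A.cell σ) ≤ ENNReal.ofReal (ν σ)) ∧
    S = {x | ∃ᶠ n in atTop, x ∈ V n}

/-- `ν` is a probability measure that satisfies the absolute-continuity condition
`ν(σ) ≤ ∫_[σ] h dμ` for some integrable `h`. -/
def ProbAC (A : CellDecomposition a μ) (ν : List Bool → ℝ) : Prop :=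
  ν [] = 1 ∧ ∃ h : X → ℝ, Integrable h μ ∧ ∀ σ, ν σ ≤ ∫ x in A.cell σ, h x ∂μ

inductive TestKind
  | martingale | savings | integral | boundedML | vitali

/-- The kinds of tests given by a martingale rather than by a bounding measure. -/
def TestKind.IsMartingaleKind : TestKind → Prop
  | .martingale | .savings => True
  | .integral | .boundedML | .vitali => False

/-- `c` is a code of a test of kind `k`, with bounding measure (if any) satisfying `P`, and `S` is
the set of points that fail it. -/
def IsTest (A : CellDecomposition a μ) (P : (List Bool → ℝ) → Prop) :
    TestKind → Code × Code → Set X → Prop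
  | .martingale => MartingaleTest A
  | .savings => SavingsTest A
  | .integral => IntegralTest A P
  | .boundedML => BoundedMLTest A P
  | .vitali => VitaliTest A P

/-- `x` fails some test of kind `k`, with bounding measure (if any) satisfying `P`. -/
def FailsSome (A : CellDecomposition a μ) (P : (List Bool → ℝ) → Prop) (k : TestKind) (x : X) :
    Prop :=
  ∃ c S, IsTest A P k c S ∧ x ∈ S

end Space

end CompRand

end

noncomputable section

namespace CompRand

open Nat.Partrec (Code)
open Encodable Denumerable

/-! ### Recursively enumerable predicates -/

section RE

variable {α β γ : Type*} [Primcodable α] [Primcodable β] [Primcodable γ]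

/-! All reductions pass through two hubs. The first is a computable measure `ν` on strings, together
with the points at which `ν(σ)/μ([σ])` is unbounded over their cells (`MeasureTest`). The second is
the Vitali cover test whose bounding measure is a probability measure with an integrable density
bound.

A martingale `M` yields the measure `M·μ`. Conversely, `ν` yields a martingale with savings. Keep an
active account that bets in proportion to a strictly positive perturbation of `ν`, and move to
savings whatever exceeds the mass of the cell. Let `w` be the fraction of the perturbed measure
still at stake and `s` the savings. When `w` shrinks by a factor `t > 1`, `s` grows by at least `min
t 2 - 1`. If `s` stayed bounded, then `w * exp s` would eventually be nondecreasing, so `w` would be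
bounded below and the ratio bounded (`tendsto_savings`). The part of a bet above twice the mass of a
child is spread over the whole parent cell. Hence no mass is lost in null cells, whose nullity is
not decidable, and fairness is exact (`stake_measure`).

The total capital `stake` lies between `saved * μ` and `(saved + 1) * μ`, and `saved` is
nondecreasing along cells. By monotone convergence the integral of `sup saved` over a cell is at
most `stake`. This gives both the integrable density (`exists_density`) and the maximal inequality
(`measureReal_exceed_le`), so the sets `{saved > 2 ^ (n + 2)}` form a Vitali cover test with a
normalizable bounding measure.

From a bounded Martin-Löf test `(U n)` the same construction catches the points with unbounded
ratio. Suppose instead that the ratio at `x` is bounded by `B < 2 ^ n`. Then no cell of `x` lies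
almost everywhere in `U n`, since its mass would be at most `2 ^ (-n) * ν < μ`. Take a ball in `U n`
and a smaller concentric ball containing `x`. Up to an exceptional set of small measure, cells of
some fixed level lie almost everywhere in `U n` or almost everywhere outside the smaller closed
ball. So `x` falls into an effectively open set that is almost covered by the few exceptional cells
(`exists_small_covers`). These sets are added to the Vitali test, and their masses to its bounding
measure. Shrinking cells are not needed here; they are needed only to pass from `(U n)` to unbounded
ratio.

The circle closes with the same bounding measure: the sum of the indicators of a Vitali cover is an
integral test, and the superlevel sets of an integral test are a bounded Martin-Löf test by Markov's
inequality.

For uniformity, reals are handled through r.e. rational cuts, correct under a promise `D` that the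
code is valid (`LSC`, `CR`). The main source of upper bounds is additivity: an additive lower
semicomputable family with computable total mass is computable (`CR.of_additive`). -/

/-- Step-bounded evaluation is primitive recursive, and conversely a witness is found by unbounded
search. With decidable witnesses, the closure properties below become pairing of witnesses. -/
theorem rePred_iff_exists_primrecPred {p : α → Prop} :
    REPred p ↔ ∃ K : α × ℕ → Prop, PrimrecPred K ∧ ∀ a, p a ↔ ∃ n, K (a, n) := by
  constructor
  · intro h
    obtain ⟨c, hc⟩ := Code.exists_code.1 h
    refine ⟨fun x => (Code.evaln x.2 c (encode x.1)).isSome = true,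
      Primrec.primrecPred (p := fun x : α × ℕ => (Code.evaln x.2 c (encode x.1)).isSome = true) ?_,
      fun a => ?_⟩
    · refine Primrec.of_eq (Primrec.option_isSome.comp (Code.primrec_evaln.comp
        (((Primrec.snd.pair (Primrec.const c)).pair (Primrec.encode.comp Primrec.fst))))) ?_
      intro x; simp
    · have h1 : p a ↔ (Code.eval c (encode a)).Dom := by
        rw [hc]; simp [Part.assert, Part.bind]
      rw [h1, Part.dom_iff_mem]
      constructor
      · rintro ⟨y, hy⟩
        obtain ⟨k, hk⟩ := Code.evaln_complete.1 hy
        exact ⟨k, by simp [Option.mem_def.1 hk]⟩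
      · rintro ⟨k, hk⟩
        obtain ⟨y, hy⟩ := Option.isSome_iff_exists.1 hk
        exact ⟨y, Code.evaln_sound hy⟩
  · rintro ⟨K, hK, h⟩
    classical
    have hT : Primrec₂ fun (a : α) (n : ℕ) => if K (a, n) then some () else none :=
      Primrec.ite hK (Primrec.const _) (Primrec.const _)
    refine ((Partrec.rfindOpt hT.to_comp).dom_re).of_eq fun a => ?_
    rw [h a, Nat.rfindOpt_dom]
    refine exists_congr fun n => ?_
    by_cases hn : K (a, n) <;> simp [hn]

theorem _root_.PrimrecPred.rePred {p : α → Prop} (h : PrimrecPred p) : REPred p :=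
  rePred_iff_exists_primrecPred.2 ⟨fun x => p x.1, h.comp Primrec.fst, fun a => by simp⟩

theorem _root_.REPred.comp {p : β → Prop} (h : REPred p) {f : α → β} (hf : Computable f) :
    REPred fun a => p (f a) :=
  Partrec.comp h hf

theorem _root_.REPred.and {p q : α → Prop} (hp : REPred p) (hq : REPred q) :
    REPred fun a => p a ∧ q a := by
  obtain ⟨K, hK, h⟩ := rePred_iff_exists_primrecPred.1 hp
  obtain ⟨K', hK', h'⟩ := rePred_iff_exists_primrecPred.1 hq
  refine rePred_iff_exists_primrecPred.2
    ⟨fun x => K (x.1, x.2.unpair.1) ∧ K' (x.1, x.2.unpair.2), ?_, fun a => ?_⟩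
  · have h1 := Primrec.unpair.comp (Primrec.snd (α := α) (β := ℕ))
    exact (hK.comp (Primrec.fst.pair (Primrec.fst.comp h1))).and
      (hK'.comp (Primrec.fst.pair (Primrec.snd.comp h1)))
  · rw [h a, h' a]
    constructor
    · rintro ⟨⟨m, hm⟩, ⟨n, hn⟩⟩
      exact ⟨Nat.pair m n, by simpa using ⟨hm, hn⟩⟩
    · rintro ⟨n, h1, h2⟩
      exact ⟨⟨_, h1⟩, ⟨_, h2⟩⟩

theorem _root_.REPred.or {p q : α → Prop} (hp : REPred p) (hq : REPred q) :
    REPred fun a => p a ∨ q a := by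
  obtain ⟨K, hK, h⟩ := rePred_iff_exists_primrecPred.1 hp
  obtain ⟨K', hK', h'⟩ := rePred_iff_exists_primrecPred.1 hq
  refine rePred_iff_exists_primrecPred.2 ⟨fun x => K x ∨ K' x, hK.or hK', fun a => ?_⟩
  rw [h a, h' a, exists_or]

theorem _root_.REPred.exists {p : α × β → Prop} (hp : REPred p) :
    REPred fun a => ∃ b, p (a, b) := by
  obtain ⟨K, hK, h⟩ := rePred_iff_exists_primrecPred.1 hp
  classical
  refine rePred_iff_exists_primrecPred.2
    ⟨fun x => ((decode (α := β) x.2.unpair.1).bind fun b =>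
      if K ((x.1, b), x.2.unpair.2) then some () else none).isSome = true, ?_, fun a => ?_⟩
  · refine Primrec.primrecPred (p := fun x : α × ℕ => _) ?_
    refine Primrec.of_eq (Primrec.option_isSome.comp (Primrec.option_bind
      (f := fun x : α × ℕ => (decode (α := β) x.2.unpair.1))
      (g := fun x b => if K ((x.1, b), x.2.unpair.2) then some () else none) ?_ ?_)) ?_
    · exact Primrec.decode.comp (Primrec.fst.comp (Primrec.unpair.comp Primrec.snd))
    · refine Primrec.ite (hK.comp ?_) (Primrec.const _) (Primrec.const _)
      exact ((Primrec.fst.comp Primrec.fst).pair Primrec.snd).pair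
        (Primrec.snd.comp (Primrec.unpair.comp (Primrec.snd.comp Primrec.fst)))
    · intro x; simp
  · constructor
    · rintro ⟨b, hb⟩
      obtain ⟨n, hn⟩ := (h _).1 hb
      exact ⟨Nat.pair (encode b) n, by simp [hn]⟩
    · rintro ⟨n, hn⟩
      obtain ⟨u, hu⟩ := Option.isSome_iff_exists.1 hn
      obtain ⟨b, -, hb⟩ := Option.bind_eq_some_iff.1 hu
      refine ⟨b, (h _).2 ⟨n.unpair.2, ?_⟩⟩
      by_contra hK
      simp [hK] at hb

/-- The witnesses for the finitely many entries have a common bound, and that bound serves as a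
single witness. -/
theorem _root_.REPred.forall_mem {p : α × β → Prop} (hp : REPred p) :
    REPred fun x : α × List β => ∀ b ∈ x.2, p (x.1, b) := by
  obtain ⟨K, hK, h⟩ := rePred_iff_exists_primrecPred.1 hp
  refine rePred_iff_exists_primrecPred.2
    ⟨fun x => ∀ b ∈ x.1.2, ∃ k ∈ List.range x.2, K ((x.1.1, b), k), ?_, fun a => ?_⟩
  · have h1 : PrimrecRel fun (k : ℕ) (y : (α × β)) => K (y, k) :=
      hK.comp (Primrec.snd.pair Primrec.fst)
    have h2 : PrimrecRel fun (b : β) (y : α × ℕ) => ∃ k ∈ List.range y.2, K ((y.1, b), k) :=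
      PrimrecRel.comp (R := fun (l : List ℕ) (y : α × β) => ∃ k ∈ l, K (y, k))
        (f := fun z : β × (α × ℕ) => List.range z.2.2) (g := fun z : β × (α × ℕ) => (z.2.1, z.1))
        (PrimrecRel.exists_mem_list h1) (Primrec.list_range.comp (Primrec.snd.comp Primrec.snd))
        ((Primrec.fst.comp Primrec.snd).pair Primrec.fst)
    exact (PrimrecRel.forall_mem_list h2).comp (Primrec.snd.comp Primrec.fst)
        ((Primrec.fst.comp Primrec.fst).pair Primrec.snd)
  · constructor
    · intro H
      choose! f hf using fun b hb => (h _).1 (H b hb)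
      -- The sum bounds every witness; one more is needed because `List.range` excludes its end.
      refine ⟨(a.2.map f).sum + 1, fun b hb => ⟨f b, ?_, hf b hb⟩⟩
      exact List.mem_range.2 <| Nat.lt_succ_of_le (List.single_le_sum (by simp) _ (List.mem_map_of_mem hb))
    · rintro ⟨n, hn⟩ b hb
      obtain ⟨k, -, hk⟩ := hn b hb
      exact (h _).2 ⟨k, hk⟩

/-- Two computable functions agreeing is r.e. -/
theorem rePred_eq {f g : α → β} (hf : Computable f) (hg : Computable g) :
    REPred fun a => f a = g a := by
  exact REPred.comp (p := fun x : β × β => x.1 = x.2) (PrimrecPred.rePred Primrec.eq)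
    (hf.pair hg)

theorem rePred_mem_eval : REPred fun x : (Code × ℕ) × ℕ => x.2 ∈ x.1.1.eval x.1.2 := by
  refine rePred_iff_exists_primrecPred.2
    ⟨fun x => Code.evaln x.2 x.1.1.1 x.1.1.2 = some x.1.2, ?_, fun a => ?_⟩
  · refine PrimrecRel.comp Primrec.eq (Code.primrec_evaln.comp
      (g := fun x : ((Code × ℕ) × ℕ) × ℕ => ((x.2, x.1.1.1), x.1.1.2)) ?_) ?_
    · exact (Primrec.snd.pair (Primrec.fst.comp (Primrec.fst.comp Primrec.fst))).pair
        (Primrec.snd.comp (Primrec.fst.comp Primrec.fst))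
    · exact Primrec.option_some.comp (Primrec.snd.comp Primrec.fst)
  · exact Code.evaln_complete

/-- The `s`-`m`-`n` theorem for binary partial recursive functions. -/
theorem exists_code_of_partrec {f : α × β →. ℕ} (hf : Partrec f) :
    ∃ F : α → Code, Computable F ∧ ∀ a b, (F a).eval (encode b) = f (a, b) := by
  obtain ⟨c, hc⟩ := Code.exists_code.1 hf
  refine ⟨fun a => Code.curry c (encode a),
    Code.primrec₂_curry.to_comp.comp (Computable.const c) Computable.encode, fun a b => ?_⟩
  rw [Code.eval_curry, hc]
  have : Nat.pair (encode a) (encode b) = encode (a, b) := rfl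
  rw [this]
  simp only [encodek, Part.coe_some, Part.bind_some]
  exact Part.map_id' (fun _ => rfl) _

/-- Uniformization of an r.e. relation by a partial recursive function. -/
theorem exists_partrec_of_rePred {p : α × β → Prop} (hp : REPred p) :
    ∃ f : α →. β, Partrec f ∧ (∀ a, (f a).Dom ↔ ∃ b, p (a, b)) ∧
      ∀ a, ∀ b ∈ f a, p (a, b) := by
  obtain ⟨K, hK, h⟩ := rePred_iff_exists_primrecPred.1 hp
  classical
  let T : α → ℕ → Option β := fun a n => (decode (α := β) n.unpair.1).bind fun b =>
      if K ((a, b), n.unpair.2) then some b else none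
  have hT : Primrec₂ T := by
    refine Primrec.option_bind
      (f := fun x : α × ℕ => (decode (α := β) x.2.unpair.1))
      (g := fun x b => if K ((x.1, b), x.2.unpair.2) then some b else none) ?_ ?_
    · exact Primrec.decode.comp (Primrec.fst.comp (Primrec.unpair.comp Primrec.snd))
    · refine Primrec.ite (hK.comp ?_) (Primrec.option_some.comp Primrec.snd) (Primrec.const _)
      exact ((Primrec.fst.comp Primrec.fst).pair Primrec.snd).pair
        (Primrec.snd.comp (Primrec.unpair.comp (Primrec.snd.comp Primrec.fst)))
  have hTs : ∀ a n b, b ∈ T a n → p (a, b) := by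
    intro a n b hb
    obtain ⟨b', -, hb'⟩ := Option.bind_eq_some_iff.1 hb
    by_cases hk : K ((a, b'), n.unpair.2)
    · simp only [hk, if_true, Option.some.injEq] at hb'
      subst hb'
      exact (h _).2 ⟨_, hk⟩
    · simp [hk] at hb'
  refine ⟨fun a => Nat.rfindOpt (T a), Partrec.rfindOpt hT.to_comp, fun a => ?_, fun a b hb => ?_⟩
  · rw [Nat.rfindOpt_dom]
    constructor
    · rintro ⟨n, b, hb⟩; exact ⟨b, hTs a n b hb⟩
    · rintro ⟨b, hb⟩
      obtain ⟨n, hn⟩ := (h _).1 hb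
      exact ⟨Nat.pair (encode b) n, b, by simp [T, hn]⟩
  · obtain ⟨n, hn⟩ := Nat.rfindOpt_spec hb
    exact hTs a n b hn

/-- On the inputs satisfying `D`, the graph of `g` is r.e.; that is, `g` is partial recursive with
the promise `D`. -/
def GComp (D : α → Prop) (g : α → β) : Prop :=
  ∃ G : α × β → Prop, REPred G ∧ ∀ a, D a → ∀ b, G (a, b) ↔ b = g a

theorem _root_.Computable.gComp {g : α → β} (hg : Computable g) (D : α → Prop) : GComp D g :=
  ⟨fun x => x.2 = g x.1, rePred_eq Computable.snd (hg.comp Computable.fst), fun _ _ _ => Iff.rfl⟩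

/-- An r.e. predicate (with a promise) may be composed with a function computable on the promise. -/
theorem _root_.REPred.exists_comp_gComp {p : β → Prop} (hp : REPred p) {D : α → Prop} {g : α → β}
    (hg : GComp D g) : ∃ q : α → Prop, REPred q ∧ ∀ a, D a → (q a ↔ p (g a)) := by
  obtain ⟨G, hG, H⟩ := hg
  refine ⟨fun a => ∃ b, G (a, b) ∧ p b, REPred.exists (hG.and (hp.comp Computable.snd)),
    fun a ha => ?_⟩
  simp [H a ha]

theorem GComp.comp {D : α → Prop} {D' : β → Prop} {g : β → γ} {f : α → β} (hg : GComp D' g)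
    (hf : GComp D f) (h : ∀ a, D a → D' (f a)) : GComp D fun a => g (f a) := by
  obtain ⟨G, hG, H⟩ := hg
  obtain ⟨F, hF, H'⟩ := hf
  refine ⟨fun x => ∃ b, F (x.1, b) ∧ G (b, x.2), REPred.exists (p := fun y : (α × γ) × β =>
    F (y.1.1, y.2) ∧ G (y.2, y.1.2)) ((hF.comp ?_).and (hG.comp ?_)), fun a ha b => ?_⟩
  · exact (Computable.fst.comp Computable.fst).pair Computable.snd
  · exact Computable.snd.pair (Computable.snd.comp Computable.fst)
  · simp [H' a ha, H _ (h a ha)]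

theorem GComp.pair {D : α → Prop} {f : α → β} {g : α → γ} (hf : GComp D f) (hg : GComp D g) :
    GComp D fun a => (f a, g a) := by
  obtain ⟨G, hG, H⟩ := hg
  obtain ⟨F, hF, H'⟩ := hf
  refine ⟨fun x => F (x.1, x.2.1) ∧ G (x.1, x.2.2), (hF.comp ?_).and (hG.comp ?_),
    fun a ha b => ?_⟩
  · exact Computable.fst.pair (Computable.fst.comp Computable.snd)
  · exact Computable.fst.pair (Computable.snd.comp Computable.snd)
  · simp [H a ha, H' a ha, Prod.ext_iff]

/-- Effective choice: from an r.e. relation, total on the promise, a choice function computable on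
the promise. -/
theorem exists_gComp_choice [Inhabited β] {D : α → Prop} {p : α × β → Prop} (hp : REPred p)
    (h : ∀ a, D a → ∃ b, p (a, b)) : ∃ g : α → β, GComp D g ∧ ∀ a, D a → p (a, g a) := by
  obtain ⟨f, hf, hd, hs⟩ := exists_partrec_of_rePred hp
  classical
  -- The graph is the domain of the program that runs `f` and halts only if the output is the given
  -- value.
  have hG : Partrec fun x : α × β => (f x.1).bind fun b =>
      cond (decide (x.2 = b)) (Part.some ()) Part.none := by
    refine Partrec.bind (hf.comp Computable.fst) ?_
    refine Partrec.cond ?_ (Computable.const ()).partrec Partrec.none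
    exact (Primrec.eq.decide.comp (Primrec.snd.comp Primrec.fst) Primrec.snd).to_comp
  refine ⟨fun a => if ha : (f a).Dom then (f a).get ha else default, ⟨_, hG.dom_re,
    fun a ha b => ?_⟩, fun a ha => ?_⟩
  · have hda := (hd a).2 (h a ha)
    simp only [hda, dite_true]
    constructor
    · rintro ⟨h1, h3⟩
      by_contra hb
      simp [hb] at h3
    · intro hb
      exact ⟨hda, by simp [hb]⟩
  · have hda := (hd a).2 (h a ha)
    simp only [hda, dite_true]
    exact hs a _ (Part.get_mem hda)

end RE

/-! ### Arithmetic on codes of rationals -/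

def ratMk (u v w : ℕ) : ℕ := Nat.pair (Nat.pair u v) w

theorem ratCode_ratMk (u v w : ℕ) : ratCode (ratMk u v w) = ((u : ℚ) - v) / (w + 1) := by
  simp [ratCode, ratMk]

theorem ratCode_surjective : Function.Surjective ratCode := by
  intro q
  refine ⟨ratMk q.num.toNat (-q.num).toNat (q.den - 1), ?_⟩
  rw [ratCode_ratMk]
  have h1 : ((q.num.toNat : ℚ) - ((-q.num).toNat : ℚ)) = q.num := by
    have : ((q.num.toNat : ℤ) - ((-q.num).toNat : ℤ)) = q.num := by omega
    exact_mod_cast congrArg (Int.cast : ℤ → ℚ) this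
  have h2 : (((q.den - 1 : ℕ) : ℚ) + 1) = q.den := by
    have := q.den_pos
    exact_mod_cast (by omega : q.den - 1 + 1 = q.den)
  rw [h1, h2, Rat.num_div_den]

theorem exists_ratCode_between {x y : ℝ} (h : x < y) :
    ∃ n, x < (ratCode n : ℝ) ∧ (ratCode n : ℝ) < y := by
  obtain ⟨q, h1, h2⟩ := exists_rat_btwn h
  obtain ⟨n, rfl⟩ := ratCode_surjective q
  exact ⟨n, h1, h2⟩

def ratNum (n : ℕ) : ℕ := n.unpair.1.unpair.1
def ratSub (n : ℕ) : ℕ := n.unpair.1.unpair.2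
def ratDen (n : ℕ) : ℕ := n.unpair.2

theorem ratCode_eq (n : ℕ) : ratCode n = ((ratNum n : ℚ) - ratSub n) / (ratDen n + 1) := rfl

theorem primrec_ratNum : Primrec ratNum :=
  Primrec.fst.comp (Primrec.unpair.comp (Primrec.fst.comp Primrec.unpair))
theorem primrec_ratSub : Primrec ratSub :=
  Primrec.snd.comp (Primrec.unpair.comp (Primrec.fst.comp Primrec.unpair))
theorem primrec_ratDen : Primrec ratDen := Primrec.snd.comp Primrec.unpair

section
variable {α : Type*} [Primcodable α]

theorem primrec_ratMk {f g h : α → ℕ} (hf : Primrec f) (hg : Primrec g) (hh : Primrec h) :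
    Primrec fun a => ratMk (f a) (g a) (h a) :=
  Primrec₂.natPair.comp (Primrec₂.natPair.comp hf hg) hh
end

/-- The last entry stores the denominator minus one, whence `(u + 1) * (v + 1) - 1 = u * v + u + v`.
-/
def ratAdd (m n : ℕ) : ℕ :=
  ratMk (ratNum m * (ratDen n + 1) + ratNum n * (ratDen m + 1))
    (ratSub m * (ratDen n + 1) + ratSub n * (ratDen m + 1))
    (ratDen m * ratDen n + ratDen m + ratDen n)

def ratMul (m n : ℕ) : ℕ :=
  ratMk (ratNum m * ratNum n + ratSub m * ratSub n) (ratNum m * ratSub n + ratSub m * ratNum n)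
    (ratDen m * ratDen n + ratDen m + ratDen n)

def ratNeg (n : ℕ) : ℕ := ratMk (ratSub n) (ratNum n) (ratDen n)

theorem ratCode_ratAdd (m n : ℕ) : ratCode (ratAdd m n) = ratCode m + ratCode n := by
  rw [ratAdd, ratCode_ratMk, ratCode_eq, ratCode_eq]
  have h1 : ((ratDen m : ℚ) + 1) ≠ 0 := by positivity
  have h2 : ((ratDen n : ℚ) + 1) ≠ 0 := by positivity
  have h3 : ((ratDen m * ratDen n + ratDen m + ratDen n : ℕ) : ℚ) + 1
      = ((ratDen m : ℚ) + 1) * (ratDen n + 1) := by push_cast; ring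
  rw [h3]; field_simp; push_cast; ring

theorem ratCode_ratMul (m n : ℕ) : ratCode (ratMul m n) = ratCode m * ratCode n := by
  rw [ratMul, ratCode_ratMk, ratCode_eq, ratCode_eq]
  have h1 : ((ratDen m : ℚ) + 1) ≠ 0 := by positivity
  have h2 : ((ratDen n : ℚ) + 1) ≠ 0 := by positivity
  have h3 : ((ratDen m * ratDen n + ratDen m + ratDen n : ℕ) : ℚ) + 1
      = ((ratDen m : ℚ) + 1) * (ratDen n + 1) := by push_cast; ring
  rw [h3]; field_simp; push_cast; ring

theorem ratCode_ratNeg (n : ℕ) : ratCode (ratNeg n) = -ratCode n := by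
  rw [ratNeg, ratCode_ratMk, ratCode_eq, ← neg_div, neg_sub]

theorem primrec_ratAdd : Primrec₂ ratAdd := by
  have a1 := primrec_ratNum.comp (Primrec.fst (α := ℕ) (β := ℕ))
  have a2 := primrec_ratSub.comp (Primrec.fst (α := ℕ) (β := ℕ))
  have a3 := primrec_ratDen.comp (Primrec.fst (α := ℕ) (β := ℕ))
  have b1 := primrec_ratNum.comp (Primrec.snd (α := ℕ) (β := ℕ))
  have b2 := primrec_ratSub.comp (Primrec.snd (α := ℕ) (β := ℕ))
  have b3 := primrec_ratDen.comp (Primrec.snd (α := ℕ) (β := ℕ))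
  have a4 := Primrec.succ.comp a3
  have b4 := Primrec.succ.comp b3
  exact primrec_ratMk
    (Primrec.nat_add.comp (Primrec.nat_mul.comp a1 b4) (Primrec.nat_mul.comp b1 a4))
    (Primrec.nat_add.comp (Primrec.nat_mul.comp a2 b4) (Primrec.nat_mul.comp b2 a4))
    (Primrec.nat_add.comp (Primrec.nat_add.comp (Primrec.nat_mul.comp a3 b3) a3) b3)

theorem primrec_ratMul : Primrec₂ ratMul := by
  have a1 := primrec_ratNum.comp (Primrec.fst (α := ℕ) (β := ℕ))
  have a2 := primrec_ratSub.comp (Primrec.fst (α := ℕ) (β := ℕ))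
  have a3 := primrec_ratDen.comp (Primrec.fst (α := ℕ) (β := ℕ))
  have b1 := primrec_ratNum.comp (Primrec.snd (α := ℕ) (β := ℕ))
  have b2 := primrec_ratSub.comp (Primrec.snd (α := ℕ) (β := ℕ))
  have b3 := primrec_ratDen.comp (Primrec.snd (α := ℕ) (β := ℕ))
  exact primrec_ratMk
    (Primrec.nat_add.comp (Primrec.nat_mul.comp a1 b1) (Primrec.nat_mul.comp a2 b2))
    (Primrec.nat_add.comp (Primrec.nat_mul.comp a1 b2) (Primrec.nat_mul.comp a2 b1))
    (Primrec.nat_add.comp (Primrec.nat_add.comp (Primrec.nat_mul.comp a3 b3) a3) b3)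

theorem primrec_ratNeg : Primrec ratNeg :=
  primrec_ratMk primrec_ratSub primrec_ratNum primrec_ratDen

/-- Cross-multiply and move the subtracted parts to the other side; the comparison then takes place
in `ℕ`. -/
theorem primrecRel_ratLT : PrimrecRel fun m n => ratCode m < ratCode n := by
  have a1 := primrec_ratNum.comp (Primrec.fst (α := ℕ) (β := ℕ))
  have a2 := primrec_ratSub.comp (Primrec.fst (α := ℕ) (β := ℕ))
  have a4 := Primrec.succ.comp <| primrec_ratDen.comp (Primrec.fst (α := ℕ) (β := ℕ))
  have b1 := primrec_ratNum.comp (Primrec.snd (α := ℕ) (β := ℕ))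
  have b2 := primrec_ratSub.comp (Primrec.snd (α := ℕ) (β := ℕ))
  have b4 := Primrec.succ.comp <| primrec_ratDen.comp (Primrec.snd (α := ℕ) (β := ℕ))
  have := Primrec.nat_lt.comp
    (Primrec.nat_add.comp (Primrec.nat_mul.comp a1 b4) (Primrec.nat_mul.comp b2 a4))
    (Primrec.nat_add.comp (Primrec.nat_mul.comp b1 a4) (Primrec.nat_mul.comp a2 b4))
  refine this.of_eq fun x => ?_
  show _ ↔ ratCode x.1 < ratCode x.2
  rw [ratCode_eq, ratCode_eq, div_lt_div_iff₀ (by positivity) (by positivity)]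
  simp only [Nat.succ_eq_add_one]
  rw [← Nat.cast_lt (α := ℚ)]
  push_cast
  constructor <;> intro h <;> linarith

section
variable {α : Type*} [Primcodable α]

theorem rePred_ratLT {f g : α → ℕ} (hf : Computable f) (hg : Computable g) :
    REPred fun a => (ratCode (f a) : ℝ) < ratCode (g a) :=
  (REPred.comp (p := fun x : ℕ × ℕ => ratCode x.1 < ratCode x.2)
    (PrimrecPred.rePred primrecRel_ratLT) (hf.pair hg)).of_eq fun a => by simp
end

def ratMax (m n : ℕ) : ℕ := if ratCode m < ratCode n then n else m
def ratMin (m n : ℕ) : ℕ := if ratCode m < ratCode n then m else n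

theorem primrec_ratMax : Primrec₂ ratMax :=
  Primrec.ite primrecRel_ratLT Primrec.snd Primrec.fst
theorem primrec_ratMin : Primrec₂ ratMin :=
  Primrec.ite primrecRel_ratLT Primrec.fst Primrec.snd

theorem ratCode_ratMax (m n : ℕ) : ratCode (ratMax m n) = max (ratCode m) (ratCode n) := by
  unfold ratMax; split_ifs with h
  · exact (max_eq_right h.le).symm
  · exact (max_eq_left (not_lt.1 h)).symm

theorem ratCode_ratMin (m n : ℕ) : ratCode (ratMin m n) = min (ratCode m) (ratCode n) := by
  unfold ratMin; split_ifs with h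
  · exact (min_eq_left h.le).symm
  · exact (min_eq_right (not_lt.1 h)).symm

/-- A code of the natural number `n`. -/
def ratNat (n : ℕ) : ℕ := ratMk n 0 0

theorem ratCode_ratNat (n : ℕ) : ratCode (ratNat n) = n := by simp [ratNat, ratCode_ratMk]

theorem primrec_ratNat : Primrec ratNat :=
  primrec_ratMk Primrec.id (Primrec.const 0) (Primrec.const 0)

/-- A code of `2 ^ (-k)`. -/
def ratPow (k : ℕ) : ℕ := ratMk 1 0 (2 ^ k - 1)

theorem ratCode_ratPow (k : ℕ) : ratCode (ratPow k) = 2⁻¹ ^ k := by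
  have h : (((2 ^ k - 1 : ℕ) : ℚ) + 1) = 2 ^ k := by
    have := Nat.one_le_two_pow (n := k)
    push_cast [Nat.cast_sub this]; ring
  rw [ratPow, ratCode_ratMk, h]; simp

theorem primrec_two_pow : Primrec fun k : ℕ => 2 ^ k :=
  (Primrec₂.unpaired'.1 Nat.Primrec.pow).comp (Primrec.const 2) Primrec.id

theorem primrec_ratPow : Primrec ratPow :=
  primrec_ratMk (Primrec.const 1) (Primrec.const 0)
    (Primrec.nat_sub.comp primrec_two_pow (Primrec.const 1))

theorem ratCode_ratPow_real (k : ℕ) : ((ratCode (ratPow k) : ℚ) : ℝ) = 2⁻¹ ^ k := by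
  rw [ratCode_ratPow]; push_cast; rfl

/-! ### Lower semicomputable and computable families of reals -/

section LSC

variable {α β γ : Type*} [Primcodable α] [Primcodable β] [Primcodable γ]

/-- The reals `f p` are lower semicomputable, uniformly in `p`, provided that `D p`. -/
def LSC (D : α → Prop) (f : α → ℝ) : Prop :=
  ∃ R : α × ℕ → Prop, REPred R ∧ ∀ p, D p → ∀ q, R (p, q) ↔ (ratCode q : ℝ) < f p

/-- The reals `f p` are computable, uniformly in `p`, provided that `D p`. -/
def CR (D : α → Prop) (f : α → ℝ) : Prop := LSC D f ∧ LSC D fun p => -f p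

variable {D : α → Prop} {f g : α → ℝ}

theorem LSC.mono {D' : α → Prop} (hf : LSC D f) (h : ∀ p, D' p → D p) : LSC D' f := by
  obtain ⟨R, hR, H⟩ := hf
  exact ⟨R, hR, fun p hp => H p (h p hp)⟩

theorem LSC.congr (hf : LSC D f) (h : ∀ p, D p → f p = g p) : LSC D g := by
  obtain ⟨R, hR, H⟩ := hf
  exact ⟨R, hR, fun p hp => by rw [← h p hp]; exact H p hp⟩

theorem LSC.comp_gComp {D : β → Prop} {f : β → ℝ} (hf : LSC D f) {D' : α → Prop} {g : α → β}
    (hg : GComp D' g) (h : ∀ p, D' p → D (g p)) : LSC D' fun p => f (g p) := by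
  obtain ⟨R, hR, H⟩ := hf
  obtain ⟨G, hG, H'⟩ := hg
  refine ⟨fun x => ∃ b, G (x.1, b) ∧ R (b, x.2), REPred.exists (p := fun y : (α × ℕ) × β =>
    G (y.1.1, y.2) ∧ R (y.2, y.1.2)) ((hG.comp ?_).and (hR.comp ?_)), fun p hp q => ?_⟩
  · exact (Computable.fst.comp Computable.fst).pair Computable.snd
  · exact Computable.snd.pair (Computable.snd.comp Computable.fst)
  · simp [H' p hp, H _ (h p hp)]

theorem LSC.comp {D : β → Prop} {f : β → ℝ} (hf : LSC D f) {g : α → β} (hg : Computable g) :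
    LSC (fun p => D (g p)) fun p => f (g p) :=
  hf.comp_gComp (hg.gComp _) fun _ h => h

/-- Membership in a strict upper or lower cut is r.e. -/
theorem LSC.exists_rePred (hf : LSC D f) {g : α → ℕ} (hg : Computable g) :
    ∃ R : α → Prop, REPred R ∧ ∀ p, D p → (R p ↔ (ratCode (g p) : ℝ) < f p) := by
  obtain ⟨R, hR, H⟩ := hf
  exact ⟨fun p => R (p, g p), hR.comp (Computable.id.pair hg), fun p hp => H p hp _⟩

/-- The supremum is expressed through strict lower cuts, so no boundedness has to be carried for a
real `⨆`. -/
theorem LSC.iSup {G : α × β → ℝ} (hG : LSC (fun x => D x.1) G)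
    (h : ∀ p, D p → ∀ q : ℝ, q < f p ↔ ∃ n, q < G (p, n)) : LSC D f := by
  obtain ⟨R, hR, H⟩ := hG
  refine ⟨fun x => ∃ n, R ((x.1, n), x.2), REPred.exists (p := fun y : (α × ℕ) × β =>
    R ((y.1.1, y.2), y.1.2)) (hR.comp ?_), fun p hp q => ?_⟩
  · exact ((Computable.fst.comp Computable.fst).pair Computable.snd).pair
      (Computable.snd.comp Computable.fst)
  · simp only [h p hp]
    exact exists_congr fun n => H (p, n) hp q

/-- By monotonicity, rational lower bounds of the arguments give lower bounds of the value; by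
continuity these come arbitrarily close to it. -/
theorem LSC.map₂ {F : ℝ → ℝ → ℝ} {op : ℕ → ℕ → ℕ} (hop : Primrec₂ op)
    (hF : ∀ m n, (ratCode (op m n) : ℝ) = F (ratCode m) (ratCode n))
    (hmono : ∀ x x' y y', x ≤ x' → y ≤ y' → F x y ≤ F x' y')
    (hcont : Continuous fun z : ℝ × ℝ => F z.1 z.2)
    (hf : LSC D f) (hg : LSC D g) : LSC D fun p => F (f p) (g p) := by
  obtain ⟨R, hR, H⟩ := hf
  obtain ⟨R', hR', H'⟩ := hg
  refine ⟨fun x => ∃ mn : ℕ × ℕ, (R (x.1, mn.1) ∧ R' (x.1, mn.2)) ∧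
    (ratCode x.2 : ℝ) < ratCode (op mn.1 mn.2), REPred.exists (p := fun y : (α × ℕ) × (ℕ × ℕ) =>
    (R (y.1.1, y.2.1) ∧ R' (y.1.1, y.2.2)) ∧ (ratCode y.1.2 : ℝ) < ratCode (op y.2.1 y.2.2))
    (((hR.comp ?_).and (hR'.comp ?_)).and (rePred_ratLT ?_ ?_)), fun p hp q => ?_⟩
  · exact (Computable.fst.comp Computable.fst).pair (Computable.fst.comp Computable.snd)
  · exact (Computable.fst.comp Computable.fst).pair (Computable.snd.comp Computable.snd)
  · exact Computable.snd.comp Computable.fst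
  · exact hop.to_comp.comp (Computable.fst.comp Computable.snd)
      (Computable.snd.comp Computable.snd)
  · simp only [H p hp, H' p hp, hF]
    constructor
    · rintro ⟨⟨m, n⟩, ⟨h1, h2⟩, h3⟩
      exact h3.trans_le (hmono _ _ _ _ h1.le h2.le)
    · intro h
      have ho : IsOpen {z : ℝ × ℝ | (ratCode q : ℝ) < F z.1 z.2} :=
        isOpen_lt continuous_const hcont
      obtain ⟨ε, hε, hb⟩ := Metric.isOpen_iff.1 ho (f p, g p) h
      obtain ⟨m, hm1, hm2⟩ := exists_ratCode_between (show f p - ε < f p by linarith)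
      obtain ⟨n, hn1, hn2⟩ := exists_ratCode_between (show g p - ε < g p by linarith)
      have hmem : ((ratCode m : ℝ), (ratCode n : ℝ)) ∈ Metric.ball (f p, g p) ε := ?_
      · exact ⟨(m, n), ⟨hm2, hn2⟩, hb hmem⟩
      rw [Metric.mem_ball, Prod.dist_eq, max_lt_iff, Real.dist_eq, Real.dist_eq, abs_lt, abs_lt]
      dsimp only
      constructor <;> constructor <;> linarith

theorem LSC.add (hf : LSC D f) (hg : LSC D g) : LSC D fun p => f p + g p :=
  LSC.map₂ primrec_ratAdd (fun m n => by rw [ratCode_ratAdd]; push_cast; rfl)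
    (fun _ _ _ _ h h' => add_le_add h h') (by fun_prop) hf hg

theorem LSC.min (hf : LSC D f) (hg : LSC D g) : LSC D fun p => min (f p) (g p) :=
  LSC.map₂ primrec_ratMin (fun m n => by rw [ratCode_ratMin]; push_cast; rfl)
    (fun _ _ _ _ h h' => min_le_min h h') (by fun_prop) hf hg

theorem LSC.max (hf : LSC D f) (hg : LSC D g) : LSC D fun p => max (f p) (g p) :=
  LSC.map₂ primrec_ratMax (fun m n => by rw [ratCode_ratMax]; push_cast; rfl)
    (fun _ _ _ _ h h' => max_le_max h h') (by fun_prop) hf hg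

theorem ratCode_ratNat_zero : ratCode (ratNat 0) = 0 := by simp [ratCode_ratNat]

/-- Multiplication is not monotone on all of `ℝ`, but the product of positive parts is, and it
agrees with the product on the promise. -/
theorem LSC.mul (hf : LSC D f) (hg : LSC D g) (hf0 : ∀ p, D p → 0 ≤ f p)
    (hg0 : ∀ p, D p → 0 ≤ g p) : LSC D fun p => f p * g p := by
  refine (LSC.map₂ (F := fun x y => Max.max x 0 * Max.max y 0)
    (op := fun m n => ratMul (ratMax m (ratNat 0)) (ratMax n (ratNat 0))) ?_ ?_ ?_ (by fun_prop)
    hf hg).congr fun p hp => by simp only [max_eq_left (hf0 p hp), max_eq_left (hg0 p hp)]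
  · exact primrec_ratMul.comp (primrec_ratMax.comp Primrec.fst (Primrec.const _))
      (primrec_ratMax.comp Primrec.snd (Primrec.const _))
  · intro m n
    rw [ratCode_ratMul, ratCode_ratMax, ratCode_ratMax, ratCode_ratNat_zero]; push_cast; rfl
  · intro x x' y y' h h'
    exact mul_le_mul (max_le_max h le_rfl) (max_le_max h' le_rfl) (le_max_right _ _)
      (le_max_right _ _)

theorem LSC.neg_mul (hf : LSC D fun p => -f p) (hg : LSC D fun p => -g p)
    (hf0 : ∀ p, D p → 0 ≤ f p) (hg0 : ∀ p, D p → 0 ≤ g p) : LSC D fun p => -(f p * g p) := by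
  refine (LSC.map₂ (F := fun x y => -(Max.max (-x) 0 * Max.max (-y) 0))
    (op := fun m n => ratNeg (ratMul (ratMax (ratNeg m) (ratNat 0)) (ratMax (ratNeg n) (ratNat 0))))
    ?_ ?_ ?_ (by fun_prop)
    hf hg).congr fun p hp => by simp only [neg_neg, max_eq_left (hf0 p hp), max_eq_left (hg0 p hp)]
  · exact primrec_ratNeg.comp (primrec_ratMul.comp
      (primrec_ratMax.comp (primrec_ratNeg.comp Primrec.fst) (Primrec.const _))
      (primrec_ratMax.comp (primrec_ratNeg.comp Primrec.snd) (Primrec.const _)))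
  · intro m n
    rw [ratCode_ratNeg, ratCode_ratMul, ratCode_ratMax, ratCode_ratMax, ratCode_ratNat_zero,
      ratCode_ratNeg, ratCode_ratNeg]
    push_cast; rfl
  · intro x x' y y' h h'
    exact neg_le_neg (mul_le_mul (max_le_max (neg_le_neg h) le_rfl)
      (max_le_max (neg_le_neg h') le_rfl) (le_max_right _ _) (le_max_right _ _))

theorem LSC.ratCast {g : α → ℕ} (hg : Computable g) : LSC D fun p => (ratCode (g p) : ℝ) :=
  ⟨fun x => (ratCode x.2 : ℝ) < ratCode (g x.1),
    rePred_ratLT Computable.snd (hg.comp Computable.fst), fun _ _ _ => Iff.rfl⟩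

theorem CR.ratCast {g : α → ℕ} (hg : Computable g) : CR D fun p => (ratCode (g p) : ℝ) :=
  ⟨LSC.ratCast hg, (LSC.ratCast (primrec_ratNeg.to_comp.comp hg)).congr fun p _ => by
    rw [ratCode_ratNeg]; push_cast; rfl⟩

theorem CR.mono {D' : α → Prop} (hf : CR D f) (h : ∀ p, D' p → D p) : CR D' f :=
  ⟨hf.1.mono h, hf.2.mono h⟩

theorem CR.congr (hf : CR D f) (h : ∀ p, D p → f p = g p) : CR D g :=
  ⟨hf.1.congr h, hf.2.congr fun p hp => by rw [h p hp]⟩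

theorem CR.comp_gComp {D : β → Prop} {f : β → ℝ} (hf : CR D f) {D' : α → Prop} {g : α → β}
    (hg : GComp D' g) (h : ∀ p, D' p → D (g p)) : CR D' fun p => f (g p) :=
  ⟨hf.1.comp_gComp hg h, hf.2.comp_gComp hg h⟩

theorem CR.comp {D : β → Prop} {f : β → ℝ} (hf : CR D f) {g : α → β} (hg : Computable g) :
    CR (fun p => D (g p)) fun p => f (g p) := hf.comp_gComp (hg.gComp _) fun _ h => h

theorem CR.neg (hf : CR D f) : CR D fun p => -f p :=
  ⟨hf.2, hf.1.congr fun p _ => by simp⟩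

theorem CR.add (hf : CR D f) (hg : CR D g) : CR D fun p => f p + g p :=
  ⟨hf.1.add hg.1, (hf.2.add hg.2).congr fun p _ => by ring⟩

theorem CR.sub (hf : CR D f) (hg : CR D g) : CR D fun p => f p - g p :=
  (hf.add hg.neg).congr fun p _ => by ring

theorem CR.min (hf : CR D f) (hg : CR D g) : CR D fun p => min (f p) (g p) :=
  ⟨hf.1.min hg.1, (hf.2.max hg.2).congr fun p _ => by rw [max_neg_neg]⟩

theorem CR.max (hf : CR D f) (hg : CR D g) : CR D fun p => max (f p) (g p) :=
  ⟨hf.1.max hg.1, (hf.2.min hg.2).congr fun p _ => by rw [min_neg_neg]⟩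

theorem CR.mul (hf : CR D f) (hg : CR D g) (hf0 : ∀ p, D p → 0 ≤ f p)
    (hg0 : ∀ p, D p → 0 ≤ g p) : CR D fun p => f p * g p :=
  ⟨hf.1.mul hg.1 hf0 hg0, LSC.neg_mul hf.2 hg.2 hf0 hg0⟩

theorem CR.natCast {g : α → ℕ} (hg : Computable g) : CR D fun p => (g p : ℝ) :=
  (CR.ratCast (primrec_ratNat.to_comp.comp hg)).congr fun _ _ => by
    rw [ratCode_ratNat]; push_cast; rfl

theorem CR.const_nat (n : ℕ) : CR D fun _ => (n : ℝ) := CR.natCast (Computable.const n)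

theorem CR.pow {g : α → ℕ} (hg : Computable g) : CR D fun p => (2⁻¹ : ℝ) ^ g p :=
  (CR.ratCast (primrec_ratPow.to_comp.comp hg)).congr fun _ _ => ratCode_ratPow_real _

/-- For `f > 0`, `q < 1 / f` holds iff `q * r < 1` for some rational `r > f`, so upper bounds of `f`
suffice. If `q ≤ 0`, any such `r` works. -/
theorem LSC.inv (hf : LSC D fun p => -f p) (hf0 : ∀ p, D p → 0 < f p) :
    LSC D fun p => (f p)⁻¹ := by
  obtain ⟨R, hR, H⟩ := hf
  refine ⟨fun x => ∃ r, R (x.1, ratNeg r) ∧ (ratCode (ratMul x.2 r) : ℝ) < ratCode (ratNat 1),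
    REPred.exists (p := fun y : (α × ℕ) × ℕ => R (y.1.1, ratNeg y.2) ∧
      (ratCode (ratMul y.1.2 y.2) : ℝ) < ratCode (ratNat 1))
      ((hR.comp ?_).and (rePred_ratLT ?_ (Computable.const _))), fun p hp q => ?_⟩
  · exact (Computable.fst.comp Computable.fst).pair (primrec_ratNeg.to_comp.comp Computable.snd)
  · exact primrec_ratMul.to_comp.comp (Computable.snd.comp Computable.fst) Computable.snd
  · have hpos := hf0 p hp
    simp only [H p hp, ratCode_ratNeg, ratCode_ratMul, ratCode_ratNat]
    push_cast
    rw [← one_div, lt_div_iff₀ hpos]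
    constructor
    · rintro ⟨r, h1, h2⟩
      rcases le_or_gt (ratCode q : ℝ) 0 with h | h <;> nlinarith
    · intro h
      rcases le_or_gt (ratCode q : ℝ) 0 with h' | h'
      · obtain ⟨r, h1, -⟩ := exists_ratCode_between (show f p < f p + 1 by linarith)
        exact ⟨r, by linarith, by nlinarith⟩
      · have h3 : f p < 1 / (ratCode q : ℝ) := by rw [lt_div_iff₀ h']; linarith
        obtain ⟨r, h1, h2⟩ := exists_ratCode_between h3
        refine ⟨r, by linarith, ?_⟩
        rw [lt_div_iff₀ h'] at h2
        linarith

/-- Here `q < -1 / f` holds iff `q * r < -1` for some rational `r` with `0 < r < f`, so lower bounds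
of `f` suffice. -/
theorem LSC.neg_inv (hf : LSC D f) (hf0 : ∀ p, D p → 0 < f p) :
    LSC D fun p => -(f p)⁻¹ := by
  obtain ⟨R, hR, H⟩ := hf
  refine ⟨fun x => ∃ r, (R (x.1, r) ∧ (ratCode (ratNat 0) : ℝ) < ratCode r) ∧
    (ratCode (ratMul x.2 r) : ℝ) < ratCode (ratNeg (ratNat 1)),
    REPred.exists (p := fun y : (α × ℕ) × ℕ => (R (y.1.1, y.2) ∧
      (ratCode (ratNat 0) : ℝ) < ratCode y.2) ∧
      (ratCode (ratMul y.1.2 y.2) : ℝ) < ratCode (ratNeg (ratNat 1)))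
      (((hR.comp ?_).and (rePred_ratLT (Computable.const _) Computable.snd)).and
        (rePred_ratLT ?_ (Computable.const _))), fun p hp q => ?_⟩
  · exact (Computable.fst.comp Computable.fst).pair Computable.snd
  · exact primrec_ratMul.to_comp.comp (Computable.snd.comp Computable.fst) Computable.snd
  · have hpos := hf0 p hp
    simp only [H p hp, ratCode_ratNeg, ratCode_ratMul, ratCode_ratNat]
    push_cast
    rw [lt_neg, ← one_div, div_lt_iff₀ hpos]
    constructor
    · rintro ⟨r, ⟨h1, h2⟩, h3⟩
      have : (ratCode q : ℝ) < 0 := by by_contra h; push Not at h; nlinarith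
      nlinarith
    · intro h
      have h' : 0 < -(ratCode q : ℝ) := by by_contra h'; push Not at h'; nlinarith
      have h3 : 1 / (-(ratCode q : ℝ)) < f p := by rw [div_lt_iff₀ h']; linarith
      obtain ⟨r, h1, h2⟩ := exists_ratCode_between h3
      have h4 : 0 < 1 / (-(ratCode q : ℝ)) := by positivity
      refine ⟨r, ⟨h2, h4.trans h1⟩, ?_⟩
      rw [div_lt_iff₀ h'] at h1
      linarith

theorem CR.inv (hf : CR D f) (hf0 : ∀ p, D p → 0 < f p) : CR D fun p => (f p)⁻¹ :=
  ⟨LSC.inv hf.2 hf0, LSC.neg_inv hf.1 hf0⟩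

theorem CR.div (hf : CR D f) (hg : CR D g) (hf0 : ∀ p, D p → 0 ≤ f p)
    (hg0 : ∀ p, D p → 0 < g p) : CR D fun p => f p / g p :=
  hf.mul (hg.inv hg0) hf0 fun p hp => inv_nonneg.2 (hg0 p hp).le

/-- Split `f` into positive and negative part and multiply each by `g`. -/
theorem CR.mul_of_nonneg_right (hf : CR D f) (hg : CR D g) (hg0 : ∀ p, D p → 0 ≤ g p) :
    CR D fun p => f p * g p := by
  have h0 : CR D fun _ => ((0 : ℕ) : ℝ) := CR.const_nat 0
  refine (((hf.max h0).mul hg (fun p _ => ?_) hg0).sub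
    ((hf.neg.max h0).mul hg (fun p _ => ?_) hg0)).congr fun p _ => ?_
  · simp
  · simp
  · have := max_zero_sub_max_neg_zero_eq_self (f p)
    rw [← sub_mul, Nat.cast_zero, this]

/-- Codes of the sum of a list of coded rationals. -/
def ratListSum (l : List ℕ) : ℕ := l.foldr ratAdd (ratNat 0)

theorem primrec_ratListSum : Primrec ratListSum :=
  Primrec.list_foldr Primrec.id (Primrec.const _)
    (primrec_ratAdd.comp (Primrec.fst.comp Primrec.snd) (Primrec.snd.comp Primrec.snd)).to₂

theorem ratCode_ratListSum (l : List ℕ) :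
    ((ratCode (ratListSum l) : ℚ) : ℝ) = (l.map fun n => (ratCode n : ℝ)).sum := by
  induction l with
  | nil => simp [ratListSum, ratCode_ratNat]
  | cons n l ih =>
    have : ratListSum (n :: l) = ratAdd n (ratListSum l) := rfl
    rw [this, ratCode_ratAdd]; push_cast; rw [ih]; simp

omit [Primcodable β] in
theorem exists_approx_list (g : β → ℝ) (l : List β) {x : ℝ} (h : x < (l.map g).sum) :
    ∃ W : List (β × ℕ), W.map Prod.fst = l ∧ (∀ y ∈ W, (ratCode y.2 : ℝ) < g y.1) ∧
      x < ((W.map Prod.snd).map fun n => (ratCode n : ℝ)).sum := by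
  induction l generalizing x with
  | nil => exact ⟨[], by simpa using h⟩
  | cons b l ih =>
    rw [List.map_cons, List.sum_cons] at h
    obtain ⟨n, h1, h2⟩ := exists_ratCode_between (show x - (l.map g).sum < g b by linarith)
    obtain ⟨W, rfl, hW, hs⟩ := ih (x := x - ratCode n) (by linarith)
    refine ⟨(b, n) :: W, rfl, ?_, ?_⟩
    · simp only [List.mem_cons, forall_eq_or_imp]; exact ⟨h2, hW⟩
    · simp only [List.map_cons, List.sum_cons]; linarith

/-- A lower bound of the sum is certified by a list pairing each summand with a rational strictly
below it. -/
theorem LSC.list_sum {f : α × β → ℝ} (hf : LSC (fun x => D x.1) f) :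
    LSC (fun x : α × List β => D x.1) fun x => (x.2.map fun b => f (x.1, b)).sum := by
  obtain ⟨R, hR, H⟩ := hf
  refine ⟨fun x => ∃ W : List (β × ℕ), (W.map Prod.fst = x.1.2 ∧
      (∀ y ∈ W, R ((x.1.1, y.1), y.2))) ∧
      (ratCode x.2 : ℝ) < ratCode (ratListSum (W.map Prod.snd)),
    REPred.exists (p := fun y : ((α × List β) × ℕ) × List (β × ℕ) =>
      (y.2.map Prod.fst = y.1.1.2 ∧ (∀ z ∈ y.2, R ((y.1.1.1, z.1), z.2))) ∧
      (ratCode y.1.2 : ℝ) < ratCode (ratListSum (y.2.map Prod.snd)))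
      (((rePred_eq ?_ ?_).and ?_).and (rePred_ratLT ?_ ?_)), fun p hp q => ?_⟩
  · exact (Primrec.list_map Primrec.snd (Primrec.fst.comp Primrec.snd).to₂).to_comp
  · exact Computable.snd.comp (Computable.fst.comp Computable.fst)
  · refine (REPred.forall_mem (p := fun z : α × (β × ℕ) => R ((z.1, z.2.1), z.2.2))
      (hR.comp ?_)).comp (f := fun y : ((α × List β) × ℕ) × List (β × ℕ) => (y.1.1.1, y.2)) ?_
    · exact (Computable.fst.pair (Computable.fst.comp Computable.snd)).pair
        (Computable.snd.comp Computable.snd)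
    · exact (Computable.fst.comp (Computable.fst.comp Computable.fst)).pair Computable.snd
  · exact Computable.snd.comp Computable.fst
  · exact (primrec_ratListSum.comp
      (Primrec.list_map Primrec.snd (Primrec.snd.comp Primrec.snd).to₂)).to_comp
  · simp only [ratCode_ratListSum]
    have h1 : ∀ (b : β) (n : ℕ), R ((p.1, b), n) ↔ (ratCode n : ℝ) < f (p.1, b) :=
      fun b n => H (p.1, b) hp n
    simp only [h1]
    constructor
    · rintro ⟨W, ⟨h2, h3⟩, h4⟩
      refine h4.trans_le ?_
      rw [← h2, List.map_map, List.map_map]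
      exact List.sum_le_sum fun y hy => (h3 y hy).le
    · intro h
      obtain ⟨W, h2, h3, h4⟩ := exists_approx_list (fun b => f (p.1, b)) _ h
      exact ⟨W, ⟨h2, h3⟩, h4⟩

theorem CR.list_sum {f : α × β → ℝ} (hf : CR (fun x => D x.1) f) :
    CR (fun x : α × List β => D x.1) fun x => (x.2.map fun b => f (x.1, b)).sum :=
  ⟨hf.1.list_sum, hf.2.list_sum.congr fun p _ => by
    rw [List.sum_neg, List.map_map]; rfl⟩

theorem CR.sum_range {f : α × ℕ → ℝ} (hf : CR (fun x => D x.1) f) {N : α → ℕ}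
    (hN : Computable N) : CR D fun p => ∑ i ∈ Finset.range (N p), f (p, i) :=
  ((CR.list_sum hf).comp (g := fun p : α => (p, List.range (N p)))
    (Computable.id.pair (Primrec.list_range.to_comp.comp hN))).congr fun p _ => by
      rw [Finset.sum_eq_multiset_sum]; rfl

theorem LSC.inf_range {f : α × ℕ → ℝ} (hf : LSC (fun x => D x.1) f) {N : α → ℕ}
    (hN : Computable N) {g : α → ℝ}
    (h : ∀ p, D p → ∀ q : ℝ, q < g p ↔ ∀ i ≤ N p, q < f (p, i)) : LSC D g := by
  obtain ⟨R, hR, H⟩ := hf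
  refine ⟨fun x => ∀ i ∈ List.range (N x.1 + 1), R ((x.1, i), x.2), ?_, fun p hp q => ?_⟩
  · refine (REPred.forall_mem (p := fun z : (α × ℕ) × ℕ => R ((z.1.1, z.2), z.1.2))
      (hR.comp ?_)).comp (f := fun x : α × ℕ => (x, List.range (N x.1 + 1))) ?_
    · exact ((Computable.fst.comp Computable.fst).pair Computable.snd).pair
        (Computable.snd.comp Computable.fst)
    · exact Computable.id.pair (Primrec.list_range.to_comp.comp
        (Primrec.succ.to_comp.comp (hN.comp Computable.fst)))
  · rw [h p hp]
    simp only [List.mem_range, Nat.lt_succ_iff]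
    exact forall_congr' fun i => forall_congr' fun _ => H (p, i) hp q

/-- A nonnegative family that vanishes outside an r.e. set is lower semicomputable if it is so
on that set. -/
theorem LSC.of_guard {G : α → Prop} (hG : REPred G) (hf : LSC (fun p => D p ∧ G p) f)
    (hf0 : ∀ p, D p → 0 ≤ f p) (h : ∀ p, D p → ¬ G p → f p = 0) : LSC D f := by
  obtain ⟨R, hR, H⟩ := hf
  refine ⟨fun x => (ratCode x.2 : ℝ) < ratCode (ratNat 0) ∨ (G x.1 ∧ R x),
    (rePred_ratLT Computable.snd (Computable.const _)).or ((hG.comp Computable.fst).and hR),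
    fun p hp q => ?_⟩
  have h0 : ((ratCode (ratNat 0) : ℚ) : ℝ) = 0 := by simp [ratCode_ratNat]
  simp only [h0]
  by_cases hg : G p
  · rw [H p ⟨hp, hg⟩]
    constructor
    · rintro (h1 | h1)
      · exact h1.trans_le (hf0 p hp)
      · exact h1.2
    · exact fun h1 => Or.inr ⟨hg, h1⟩
  · simp [hg, h p hp hg]

end LSC

/-! ### Codes of computable families of reals -/

section Codes

variable {γ : Type*} [Primcodable γ]

theorem inv_two_pow_pos (k : ℕ) : (0 : ℝ) < 2⁻¹ ^ k := by positivity

theorem exists_inv_two_pow_lt {ε : ℝ} (h : 0 < ε) : ∃ k : ℕ, (2⁻¹ : ℝ) ^ k < ε :=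
  exists_pow_lt_of_lt_one h (by norm_num)

theorem computable_encode_pair {α : Type*} [Primcodable α] {f : α → List Bool} {g : α → ℕ}
    (hf : Computable f) (hg : Computable g) : Computable fun a => encode (f a, g a) :=
  Computable.encode.comp (hf.pair hg)

/-- Reals that are approximated by the outputs of programs are computable. -/
theorem CR.of_codes {D : Code × List Bool → Prop} {v : Code × List Bool → ℝ}
    (h : ∀ p, D p → ∀ k, ∃ n ∈ p.1.eval (encode (p.2, k)), |(ratCode n : ℝ) - v p| ≤ 2⁻¹ ^ k) :
    CR D v := by
  have key : ∀ p, D p → ∀ k, ∀ n ∈ p.1.eval (encode (p.2, k)), |(ratCode n : ℝ) - v p| ≤ 2⁻¹ ^ k := by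
    intro p hp k n hn
    obtain ⟨m, hm, hm'⟩ := h p hp k
    rwa [Part.mem_unique hn hm]
  have hev : REPred fun y : ((Code × List Bool) × ℕ) × (ℕ × ℕ) =>
      y.2.2 ∈ y.1.1.1.eval (encode (y.1.1.2, y.2.1)) :=
    rePred_mem_eval.comp (f := fun y : ((Code × List Bool) × ℕ) × (ℕ × ℕ) =>
      ((y.1.1.1, encode (y.1.1.2, y.2.1)), y.2.2))
      (((Computable.fst.comp (Computable.fst.comp Computable.fst)).pair
        (computable_encode_pair (Computable.snd.comp (Computable.fst.comp Computable.fst))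
          (Computable.fst.comp Computable.snd))).pair (Computable.snd.comp Computable.snd))
  constructor
  · refine ⟨fun x => ∃ kn : ℕ × ℕ, kn.2 ∈ x.1.1.eval (encode (x.1.2, kn.1)) ∧
      (ratCode (ratAdd x.2 (ratPow kn.1)) : ℝ) < ratCode kn.2, REPred.exists (p := fun y :
      ((Code × List Bool) × ℕ) × (ℕ × ℕ) => y.2.2 ∈ y.1.1.1.eval (encode (y.1.1.2, y.2.1)) ∧
      (ratCode (ratAdd y.1.2 (ratPow y.2.1)) : ℝ) < ratCode y.2.2)
      (hev.and (rePred_ratLT ?_ (Computable.snd.comp Computable.snd))), fun p hp q => ?_⟩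
    · exact primrec_ratAdd.to_comp.comp (Computable.snd.comp Computable.fst)
        (primrec_ratPow.to_comp.comp (Computable.fst.comp Computable.snd))
    · simp only [ratCode_ratAdd, Rat.cast_add, ratCode_ratPow_real]
      constructor
      · rintro ⟨⟨k, n⟩, h1, h2⟩
        have := abs_le.1 (key p hp k n h1)
        dsimp only at h2
        linarith
      · intro hq
        obtain ⟨k, hk⟩ := exists_inv_two_pow_lt (show 0 < (v p - ratCode q) / 2 by linarith)
        obtain ⟨n, hn, hn'⟩ := h p hp k
        have := abs_le.1 hn'
        exact ⟨(k, n), hn, by dsimp only; linarith⟩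
  · refine ⟨fun x => ∃ kn : ℕ × ℕ, kn.2 ∈ x.1.1.eval (encode (x.1.2, kn.1)) ∧
      (ratCode (ratAdd kn.2 (ratPow kn.1)) : ℝ) < ratCode (ratNeg x.2), REPred.exists (p := fun y :
      ((Code × List Bool) × ℕ) × (ℕ × ℕ) => y.2.2 ∈ y.1.1.1.eval (encode (y.1.1.2, y.2.1)) ∧
      (ratCode (ratAdd y.2.2 (ratPow y.2.1)) : ℝ) < ratCode (ratNeg y.1.2))
      (hev.and (rePred_ratLT ?_ (primrec_ratNeg.to_comp.comp
        (Computable.snd.comp Computable.fst)))), fun p hp q => ?_⟩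
    · exact primrec_ratAdd.to_comp.comp (Computable.snd.comp Computable.snd)
        (primrec_ratPow.to_comp.comp (Computable.fst.comp Computable.snd))
    · simp only [ratCode_ratAdd, Rat.cast_add, ratCode_ratPow_real, ratCode_ratNeg, Rat.cast_neg]
      constructor
      · rintro ⟨⟨k, n⟩, h1, h2⟩
        have := abs_le.1 (key p hp k n h1)
        dsimp only at h2
        linarith
      · intro hq
        obtain ⟨k, hk⟩ := exists_inv_two_pow_lt (show 0 < (-v p - ratCode q) / 2 by linarith)
        obtain ⟨n, hn, hn'⟩ := h p hp k
        have := abs_le.1 hn'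
        exact ⟨(k, n), hn, by dsimp only; linarith⟩

/-- A computable family of reals, defined on an r.e. set of strings, is given by a program, which
depends computably on the parameter. -/
theorem CR.exists_computes {D : γ → Prop} {G : γ × List Bool → Prop} (hG : REPred G)
    {f : γ × List Bool → ℝ} (hf : CR (fun p => D p.1 ∧ G p) f) :
    ∃ F : γ → Code, Computable F ∧ ∀ c, D c →
      Computes (F c) fun σ => ⟨G (c, σ), fun _ => f (c, σ)⟩ := by
  obtain ⟨⟨R, hR, H⟩, ⟨R', hR', H'⟩⟩ := hf
  -- The program searches for a rational `n` with `n - 2 ^ (-k) < f < n + 2 ^ (-k)`, both read off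
  -- from the cuts. Requiring `G` in the search makes it diverge outside the domain.
  have h1 : REPred fun y : (γ × (List Bool × ℕ)) × ℕ => G (y.1.1, y.1.2.1) ∧
      (R ((y.1.1, y.1.2.1), ratAdd y.2 (ratNeg (ratPow y.1.2.2))) ∧
      R' ((y.1.1, y.1.2.1), ratNeg (ratAdd y.2 (ratPow y.1.2.2)))) := by
    have hp : Computable fun y : (γ × (List Bool × ℕ)) × ℕ => (y.1.1, y.1.2.1) :=
      (Computable.fst.comp Computable.fst).pair
        (Computable.fst.comp (Computable.snd.comp Computable.fst))
    have hk : Computable fun y : (γ × (List Bool × ℕ)) × ℕ => ratPow y.1.2.2 :=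
      primrec_ratPow.to_comp.comp (Computable.snd.comp (Computable.snd.comp Computable.fst))
    exact (hG.comp hp).and ((hR.comp (hp.pair (primrec_ratAdd.to_comp.comp Computable.snd
      (primrec_ratNeg.to_comp.comp hk)))).and (hR'.comp (hp.pair (primrec_ratNeg.to_comp.comp
      (primrec_ratAdd.to_comp.comp Computable.snd hk)))))
  obtain ⟨φ, hφ, hd, hs⟩ := exists_partrec_of_rePred h1
  obtain ⟨F, hF, hFe⟩ := exists_code_of_partrec hφ
  refine ⟨F, hF, fun c hc σ k => ?_⟩
  rw [hFe]
  have cuts : G (c, σ) → ∀ n, (R ((c, σ), ratAdd n (ratNeg (ratPow k))) ∧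
      R' ((c, σ), ratNeg (ratAdd n (ratPow k)))) ↔
      (ratCode n : ℝ) - 2⁻¹ ^ k < f (c, σ) ∧ f (c, σ) < ratCode n + 2⁻¹ ^ k := by
    intro hg n
    rw [H _ ⟨hc, hg⟩, H' _ ⟨hc, hg⟩]
    simp only [ratCode_ratAdd, ratCode_ratNeg, Rat.cast_add, Rat.cast_neg, ratCode_ratPow_real]
    rw [neg_lt_neg_iff, ← sub_eq_add_neg]
  constructor
  · rw [hd]
    constructor
    · rintro ⟨n, h, -⟩; exact h
    · intro hg
      have := inv_two_pow_pos k
      obtain ⟨n, hn1, hn2⟩ := exists_ratCode_between (show f (c, σ) < f (c, σ) + 2⁻¹ ^ k by linarith)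
      exact ⟨n, hg, (cuts hg n).2 ⟨by linarith, by linarith⟩⟩
  · intro n hn v hv
    obtain ⟨hg, h2⟩ := hs _ n hn
    obtain ⟨-, rfl⟩ := hv
    obtain ⟨h3, h4⟩ := (cuts hg n).1 h2
    rw [abs_le]
    constructor <;> dsimp only <;> linarith

theorem rePred_true {α : Type*} [Primcodable α] : REPred fun _ : α => True :=
  (rePred_eq (Computable.id (α := α)) Computable.id).of_eq fun _ => by simp

theorem CR.exists_computes_total {D : γ → Prop} {f : γ × List Bool → ℝ}
    (hf : CR (fun p => D p.1) f) : ∃ F : γ → Code, Computable F ∧ ∀ c, D c →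
      Computes (F c) fun σ => Part.some (f (c, σ)) :=
  CR.exists_computes (G := fun _ => True) rePred_true (hf.mono fun _ h => h.1)

/-- Both values are within `2 ^ (-k)` of the same output for every `k`. Since a code determines its
object, choosing an object from a code, as in `measureOf`, is harmless. -/
theorem Computes.eq_of_mem {c : Code} {f g : List Bool →. ℝ} (hf : Computes c f)
    (hg : Computes c g) : f = g := by
  funext σ
  refine Part.ext' ?_ fun h1 h2 => ?_
  · rw [← (hf σ 0).1, (hg σ 0).1]
  · by_contra hne
    have hpos : 0 < |(f σ).get h1 - (g σ).get h2| / 2 := half_pos (abs_pos.2 (sub_ne_zero.2 hne))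
    obtain ⟨k, hk⟩ := exists_inv_two_pow_lt hpos
    have hd := (hf σ k).1.2 h1
    have e1 := (hf σ k).2 _ (Part.get_mem hd) _ (Part.get_mem h1)
    have e2 := (hg σ k).2 _ (Part.get_mem hd) _ (Part.get_mem h2)
    have := abs_sub_le ((f σ).get h1) (ratCode ((c.eval (encode (σ, k))).get hd)) ((g σ).get h2)
    rw [abs_sub_comm ((f σ).get h1) (ratCode _ : ℝ)] at this
    linarith

/-- The code `c` is a code of a computable measure on Cantor space. -/
def IsMeasureCode (c : Code) : Prop := ∃ ν, ComputesMeasure c ν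

open Classical in
/-- The computable measure with code `c`. -/
def measureOf (c : Code) : List Bool → ℝ := if h : IsMeasureCode c then h.choose else 0

theorem IsMeasureCode.computes {c : Code} (h : IsMeasureCode c) :
    ComputesMeasure c (measureOf c) := by
  rw [measureOf, dif_pos h]; exact h.choose_spec

theorem ComputesMeasure.isMeasureCode {c : Code} {ν : List Bool → ℝ} (h : ComputesMeasure c ν) :
    IsMeasureCode c := ⟨ν, h⟩

theorem ComputesMeasure.eq_measureOf {c : Code} {ν : List Bool → ℝ} (h : ComputesMeasure c ν) :
    ν = measureOf c := by
  funext σ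
  have := congrFun (Computes.eq_of_mem h.1 (IsMeasureCode.computes ⟨ν, h⟩).1) σ
  exact Part.some_injective this

theorem CR.measureOf :
    CR (fun p : Code × List Bool => IsMeasureCode p.1) fun p => measureOf p.1 p.2 := by
  refine CR.of_codes fun p hp k => ?_
  have h := hp.computes.1 p.2 k
  have hd := h.1.2 trivial
  exact ⟨_, Part.get_mem hd, h.2 _ (Part.get_mem hd) _ (Part.mem_some _)⟩

end Codes

/-! ### Uniformly effectively open sets -/

section Sigma

variable {X : Type*} [MetricSpace X] {a : ℕ → X}
variable {α β γ : Type*} [Primcodable α] [Primcodable β] [Primcodable γ]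

/-- The union of the basic balls with indices in `R`. -/
def ballUnion (a : ℕ → X) (R : ℕ × ℕ → Prop) : Set X :=
  {x | ∃ i n, R (i, n) ∧ dist x (a i) < (ratCode n : ℝ)}

/-- The sets `U p` are effectively open, uniformly in `p`, provided that `D p`. -/
def SigmaOne (a : ℕ → X) (D : α → Prop) (U : α → Set X) : Prop :=
  ∃ R : α × (ℕ × ℕ) → Prop, REPred R ∧ ∀ p, D p → U p = ballUnion a fun b => R (p, b)

variable {D : α → Prop} {U V : α → Set X}

theorem SigmaOne.mono {D' : α → Prop} (hU : SigmaOne a D U) (h : ∀ p, D' p → D p) :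
    SigmaOne a D' U := by
  obtain ⟨R, hR, H⟩ := hU
  exact ⟨R, hR, fun p hp => H p (h p hp)⟩

theorem SigmaOne.congr (hU : SigmaOne a D U) (h : ∀ p, D p → U p = V p) : SigmaOne a D V := by
  obtain ⟨R, hR, H⟩ := hU
  exact ⟨R, hR, fun p hp => by rw [← h p hp, H p hp]⟩

theorem SigmaOne.comp_gComp {D : β → Prop} {U : β → Set X} (hU : SigmaOne a D U)
    {D' : α → Prop} {g : α → β} (hg : GComp D' g) (h : ∀ p, D' p → D (g p)) :
    SigmaOne a D' fun p => U (g p) := by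
  obtain ⟨R, hR, H⟩ := hU
  obtain ⟨G, hG, H'⟩ := hg
  refine ⟨fun x => ∃ b, G (x.1, b) ∧ R (b, x.2), REPred.exists (p := fun y : (α × (ℕ × ℕ)) × β =>
    G (y.1.1, y.2) ∧ R (y.2, y.1.2)) ((hG.comp ?_).and (hR.comp ?_)), fun p hp => ?_⟩
  · exact (Computable.fst.comp Computable.fst).pair Computable.snd
  · exact Computable.snd.pair (Computable.snd.comp Computable.fst)
  · simp [H' p hp, H _ (h p hp)]

theorem SigmaOne.comp {D : β → Prop} {U : β → Set X} (hU : SigmaOne a D U) {g : α → β}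
    (hg : Computable g) : SigmaOne a (fun p => D (g p)) fun p => U (g p) :=
  hU.comp_gComp (hg.gComp _) fun _ h => h

theorem rePred_eval_dom {f : α → Code} {g : α → ℕ} (hf : Computable f) (hg : Computable g) :
    REPred fun p => ((f p).eval (g p)).Dom :=
  (Code.eval_part.comp hf hg).dom_re

theorem sigmaOne_effOpen : SigmaOne a (fun _ : Code => True) fun e => effOpen a e :=
  ⟨fun x => (x.1.eval (Nat.pair x.2.1 x.2.2)).Dom, rePred_eval_dom Computable.fst
    (Primrec₂.natPair.to_comp.comp (Computable.fst.comp Computable.snd)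
      (Computable.snd.comp Computable.snd)), fun _ _ => rfl⟩

theorem exists_code_of_rePred {R : α × (ℕ × ℕ) → Prop} (hR : REPred R) :
    ∃ e : α → Code, Computable e ∧ ∀ p, effOpen a (e p) = ballUnion a fun b => R (p, b) := by
  have h1 : REPred fun x : α × ℕ => R (x.1, x.2.unpair) :=
    hR.comp (Computable.fst.pair (Computable.unpair.comp Computable.snd))
  have h2 : Partrec fun x : α × ℕ => Part.assert (R (x.1, x.2.unpair)) fun _ => Part.some (0 : ℕ) := by
    have := Partrec.map h1 (Computable.const 0).to₂
    refine this.of_eq fun x => ?_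
    exact Part.ext' (by simp [Part.assert]) fun _ _ => rfl
  obtain ⟨F, hF, hFe⟩ := exists_code_of_partrec h2
  refine ⟨F, hF, fun p => ?_⟩
  ext x
  refine exists_congr fun i => exists_congr fun n => and_congr_left fun _ => ?_
  have := hFe p (Nat.pair i n)
  rw [Encodable.encode_nat] at this
  rw [this]
  simp [Part.assert]

theorem SigmaOne.exists_code (hU : SigmaOne a D U) :
    ∃ e : α → Code, Computable e ∧ ∀ p, D p → U p = effOpen a (e p) := by
  obtain ⟨R, hR, H⟩ := hU
  obtain ⟨e, he, h⟩ := exists_code_of_rePred (a := a) hR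
  exact ⟨e, he, fun p hp => by rw [H p hp, h p]⟩

theorem SigmaOne.exists_computesOpens [MeasurableSpace X] {D : γ → Prop} {U : γ × ℕ → Set X}
    (hU : SigmaOne a (fun p => D p.1) U) : ∃ F : γ → Code, Computable F ∧
      ∀ c, D c → ComputesOpens a (F c) fun n => U (c, n) := by
  obtain ⟨e, he, h⟩ := hU.exists_code
  obtain ⟨F, hF, hFe⟩ := exists_code_of_partrec (Computable.encode.comp he).partrec
  refine ⟨F, hF, fun c hc n => ⟨encode (e (c, n)), ?_, ?_⟩⟩
  · have := hFe c n
    rw [Encodable.encode_nat] at this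
    rw [this]
    exact Part.mem_some _
  · rw [Denumerable.ofNat_encode]; exact h _ hc

/-- The sequence of effectively open sets with code `c`. -/
def opensOf (a : ℕ → X) (c : Code) (n : ℕ) : Set X :=
  {x | ∃ m ∈ c.eval n, x ∈ effOpen a (ofNat Code m)}

theorem _root_.CompRand.ComputesOpens.eq_opensOf [MeasurableSpace X] {c : Code} {U : ℕ → Set X}
    (h : ComputesOpens a c U) : U = opensOf a c := by
  funext n
  obtain ⟨m, hm, hU⟩ := h n
  rw [hU]
  ext x
  exact ⟨fun hx => ⟨m, hm, hx⟩, fun ⟨m', hm', hx⟩ => by rwa [Part.mem_unique hm hm']⟩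

/-- The sets need to be effectively open only where the guard `G` holds, because the enumeration
waits for `G` first. -/
theorem SigmaOne.iUnion {U : α × β → Set X} {G : α × β → Prop} (hG : REPred G)
    (hU : SigmaOne a (fun x => D x.1 ∧ G x) U) :
    SigmaOne a D fun p => {x | ∃ b, G (p, b) ∧ x ∈ U (p, b)} := by
  obtain ⟨R, hR, H⟩ := hU
  refine ⟨fun x => ∃ b, G (x.1, b) ∧ R ((x.1, b), x.2), REPred.exists
    (p := fun y : (α × (ℕ × ℕ)) × β => G (y.1.1, y.2) ∧ R ((y.1.1, y.2), y.1.2))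
    ((hG.comp ?_).and (hR.comp ?_)), fun p hp => ?_⟩
  · exact (Computable.fst.comp Computable.fst).pair Computable.snd
  · exact ((Computable.fst.comp Computable.fst).pair Computable.snd).pair
      (Computable.snd.comp Computable.fst)
  · ext x
    constructor
    · rintro ⟨b, hb, hx⟩
      rw [H _ ⟨hp, hb⟩] at hx
      obtain ⟨i, n, h1, h2⟩ := hx
      exact ⟨i, n, ⟨b, hb, h1⟩, h2⟩
    · rintro ⟨i, n, ⟨b, hb, h1⟩, h2⟩
      refine ⟨b, hb, ?_⟩
      rw [H _ ⟨hp, hb⟩]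
      exact ⟨i, n, h1, h2⟩

theorem SigmaOne.union (hU : SigmaOne a D U) (hV : SigmaOne a D V) :
    SigmaOne a D fun p => U p ∪ V p := by
  obtain ⟨R, hR, H⟩ := hU
  obtain ⟨S, hS, H'⟩ := hV
  refine ⟨fun x => R x ∨ S x, hR.or hS, fun p hp => ?_⟩
  change U p ∪ V p = _
  rw [H p hp, H' p hp]
  ext x
  simp only [ballUnion, Set.mem_union, Set.mem_ofPred_eq, or_and_right, exists_or]

/-- No promise is needed: a code that diverges at an index simply yields the empty set there. -/
theorem sigmaOne_opensOf :
    SigmaOne a (fun _ : Code × ℕ => True) fun x => opensOf a x.1 x.2 :=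
  SigmaOne.iUnion (β := ℕ) (G := fun y : (Code × ℕ) × ℕ => y.2 ∈ y.1.1.eval y.1.2)
    (U := fun y => effOpen a (ofNat Code y.2)) rePred_mem_eval
    ((sigmaOne_effOpen.comp ((Computable.ofNat Code).comp Computable.snd)).mono fun _ _ => trivial)

theorem SigmaOne.of_code {e : α → Code} (he : Computable e) :
    SigmaOne a D fun p => effOpen a (e p) :=
  (sigmaOne_effOpen.comp he).mono fun _ _ => trivial

/-- The basic balls are uniformly effectively open. -/
theorem sigmaOne_ball {i n : α → ℕ} (hi : Computable i) (hn : Computable n) :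
    SigmaOne a D fun p => {x | dist x (a (i p)) < (ratCode (n p) : ℝ)} := by
  refine ⟨fun x => x.2 = (i x.1, n x.1), rePred_eq Computable.snd
    ((hi.comp Computable.fst).pair (hn.comp Computable.fst)), fun p _ => ?_⟩
  ext x
  simp [ballUnion]

theorem isOpen_ballUnion (R : ℕ × ℕ → Prop) : IsOpen (ballUnion a R) := by
  have : ballUnion a R = ⋃ i, ⋃ n, ⋃ (_ : R (i, n)), Metric.ball (a i) (ratCode n) := by
    ext x; simp [ballUnion]
  rw [this]
  exact isOpen_iUnion fun i => isOpen_iUnion fun n => isOpen_iUnion fun _ => Metric.isOpen_ball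

theorem SigmaOne.isOpen (hU : SigmaOne a D U) {p : α} (hp : D p) : IsOpen (U p) := by
  obtain ⟨R, hR, H⟩ := hU
  rw [H p hp]; exact isOpen_ballUnion _

theorem isOpen_effOpen (e : Code) : IsOpen (effOpen a e) :=
  sigmaOne_effOpen.isOpen trivial

section Polish
variable [CompleteSpace X] (ha : IsComputablePolish a)
include ha

theorem CR.dist_simple {i j : α → ℕ} (hi : Computable i) (hj : Computable j) :
    CR D fun p => dist (a (i p)) (a (j p)) := by
  obtain ⟨F, hF, H⟩ := ha.dist_computable
  have h : CR (fun _ : ℕ × ℕ => True) fun p => dist (a p.1) (a p.2) := by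
    constructor
    · refine LSC.iSup (G := fun y : (ℕ × ℕ) × ℕ => (ratCode (F y) : ℝ) - 2⁻¹ ^ y.2)
        (((CR.ratCast hF).sub (CR.pow Computable.snd)).1) fun p _ q => ⟨fun hq => ?_, ?_⟩
      · obtain ⟨k, hk⟩ := exists_inv_two_pow_lt (show 0 < (dist (a p.1) (a p.2) - q) / 2 by linarith)
        have := abs_le.1 (H p k)
        exact ⟨k, by dsimp only; linarith⟩
      · rintro ⟨k, hk⟩
        have := abs_le.1 (H p k)
        dsimp only at hk; linarith
    · refine LSC.iSup (G := fun y : (ℕ × ℕ) × ℕ => -((ratCode (F y) : ℝ) + 2⁻¹ ^ y.2))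
        (((CR.ratCast hF).add (CR.pow Computable.snd)).2) fun p _ q => ⟨fun hq => ?_, ?_⟩
      · obtain ⟨k, hk⟩ := exists_inv_two_pow_lt
          (show 0 < (-dist (a p.1) (a p.2) - q) / 2 by linarith)
        have := abs_le.1 (H p k)
        exact ⟨k, by dsimp only; linarith⟩
      · rintro ⟨k, hk⟩
        have := abs_le.1 (H p k)
        dsimp only at hk; linarith
  exact (h.comp (hi.pair hj)).mono fun _ _ => trivial

theorem exists_simple_near (x : X) {ε : ℝ} (hε : 0 < ε) : ∃ j, dist x (a j) < ε :=
  ha.dense.exists_dist_lt x hε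

/-- An effectively open set is given by an r.e. set of basic balls contained in it that comprises
all small balls around each of its points. -/
theorem SigmaOne.refine (hU : SigmaOne a D U) : ∃ R : α × (ℕ × ℕ) → Prop, REPred R ∧
    ∀ p, D p → (∀ j m, R (p, (j, m)) → ∀ x, dist x (a j) < (ratCode m : ℝ) → x ∈ U p) ∧
      ∀ x ∈ U p, ∃ δ > 0, ∀ j m, dist x (a j) < (ratCode m : ℝ) → (ratCode m : ℝ) < δ →
        R (p, (j, m)) := by
  obtain ⟨R, hR, H⟩ := hU
  have hd : CR (fun _ : (α × (ℕ × ℕ)) × (ℕ × ℕ) => True) fun y =>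
      (ratCode y.2.2 : ℝ) - (dist (a y.1.2.1) (a y.2.1) + ratCode y.1.2.2) :=
    (CR.ratCast (Computable.snd.comp Computable.snd)).sub
      ((CR.dist_simple ha (Computable.fst.comp (Computable.snd.comp Computable.fst))
        (Computable.fst.comp Computable.snd)).add
        (CR.ratCast (Computable.snd.comp (Computable.snd.comp Computable.fst))))
  obtain ⟨S, hS, HS⟩ := hd.1.exists_rePred (Computable.const (ratNat 0))
  refine ⟨fun x => ∃ b : ℕ × ℕ, R (x.1, b) ∧ S (x, b), REPred.exists
    (p := fun y : (α × (ℕ × ℕ)) × (ℕ × ℕ) => R (y.1.1, y.2) ∧ S y) ((hR.comp ?_).and hS),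
    fun p hp => ⟨?_, ?_⟩⟩
  · exact (Computable.fst.comp Computable.fst).pair Computable.snd
  · rintro j m ⟨⟨i, n⟩, h1, h2⟩ x hx
    rw [HS _ trivial, ratCode_ratNat] at h2
    rw [H p hp]
    refine ⟨i, n, h1, ?_⟩
    have := dist_triangle x (a j) (a i)
    push_cast at h2
    linarith
  · intro x hx
    rw [H p hp] at hx
    obtain ⟨i, n, h1, h2⟩ := hx
    -- Half the slack, since `m` enters twice: as the radius and as a bound on the distance from `a
    -- j` to `x`.
    refine ⟨((ratCode n : ℝ) - dist x (a i)) / 2, by linarith, fun j m hj hm => ⟨(i, n), h1, ?_⟩⟩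
    rw [HS _ trivial, ratCode_ratNat]
    have := dist_triangle (a j) x (a i)
    rw [dist_comm (a j) x] at this
    push_cast
    linarith

omit ha [Primcodable α] in
theorem mem_ballUnion_of_small (ha : IsComputablePolish a) {R : ℕ × ℕ → Prop} {x : X} {δ : ℝ}
    (hδ : 0 < δ) (h : ∀ j m, dist x (a j) < (ratCode m : ℝ) → (ratCode m : ℝ) < δ → R (j, m)) :
    x ∈ ballUnion a R := by
  obtain ⟨m, h1, h2⟩ := exists_ratCode_between hδ
  obtain ⟨j, hj⟩ := exists_simple_near ha x h1
  exact ⟨j, m, h j m hj h2, hj⟩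

/-- With the indices chosen as in `SigmaOne.refine`, one intersects index sets. A common ball lies
in both sets, and sufficiently small balls around a common point are listed for both. -/
theorem SigmaOne.inter (hU : SigmaOne a D U) (hV : SigmaOne a D V) :
    SigmaOne a D fun p => U p ∩ V p := by
  obtain ⟨R, hR, H⟩ := hU.refine ha
  obtain ⟨S, hS, H'⟩ := hV.refine ha
  refine ⟨fun x => R x ∧ S x, hR.and hS, fun p hp => ?_⟩
  ext x
  constructor
  · rintro ⟨h1, h2⟩
    obtain ⟨δ, hδ, h3⟩ := (H p hp).2 x h1
    obtain ⟨δ', hδ', h4⟩ := (H' p hp).2 x h2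
    exact mem_ballUnion_of_small ha (lt_min hδ hδ') fun j m hj hm =>
      ⟨h3 j m hj (hm.trans_le (min_le_left _ _)), h4 j m hj (hm.trans_le (min_le_right _ _))⟩
  · rintro ⟨j, m, ⟨h1, h2⟩, h3⟩
    exact ⟨(H p hp).1 j m h1 x h3, (H' p hp).1 j m h2 x h3⟩

theorem SigmaOne.forall_mem {U : α × β → Set X} (hU : SigmaOne a (fun x => D x.1) U) {l : α → List β}
    (hl : Computable l) : SigmaOne a D fun p => {x | ∀ b ∈ l p, x ∈ U (p, b)} := by
  obtain ⟨R, hR, H⟩ := hU.refine ha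
  refine ⟨fun x => ∀ b ∈ l x.1, R ((x.1, b), x.2), ?_, fun p hp => ?_⟩
  · refine (REPred.forall_mem (p := fun z : (α × (ℕ × ℕ)) × β => R ((z.1.1, z.2), z.1.2))
      (hR.comp ?_)).comp (f := fun x : α × (ℕ × ℕ) => (x, l x.1)) ?_
    · exact ((Computable.fst.comp Computable.fst).pair Computable.snd).pair
        (Computable.snd.comp Computable.fst)
    · exact Computable.id.pair (hl.comp Computable.fst)
  · ext x
    constructor
    · intro hx
      have : ∃ δ > 0, ∀ b ∈ l p, ∀ j m, dist x (a j) < (ratCode m : ℝ) → (ratCode m : ℝ) < δ →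
          R ((p, b), (j, m)) := by
        have hx' : ∀ b ∈ l p, x ∈ U (p, b) := hx
        generalize l p = L at hx' 
        induction L with
        | nil => exact ⟨1, one_pos, by simp⟩
        | cons b L ih =>
          obtain ⟨δ, hδ, h1⟩ := ih fun c hc => hx' c (List.mem_cons_of_mem _ hc)
          obtain ⟨δ', hδ', h2⟩ := (H (p, b) hp).2 x (hx' b List.mem_cons_self)
          refine ⟨Min.min δ δ', lt_min hδ hδ', ?_⟩
          rintro c hc j m hj hm
          rcases List.mem_cons.1 hc with rfl | hc
          · exact h2 j m hj (hm.trans_le (min_le_right _ _))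
          · exact h1 c hc j m hj (hm.trans_le (min_le_left _ _))
      obtain ⟨δ, hδ, h⟩ := this
      exact mem_ballUnion_of_small ha hδ fun j m hj hm b hb => h b hb j m hj hm
    · rintro ⟨j, m, h1, h2⟩ b hb
      exact (H (p, b) hp).1 j m (h1 b hb) x h2

/-- The complements of the closed basic balls are uniformly effectively open. -/
theorem sigmaOne_coball {i n : α → ℕ} (hi : Computable i) (hn : Computable n) :
    SigmaOne a D fun p => {x | (ratCode (n p) : ℝ) < dist x (a (i p))} := by
  have hd : CR (fun _ : α × (ℕ × ℕ) => True) fun y =>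
      dist (a y.2.1) (a (i y.1)) - ((ratCode (n y.1) : ℝ) + ratCode y.2.2) :=
    (CR.dist_simple ha (Computable.fst.comp Computable.snd) (hi.comp Computable.fst)).sub
      ((CR.ratCast (hn.comp Computable.fst)).add (CR.ratCast (Computable.snd.comp Computable.snd)))
  obtain ⟨S, hS, HS⟩ := hd.1.exists_rePred (Computable.const (ratNat 0))
  refine ⟨S, hS, fun p _ => ?_⟩
  have HS' : ∀ j m, S (p, (j, m)) ↔ (ratCode (n p) : ℝ) + ratCode m < dist (a j) (a (i p)) := by
    intro j m
    rw [HS _ trivial, ratCode_ratNat]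
    push_cast; exact sub_pos
  ext x
  constructor
  · intro hx
    have hx' : (ratCode (n p) : ℝ) < dist x (a (i p)) := hx
    refine mem_ballUnion_of_small ha (δ := (dist x (a (i p)) - ratCode (n p)) / 2) (by linarith) ?_
    intro j m hj hm
    rw [HS']
    have := dist_triangle x (a j) (a (i p))
    linarith
  · rintro ⟨j, m, h1, h2⟩
    rw [HS'] at h1
    have := dist_triangle (a j) x (a (i p))
    rw [dist_comm (a j) x] at this
    show (ratCode (n p) : ℝ) < dist x (a (i p))
    linarith

end Polish

/-- The measures of uniformly effectively open sets are lower semicomputable. -/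
theorem SigmaOne.lsc_measure [MeasurableSpace X] {μ : Measure X} (hμ : IsComputableMeasure a μ)
    (hU : SigmaOne a D U) : LSC D fun p => μ.real (U p) := by
  obtain ⟨e, he, h⟩ := hU.exists_code
  refine ⟨fun x => (ratCode x.2 : ℝ) < μ.real (effOpen a (e x.1)),
    hμ.lower.comp (f := fun x : α × ℕ => (e x.1, x.2))
      ((he.comp Computable.fst).pair Computable.snd), fun p hp q => ?_⟩
  change _ ↔ (ratCode q : ℝ) < μ.real (U p)
  rw [h p hp]

end Sigma

/-! ### Cells -/

theorem length_initSeg (y : ℕ → Bool) (n : ℕ) : (initSeg y n).length = n := by simp [initSeg]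

theorem initSeg_succ (y : ℕ → Bool) (n : ℕ) : initSeg y (n + 1) = initSeg y n ++ [y n] := by
  simp [initSeg, List.range_succ]

theorem getElem_initSeg (y : ℕ → Bool) (n i : ℕ) (h : i < (initSeg y n).length) :
    (initSeg y n)[i] = y i := by simp [initSeg]

namespace CellDecomposition

variable {X : Type*} [MetricSpace X] [MeasurableSpace X] {a : ℕ → X} {μ : Measure X}
  (A : CellDecomposition a μ)

theorem cell_nil : A.cell [] = Set.univ := by
  ext x; simp [cell]

theorem mem_cell_snoc {σ : List Bool} {b : Bool} {x : X} : x ∈ A.cell (σ ++ [b]) ↔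
    x ∈ A.cell σ ∧ x ∈ effOpen a (A.code σ.length b) := by
  constructor
  · intro h
    refine ⟨fun i hi => ?_, ?_⟩
    · have := h i (by simp; omega)
      rwa [List.getElem_append_left hi] at this
    · have := h σ.length (by simp)
      simpa using this
  · rintro ⟨h1, h2⟩ i hi
    rcases Nat.lt_succ_iff_lt_or_eq.1 (by simpa using hi) with h | rfl
    · rw [List.getElem_append_left h]; exact h1 i h
    · simpa using h2

theorem cell_anti {σ τ : List Bool} (h : σ <+: τ) : A.cell τ ⊆ A.cell σ := by
  obtain ⟨ρ, rfl⟩ := h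
  intro x hx i hi
  have := hx i (by simp; omega)
  rwa [List.getElem_append_left hi] at this

theorem isOpen_cell (σ : List Bool) : IsOpen (A.cell σ) := by
  induction σ using List.reverseRecOn with
  | nil => rw [cell_nil]; exact isOpen_univ
  | append_singleton σ b ih =>
    have : A.cell (σ ++ [b]) = A.cell σ ∩ effOpen a (A.code σ.length b) := by
      ext x; exact A.mem_cell_snoc
    rw [this]
    exact ih.inter (isOpen_effOpen _)

theorem eq_of_mem_cell {σ τ : List Bool} {x : X} (hσ : x ∈ A.cell σ) (hτ : x ∈ A.cell τ)
    (h : σ.length = τ.length) : σ = τ := by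
  apply List.ext_getElem h
  intro i h1 h2
  by_contra hne
  have e1 := hσ i h1
  have e2 := hτ i h2
  have := Set.disjoint_left.1 (A.disjoint i)
  cases hs : σ[i] <;> cases ht : τ[i] <;> simp_all

theorem disjoint_cell {σ τ : List Bool} (hne : σ ≠ τ) (h : σ.length = τ.length) :
    Disjoint (A.cell σ) (A.cell τ) :=
  Set.disjoint_left.2 fun _ h1 h2 => hne (A.eq_of_mem_cell h1 h2 h)

variable {A}

theorem IsName.eq_initSeg {x : X} {y : ℕ → Bool} (hy : A.IsName x y) {σ : List Bool}
    (h : x ∈ A.cell σ) : σ = initSeg y σ.length :=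
  A.eq_of_mem_cell h (hy _) (length_initSeg _ _).symm

theorem isName_iff {x : X} {y : ℕ → Bool} :
    A.IsName x y ↔ ∀ i, x ∈ effOpen a (A.code i (y i)) := by
  constructor
  · intro h i
    have := h (i + 1)
    rw [initSeg_succ, mem_cell_snoc, length_initSeg] at this
    exact this.2
  · intro h n i hi
    rw [getElem_initSeg]; exact h i

variable [BorelSpace X] (A)

theorem measurableSet_cell (σ : List Bool) : MeasurableSet (A.cell σ) :=
  (A.isOpen_cell σ).measurableSet

variable [IsProbabilityMeasure μ]

theorem ae_mem_union (i : ℕ) :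
    ∀ᵐ x ∂μ, x ∈ effOpen a (A.code i false) ∪ effOpen a (A.code i true) :=
  mem_ae_iff_prob_eq_one (((isOpen_effOpen _).union (isOpen_effOpen _)).measurableSet) |>.2
    (A.full i)

theorem ae_represented : ∀ᵐ x ∂μ, ∃ y, A.IsName x y := by
  have := ae_all_iff.2 A.ae_mem_union
  filter_upwards [this] with x hx
  have : ∀ i, ∃ b, x ∈ effOpen a (A.code i b) := fun i => by
    rcases hx i with h | h
    exacts [⟨_, h⟩, ⟨_, h⟩]
  choose y hy using this
  exact ⟨y, isName_iff.2 hy⟩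

theorem cell_ae_eq (σ : List Bool) :
    A.cell σ =ᵐ[μ] (A.cell (σ ++ [false]) ∪ A.cell (σ ++ [true]) : Set X) := by
  filter_upwards [A.ae_mem_union σ.length] with x hx
  apply propext
  change x ∈ A.cell σ ↔ x ∈ A.cell (σ ++ [false]) ∪ A.cell (σ ++ [true])
  rw [Set.mem_union, mem_cell_snoc, mem_cell_snoc, ← and_or_left]
  exact ⟨fun h => ⟨h, hx⟩, fun h => h.1⟩

omit [BorelSpace X] [IsProbabilityMeasure μ] in
theorem disjoint_children (σ : List Bool) :
    Disjoint (A.cell (σ ++ [false])) (A.cell (σ ++ [true])) :=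
  A.disjoint_cell (by simp) (by simp)

theorem lintegral_cell (σ : List Bool) (f : X → ℝ≥0∞) : ∫⁻ x in A.cell σ, f x ∂μ =
    ∫⁻ x in A.cell (σ ++ [false]), f x ∂μ + ∫⁻ x in A.cell (σ ++ [true]), f x ∂μ := by
  rw [setLIntegral_congr (A.cell_ae_eq σ),
    lintegral_union (A.measurableSet_cell _) (A.disjoint_children σ)]

theorem measure_inter_cell (σ : List Bool) (S : Set X) : μ (S ∩ A.cell σ) =
    μ (S ∩ A.cell (σ ++ [false])) + μ (S ∩ A.cell (σ ++ [true])) := by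
  have h : ∀ τ, μ (S ∩ A.cell τ) = μ.restrict S (A.cell τ) := fun τ => by
    rw [Measure.restrict_apply (A.measurableSet_cell τ), Set.inter_comm]
  rw [h, h, h, measure_congr (ae_mono Measure.restrict_le_self (A.cell_ae_eq σ)),
    measure_union (A.disjoint_children σ) (A.measurableSet_cell _)]

theorem measureReal_inter_cell (σ : List Bool) (S : Set X) :
    μ.real (S ∩ A.cell (σ ++ [false])) + μ.real (S ∩ A.cell (σ ++ [true])) =
    μ.real (S ∩ A.cell σ) := by
  rw [measureReal_def, measureReal_def, measureReal_def, A.measure_inter_cell σ,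
    ENNReal.toReal_add (measure_ne_top _ _) (measure_ne_top _ _)]

theorem measureReal_cell (σ : List Bool) :
    μ.real (A.cell (σ ++ [false])) + μ.real (A.cell (σ ++ [true])) = μ.real (A.cell σ) := by
  simpa using A.measureReal_inter_cell σ Set.univ

omit [BorelSpace X] in
theorem measureReal_cell_nil : μ.real (A.cell []) = 1 := by simp [A.cell_nil]

omit [BorelSpace X] in
theorem measureReal_cell_le {σ τ : List Bool} (h : σ <+: τ) :
    μ.real (A.cell τ) ≤ μ.real (A.cell σ) := measureReal_mono (A.cell_anti h)

end CellDecomposition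

/-! ### Additive families on strings -/

section Additive

variable {α : Type*} [Primcodable α]

/-- The sibling of the initial segment of length `i + 1` of `σ`. -/
def sibling (σ : List Bool) (i : ℕ) : List Bool := σ.take i ++ [!(σ.getD i false)]

theorem primrec_sibling : Primrec₂ sibling :=
  Primrec.list_append.comp (Primrec.list_take.comp Primrec.snd Primrec.fst)
    (Primrec.list_cons.comp (Primrec.not.comp
      ((Primrec.list_getD false).comp Primrec.fst Primrec.snd)) (Primrec.const []))

/-- The siblings that branch off along the path to `σ`, together with `σ`, partition the total mass.
Thus lower bounds for the siblings become an upper bound for `σ`. -/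
theorem eq_sub_sum_sibling {T : List Bool → ℝ}
    (hT : ∀ σ, T (σ ++ [false]) + T (σ ++ [true]) = T σ) (σ : List Bool) :
    T σ = T [] - ∑ i ∈ Finset.range σ.length, T (sibling σ i) := by
  have hT' : ∀ σ b, T (σ ++ [b]) = T σ - T (σ ++ [!b]) := by
    intro σ b
    have := hT σ
    cases b
    · simp only [Bool.not_false]; linarith
    · simp only [Bool.not_true]; linarith
  have key : ∀ j ≤ σ.length, T (σ.take j) = T [] - ∑ i ∈ Finset.range j, T (sibling σ i) := by
    intro j
    induction j with
    | zero => intro _; simp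
    | succ j ih =>
      intro hj
      rw [Finset.sum_range_succ, List.take_succ_eq_append_getElem (by omega), hT', ih (by omega)]
      simp only [sibling, List.getD_eq_getElem _ _ (show j < σ.length by omega)]
      ring
  simpa using key σ.length le_rfl

/-- An additive lower semicomputable family on strings with computable total mass is computable. -/
theorem CR.of_additive {D : α → Prop} {T : α × List Bool → ℝ} (hT : LSC (fun p => D p.1) T)
    (hadd : ∀ p, D p → ∀ σ, T (p, σ ++ [false]) + T (p, σ ++ [true]) = T (p, σ))
    (h0 : LSC D fun p => -T (p, [])) : CR (fun p => D p.1) T := by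
  refine ⟨hT, ?_⟩
  have h1 : LSC (fun p : α × List Bool => D p.1) fun p => -T (p.1, []) := h0.comp Computable.fst
  have h2 : LSC (fun y : (α × List Bool) × ℕ => D y.1.1) fun y => T (y.1.1, sibling y.1.2 y.2) :=
    hT.comp (g := fun y : (α × List Bool) × ℕ => (y.1.1, sibling y.1.2 y.2))
      ((Computable.fst.comp Computable.fst).pair (primrec_sibling.to_comp.comp
        (Computable.snd.comp Computable.fst) Computable.snd))
  have h3 := (LSC.list_sum (D := fun p : α × List Bool => D p.1) h2).comp
    (g := fun p : α × List Bool => (p, List.range p.2.length))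
    (Computable.id.pair (Primrec.list_range.comp (Primrec.list_length.comp Primrec.snd)).to_comp)
  refine (h1.add h3).congr fun p hp => ?_
  have := eq_sub_sum_sibling (T := fun σ => T (p.1, σ)) (hadd p.1 hp) p.2
  have e : p = (p.1, p.2) := rfl
  rw [e]
  dsimp only at this ⊢
  rw [this, Finset.sum_eq_multiset_sum]
  change _ + _ = -(T (p.1, []) - (List.map _ _).sum)
  ring

end Additive

/-! ### Computability of cells -/

namespace CellDecomposition

variable {X : Type*} [MetricSpace X] [MeasurableSpace X] {a : ℕ → X} {μ : Measure X}
  (A : CellDecomposition a μ)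

theorem sigmaOne_cell [CompleteSpace X] (ha : IsComputablePolish a) :
    SigmaOne a (fun _ : List Bool => True) fun σ => A.cell σ := by
  have h : SigmaOne a (fun _ : List Bool × ℕ => True)
      fun x => effOpen a (A.code x.2 (x.1.getD x.2 false)) :=
    SigmaOne.of_code (A.code_computable.comp Computable.snd (Primrec.list_getD false).to_comp)
  refine (SigmaOne.forall_mem (D := fun _ : List Bool => True) ha h
    (Primrec.list_range.comp Primrec.list_length).to_comp).congr fun σ _ => ?_
  ext x
  simp only [Set.mem_ofPred_eq, List.mem_range, cell]
  refine forall_congr' fun i => forall_congr' fun hi => ?_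
  rw [List.getD_eq_getElem _ _ hi]

variable [BorelSpace X] [IsProbabilityMeasure μ]

/-- For fixed `S` the family is additive in the string and lower semicomputable, so an upper bound
on the mass of `S` alone makes all of it computable. With `S` the whole space, this gives the masses
of the cells. -/
theorem cr_inter_cell [CompleteSpace X] (ha : IsComputablePolish a)
    (hμ : IsComputableMeasure a μ) {α : Type*} [Primcodable α] {D : α → Prop} {S : α → Set X}
    (hS : SigmaOne a D S) (h : LSC D fun p => -μ.real (S p)) :
    CR (fun p : α × List Bool => D p.1) fun p => μ.real (S p.1 ∩ A.cell p.2) := by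
  refine CR.of_additive (SigmaOne.lsc_measure hμ (SigmaOne.inter ha (hS.comp Computable.fst)
    (((A.sigmaOne_cell ha).comp Computable.snd).mono fun _ _ => trivial)))
    (fun p _ σ => A.measureReal_inter_cell σ _) (h.congr fun p _ => ?_)
  simp [A.cell_nil]

theorem cr_cell [CompleteSpace X] (ha : IsComputablePolish a)
    (hμ : IsComputableMeasure a μ) {α : Type*} [Primcodable α] {D : α → Prop} {s : α → List Bool}
    (hs : Computable s) : CR D fun p => μ.real (A.cell (s p)) := by
  have h : CR (fun _ : Unit × List Bool => True) fun p => μ.real (A.cell p.2) := by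
    refine (A.cr_inter_cell ha hμ (D := fun _ : Unit => True) (S := fun _ => Set.univ)
      (((A.sigmaOne_cell ha).comp (Computable.const ([] : List Bool))).congr
        fun _ _ => A.cell_nil) ?_).congr fun p _ => by simp
    exact (CR.const_nat 1).2.congr fun _ _ => by simp
  exact (h.comp (g := fun p : α => ((), s p)) ((Computable.const ()).pair hs)).mono
    fun _ _ => trivial

/-- Positivity of a cell is r.e. -/
theorem rePred_pos [CompleteSpace X] (ha : IsComputablePolish a)
    (hμ : IsComputableMeasure a μ) {α : Type*} [Primcodable α] {s : α → List Bool}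
    (hs : Computable s) : REPred fun p => 0 < μ.real (A.cell (s p)) := by
  obtain ⟨R, hR, H⟩ := (A.cr_cell ha hμ (D := fun _ => True) hs).1.exists_rePred
    (Computable.const (ratNat 0))
  refine hR.of_eq fun p => ?_
  rw [H p trivial, ratCode_ratNat]; simp

omit [BorelSpace X] in
theorem pos_iff {σ : List Bool} : 0 < μ (A.cell σ) ↔ 0 < μ.real (A.cell σ) := by
  rw [measureReal_def, ENNReal.toReal_pos_iff]
  simp

/-- There is an r.e. relation between effectively open sets and cells that are contained in them
almost everywhere, and these cells exhaust the set almost everywhere. -/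
theorem exists_cover : ∃ Cov : Code × List Bool → Prop, REPred Cov ∧
    (∀ e σ τ, σ <+: τ → Cov (e, σ) → Cov (e, τ)) ∧
    (∀ e σ, Cov (e, σ) → μ (A.cell σ \ effOpen a e) = 0) ∧
    ∀ e, ∀ᵐ x ∂μ, x ∈ effOpen a e → ∃ σ, Cov (e, σ) ∧ x ∈ A.cell σ := by
  obtain ⟨G, hG, H⟩ := A.generates
  -- A string covers when it decides, with the right values, all literals of some clause of an
  -- enumerated normal form.
  refine ⟨fun x => ∃ y : List (List (ℕ × Bool)) × List (ℕ × Bool),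
    ((G x.1).eval (encode y.1)).Dom ∧ (y.2 ∈ y.1 ∧ ∀ l ∈ y.2, x.2[l.1]? = some l.2), ?_, ?_, ?_, ?_⟩
  · refine REPred.exists (p := fun z : (Code × List Bool) ×
      (List (List (ℕ × Bool)) × List (ℕ × Bool)) => ((G z.1.1).eval (encode z.2.1)).Dom ∧
      (z.2.2 ∈ z.2.1 ∧ ∀ l ∈ z.2.2, z.1.2[l.1]? = some l.2))
      ((rePred_eval_dom ?_ ?_).and ((PrimrecPred.rePred ?_).and ?_))
    · exact hG.comp (Computable.fst.comp Computable.fst)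
    · exact Computable.encode.comp (Computable.fst.comp Computable.snd)
    · refine (PrimrecRel.comp (PrimrecRel.exists_mem_list Primrec.eq)
        (Primrec.fst.comp Primrec.snd) (Primrec.snd.comp Primrec.snd)).of_eq fun z => ?_
      simp
    · refine (REPred.forall_mem (p := fun w : List Bool × (ℕ × Bool) => w.1[w.2.1]? = some w.2.2)
        (rePred_eq ?_ ?_)).comp (f := fun z : (Code × List Bool) ×
          (List (List (ℕ × Bool)) × List (ℕ × Bool)) => (z.1.2, z.2.2)) ?_
      · exact (Primrec.list_getElem?.comp Primrec.fst (Primrec.fst.comp Primrec.snd)).to_comp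
      · exact (Primrec.option_some.comp (Primrec.snd.comp Primrec.snd)).to_comp
      · exact (Computable.snd.comp Computable.fst).pair (Computable.snd.comp Computable.snd)
  · rintro e σ τ ⟨ρ, rfl⟩ ⟨y, h1, h2, h3⟩
    refine ⟨y, h1, h2, fun l hl => ?_⟩
    have := h3 l hl
    dsimp only at this ⊢
    obtain ⟨hlt, -⟩ := List.getElem?_eq_some_iff.1 this
    rw [List.getElem?_append_left hlt, this]
  · rintro e σ ⟨y, h1, h2, h3⟩
    refine measure_mono_null ?_ (ae_iff.1 (H e))
    rintro x ⟨hx1, hx2⟩ heq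
    refine hx2 ((iff_of_eq heq).2 ⟨y.1, h1, y.2, h2, fun l hl => ?_⟩)
    obtain ⟨hlt, he⟩ := List.getElem?_eq_some_iff.1 (h3 l hl)
    have := hx1 l.1 hlt
    rwa [he] at this
  · intro e
    filter_upwards [H e, A.ae_represented] with x heq ⟨y, hy⟩ hx
    obtain ⟨D, h1, C, h2, h3⟩ := (iff_of_eq heq).1 hx
    -- This length exceeds every index in the clause, so the initial segment decides all its
    -- literals. It decides them correctly because the two sides of each pair are disjoint.
    refine ⟨initSeg y ((C.map Prod.fst).sum + 1), ⟨(D, C), h1, h2, fun l hl => ?_⟩, hy _⟩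
    have hlt : l.1 < (initSeg y ((C.map Prod.fst).sum + 1)).length := by
      rw [length_initSeg]
      exact Nat.lt_succ_of_le (List.single_le_sum (by simp) _ (List.mem_map_of_mem hl))
    rw [List.getElem?_eq_getElem hlt, getElem_initSeg]
    congr 1
    by_contra hne
    have e1 := isName_iff.1 hy l.1
    have e2 := h3 l hl
    have := Set.disjoint_left.1 (A.disjoint l.1)
    cases hs : y l.1 <;> cases ht : l.2 <;> simp_all

end CellDecomposition

/-! ### Kurtz random points -/

namespace IsKurtzRandom

variable {X : Type*} [MetricSpace X] [MeasurableSpace X] {a : ℕ → X} {μ : Measure X} {x : X}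

/-- The form in which Kurtz randomness is used: such a point lies in every effectively open set of
full measure. -/
theorem mem_of_ae {α : Type*} [Primcodable α] {D : α → Prop} {U : α → Set X}
    (hx : IsKurtzRandom a μ x) (hU : SigmaOne a D U) {p : α} (hp : D p)
    (h : ∀ᵐ z ∂μ, z ∈ U p) : x ∈ U p := by
  obtain ⟨e, -, he⟩ := hU.exists_code
  have := hx (e p)
  rw [← he p hp] at this
  by_contra hn
  exact this h hn

variable [BorelSpace X] [IsProbabilityMeasure μ] {A : CellDecomposition a μ}

theorem represented (hx : IsKurtzRandom a μ x) : ¬ A.Unrepresented x := by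
  rw [CellDecomposition.Unrepresented, not_not]
  have h : ∀ i, ∃ b, x ∈ effOpen a (A.code i b) := by
    intro i
    have hU : SigmaOne a (fun _ : ℕ => True)
        fun i => {x | ∃ b : Bool, True ∧ x ∈ effOpen a (A.code i b)} :=
      SigmaOne.iUnion (U := fun y : ℕ × Bool => effOpen a (A.code y.1 y.2)) rePred_true
        (SigmaOne.of_code A.code_computable)
    obtain ⟨b, -, hb⟩ := hx.mem_of_ae (p := i) hU trivial (by
      filter_upwards [A.ae_mem_union i] with z hz
      rcases hz with h | h
      exacts [⟨_, trivial, h⟩, ⟨_, trivial, h⟩])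
    exact ⟨b, hb⟩
  choose y hy using h
  exact ⟨y, CellDecomposition.isName_iff.2 hy⟩

variable [CompleteSpace X] (ha : IsComputablePolish a)
include ha

/-- If a cell is null, the union of the other cells of the same length has full measure, is
effectively open and misses that cell. -/
theorem not_inNullCell (hx : IsKurtzRandom a μ x) : ¬ A.InNullCell x := by
  rintro ⟨σ, hσ, h0⟩
  have hU : SigmaOne a (fun _ : Unit => True)
      fun _ => {x | ∃ τ : List Bool, (τ.length = σ.length ∧ τ ≠ σ) ∧ x ∈ A.cell τ} := by
    refine SigmaOne.iUnion (G := fun y : Unit × List Bool => y.2.length = σ.length ∧ y.2 ≠ σ)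
      (U := fun y => A.cell y.2) (PrimrecPred.rePred ?_)
      (((A.sigmaOne_cell ha).comp Computable.snd).mono fun _ _ => trivial)
    exact (Primrec.eq.comp (Primrec.list_length.comp Primrec.snd) (Primrec.const _)).and
      (Primrec.eq.comp Primrec.snd (Primrec.const σ)).not
  obtain ⟨τ, ⟨h1, h2⟩, h3⟩ := hx.mem_of_ae (p := ()) hU trivial (by
    filter_upwards [A.ae_represented, measure_eq_zero_iff_ae_notMem.1 h0] with z ⟨y, hy⟩ hz
    exact ⟨initSeg y σ.length, ⟨length_initSeg _ _, fun h => hz (h ▸ hy _)⟩, hy _⟩)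
  exact h2 (A.eq_of_mem_cell h3 hσ h1)

/-- Around a nearby simple point take two rational balls, the smaller containing `x`, the larger
inside the neighbourhood. The exterior of the smaller closed ball, together with the cells almost
contained in the larger ball, is effectively open of full measure. Since `x` is not in the exterior,
it lies in one of these cells. -/
theorem cellsShrinkTo (hx : IsKurtzRandom a μ x) : A.CellsShrinkTo x := by
  intro O hO hxO
  obtain ⟨ε, hε, hb⟩ := Metric.isOpen_iff.1 hO x hxO
  obtain ⟨i, hi⟩ := exists_simple_near ha x (show 0 < ε / 4 by linarith)
  obtain ⟨m, hm1, hm2⟩ := exists_ratCode_between hi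
  obtain ⟨n, hn1, hn2⟩ := exists_ratCode_between (show ε / 4 < ε / 2 by linarith)
  obtain ⟨Cov, hCov, -, hsub, hex⟩ := A.exists_cover
  obtain ⟨e, -, he⟩ := (sigmaOne_ball (a := a) (D := fun _ : Unit => True)
    (Computable.const i) (Computable.const n)).exists_code
  have hU : SigmaOne a (fun _ : Unit => True) fun _ =>
      {z | (ratCode m : ℝ) < dist z (a i)} ∪ {z | ∃ σ, Cov (e (), σ) ∧ z ∈ A.cell σ} :=
    (sigmaOne_coball ha (Computable.const i) (Computable.const m)).union
      (SigmaOne.iUnion (G := fun y : Unit × List Bool => Cov (e (), y.2))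
        (U := fun y => A.cell y.2) (hCov.comp ((Computable.const _).pair Computable.snd))
        (((A.sigmaOne_cell ha).comp Computable.snd).mono fun _ _ => trivial))
  have hx' := hx.mem_of_ae (p := ()) hU trivial (by
    filter_upwards [hex (e ())] with z hz
    by_cases hzm : (ratCode m : ℝ) < dist z (a i)
    · exact Or.inl hzm
    · refine Or.inr (hz ?_)
      rw [← he () trivial]
      change dist z (a i) < _
      linarith)
  rcases hx' with h3 | ⟨σ, h1, h2⟩
  · have h4 : (ratCode m : ℝ) < dist x (a i) := h3
    linarith
  · refine ⟨σ, h2, measure_mono_null ?_ (hsub _ _ h1)⟩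
    refine Set.sdiff_subset_sdiff_right fun z hz => hb ?_
    rw [← he () trivial] at hz
    have h3 : dist z (a i) < ratCode n := hz
    rw [Metric.mem_ball]
    have := dist_triangle_right z x (a i)
    linarith

end IsKurtzRandom

/-! ### From martingales to measures -/

section Martingale

variable {X : Type*} [MetricSpace X] [MeasurableSpace X] {a : ℕ → X} {μ : Measure X}
  {A : CellDecomposition a μ} {M : List Bool →. ℝ}

theorem val_of_mem {σ : List Bool} {v : ℝ} (h : v ∈ M σ) : val M σ = v := by
  obtain ⟨hd, rfl⟩ := h
  exact @Part.getOrElse_of_dom _ _ hd (Classical.propDecidable _) _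

theorem val_of_not_dom {σ : List Bool} (h : ¬ (M σ).Dom) : val M σ = 0 := by
  exact @Part.getOrElse_of_not_dom _ _ h (Classical.propDecidable _) _

theorem IsMartingale.val_nonneg (hM : IsMartingale A M) (σ : List Bool) : 0 ≤ val M σ := by
  by_cases h : (M σ).Dom
  · rw [val_of_mem (Part.get_mem h)]; exact hM.nonneg σ _ (Part.get_mem h)
  · rw [val_of_not_dom h]

variable [BorelSpace X] [IsProbabilityMeasure μ] [CompleteSpace X]

omit [BorelSpace X] [CompleteSpace X] in
theorem cr_val (D : Code → Prop) (m : Code → List Bool →. ℝ)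
    (h : ∀ c, D c → Computes c (m c) ∧ IsMartingale A (m c)) :
    CR (fun p : Code × List Bool => D p.1 ∧ 0 < μ.real (A.cell p.2))
      fun p => val (m p.1) p.2 := by
  refine CR.of_codes fun p hp k => ?_
  obtain ⟨h1, h2⟩ := h p.1 hp.1
  have hd := (h2.dom p.2).2 (A.pos_iff.2 hp.2)
  rw [val_of_mem (Part.get_mem hd)]
  exact ⟨_, Part.get_mem ((h1 p.2 k).1.2 hd), (h1 p.2 k).2 _ (Part.get_mem _) _ (Part.get_mem hd)⟩

/-- A martingale determines a measure on Cantor space, uniformly. -/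
theorem exists_measure_of_martingale (ha : IsComputablePolish a) (hμ : IsComputableMeasure a μ)
    (A : CellDecomposition a μ) : ∃ F : Code → Code, Computable F ∧
      ∀ c M, Computes c M → IsMartingale A M →
        ComputesMeasure (F c) fun σ => val M σ * μ.real (A.cell σ) := by
  classical
  -- The choice is immaterial, as a code determines the partial function it computes.
  let m : Code → List Bool →. ℝ := fun c =>
    if h : ∃ M, Computes c M ∧ IsMartingale A M then h.choose else fun _ => Part.none
  let D : Code → Prop := fun c => ∃ M, Computes c M ∧ IsMartingale A M
  have hm : ∀ c, D c → Computes c (m c) ∧ IsMartingale A (m c) := by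
    intro c hc
    have : m c = hc.choose := dif_pos hc
    rw [this]; exact hc.choose_spec
  have hval := cr_val D m hm
  have hcell : CR (fun p : Code × List Bool => D p.1 ∧ 0 < μ.real (A.cell p.2))
      fun p => μ.real (A.cell p.2) := A.cr_cell ha hμ Computable.snd
  have hprod := hval.mul hcell (fun p hp => (hm p.1 hp.1).2.val_nonneg _)
    (fun _ _ => measureReal_nonneg)
  have hL : LSC (fun p : Code × List Bool => D p.1)
      fun p => val (m p.1) p.2 * μ.real (A.cell p.2) := by
    refine LSC.of_guard (A.rePred_pos ha hμ Computable.snd) hprod.1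
      (fun p hp => mul_nonneg ((hm p.1 hp).2.val_nonneg _) measureReal_nonneg) fun p hp h0 => ?_
    rw [le_antisymm (not_lt.1 h0) measureReal_nonneg, mul_zero]
  have hC : CR (fun p : Code × List Bool => D p.1)
      fun p => val (m p.1) p.2 * μ.real (A.cell p.2) := by
    refine CR.of_additive hL (fun c hc σ => (hm c hc).2.fair σ) ?_
    have := hprod.2.comp (g := fun c : Code => (c, ([] : List Bool)))
      (Computable.id.pair (Computable.const _))
    exact this.mono fun c hc => ⟨hc, by simp [A.measureReal_cell_nil]⟩
  obtain ⟨F, hF, hFc⟩ := hC.exists_computes_total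
  refine ⟨F, hF, fun c M h1 h2 => ?_⟩
  have hc : D c := ⟨M, h1, h2⟩
  have he : m c = M := Computes.eq_of_mem (hm c hc).1 h1
  have := hFc c hc
  simp only [he] at this
  exact ⟨this, fun σ => mul_nonneg (h2.val_nonneg _) measureReal_nonneg, h2.fair⟩

end Martingale

/-! ### The savings strategy -/

theorem tendsto_savings {w s m v : ℕ → ℝ} (hm : ∀ n, 0 < m n) (hv : ∀ n, 0 < v n)
    (hw : ∀ n, w (n + 1) = min (w n) (m (n + 1) / v (n + 1))) (hw0 : w 0 = m 0 / v 0)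
    (hs : ∀ n, s n + (min (w n * v (n + 1)) (2 * m (n + 1)) - min (w n * v (n + 1)) (m (n + 1)))
      / m (n + 1) ≤ s (n + 1)) (hun : ∀ B, ∃ n, B * m n < v n) : Tendsto s atTop atTop := by
  have hwpos : ∀ n, 0 < w n := by
    intro n
    induction n with
    | zero => rw [hw0]; exact div_pos (hm 0) (hv 0)
    | succ n ih => rw [hw]; exact lt_min ih (div_pos (hm _) (hv _))
  have hwle : ∀ n, w n ≤ m n / v n := by
    rintro (_ | n)
    · exact hw0.le
    · rw [hw]; exact min_le_right _ _
  have hanti : Antitone w := antitone_nat_of_succ_le fun n => by rw [hw]; exact min_le_left _ _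
  have hmono : Monotone s := by
    refine monotone_nat_of_le_succ fun n => le_trans ?_ (hs n)
    have : min (w n * v (n + 1)) (m (n + 1)) ≤ min (w n * v (n + 1)) (2 * m (n + 1)) :=
      min_le_min le_rfl (by have := hm (n + 1); linarith)
    have := div_nonneg (sub_nonneg.2 this) (hm (n + 1)).le
    linarith
  rcases tendsto_atTop_of_monotone hmono with h | ⟨l, hl⟩
  · exact h
  exfalso
  have hsl : ∀ n, s n ≤ l := fun n => hmono.ge_of_tendsto hl n
  have hdiff : Tendsto (fun n => s (n + 1) - s n) atTop (𝓝 0) := by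
    simpa using ((tendsto_add_atTop_iff_nat 1).2 hl).sub hl
  obtain ⟨n0, hn0⟩ := eventually_atTop.1 (hdiff.eventually_lt_const one_pos)
  have hstep : ∀ n ≥ n0, w n * Real.exp (s n) ≤ w (n + 1) * Real.exp (s (n + 1)) := by
    intro n hn
    have h1 := hn0 n hn
    have h2 := hs n
    have hmp := hm (n + 1)
    have hvp := hv (n + 1)
    set t := w n * v (n + 1) / m (n + 1) with ht
    have htm : w n * v (n + 1) = t * m (n + 1) := by rw [ht]; field_simp
    have hwn : 0 < w n := hwpos n
    rcases le_or_gt t 1 with h | h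
    · have : w (n + 1) = w n := by
        rw [hw, min_eq_left]
        rw [le_div_iff₀ hvp, htm]; nlinarith
      rw [this]
      exact mul_le_mul_of_nonneg_left (Real.exp_le_exp.2 (hmono n.le_succ)) hwn.le
    · have hmin1 : min (w n * v (n + 1)) (m (n + 1)) = m (n + 1) :=
        min_eq_right (by rw [htm]; nlinarith)
      have ht2 : t < 2 := by
        by_contra hcon
        push Not at hcon
        have : min (w n * v (n + 1)) (2 * m (n + 1)) = 2 * m (n + 1) :=
          min_eq_right (by rw [htm]; nlinarith)
        rw [this, hmin1] at h2
        have : (2 * m (n + 1) - m (n + 1)) / m (n + 1) = 1 := by field_simp; ring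
        linarith
      have hmin2 : min (w n * v (n + 1)) (2 * m (n + 1)) = t * m (n + 1) := by
        rw [htm]; exact min_eq_left (by nlinarith)
      rw [hmin1, hmin2] at h2
      have e1 : (t * m (n + 1) - m (n + 1)) / m (n + 1) = t - 1 := by field_simp
      rw [e1] at h2
      have e2 : w (n + 1) = w n / t := by
        rw [hw, min_eq_right]
        · rw [ht]; field_simp
        · rw [div_le_iff₀ hvp, htm]; nlinarith
      have e3 : t ≤ Real.exp (s (n + 1) - s n) := by
        have := Real.add_one_le_exp (s (n + 1) - s n)
        linarith
      have e4 : Real.exp (s (n + 1)) = Real.exp (s (n + 1) - s n) * Real.exp (s n) := by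
        rw [← Real.exp_add]; ring_nf
      rw [e2, e4, div_mul_eq_mul_div, le_div_iff₀ (by linarith)]
      have := mul_le_mul_of_nonneg_left e3 (mul_pos hwn (Real.exp_pos (s n))).le
      nlinarith
  have hge : ∀ n ≥ n0, w n0 * Real.exp (s n0) ≤ w n * Real.exp (s n) := by
    intro n hn
    induction n, hn using Nat.le_induction with
    | base => exact le_rfl
    | succ n hn ih => exact ih.trans (hstep n hn)
  set c := w n0 * Real.exp (s n0) / Real.exp l with hc
  have hcpos : 0 < c := by have := hwpos n0; positivity
  have hcw : ∀ n, c ≤ w n := by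
    intro n
    have h1 : c ≤ w (max n n0) := by
      rw [hc, div_le_iff₀ (Real.exp_pos _)]
      exact (hge (max n n0) (le_max_right _ _)).trans
        (mul_le_mul_of_nonneg_left (Real.exp_le_exp.2 (hsl _)) (hwpos _).le)
    exact h1.trans (hanti (le_max_left _ _))
  obtain ⟨n, hn⟩ := hun (1 / c)
  have h1 := (hcw n).trans (hwle n)
  rw [le_div_iff₀ (hv n)] at h1
  rw [one_div, inv_mul_lt_iff₀ hcpos] at hn
  linarith

/-- The nonnegative additive functions on finite strings. -/
structure IsStringMeasure (ν : List Bool → ℝ) : Prop where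
  nonneg : ∀ σ, 0 ≤ ν σ
  add : ∀ σ, ν (σ ++ [false]) + ν (σ ++ [true]) = ν σ

theorem IsStringMeasure.le {ν : List Bool → ℝ} (h : IsStringMeasure ν) (σ : List Bool) (b : Bool) :
    ν (σ ++ [b]) ≤ ν σ := by
  have h0 := h.nonneg (σ ++ [false])
  have h1 := h.nonneg (σ ++ [true])
  have := h.add σ
  cases b <;> linarith

namespace Savings

variable (p ν : List Bool → ℝ)

/-- A strictly positive measure dominating `ν`. -/
def pert (σ : List Bool) : ℝ := ν σ + 2⁻¹ ^ σ.length

def ratio (σ : List Bool) : ℝ := p σ / pert ν σ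

/-- The fraction of `pert ν` that is at stake at `σ`. -/
def weight (σ : List Bool) : ℝ :=
  (Finset.range (σ.length + 1)).inf' Finset.nonempty_range_add_one fun i => ratio p ν (σ.take i)

/-- The mass at stake at `σ`. -/
def active (σ : List Bool) : ℝ := weight p ν σ * pert ν σ

/-- The mass that passes from `σ` to its child `τ`, apart from the part that is redistributed. -/
def kept (σ τ : List Bool) : ℝ := min (weight p ν σ * pert ν τ) (2 * p τ)

/-- The mass at `σ` to be redistributed over all of the cell `σ`. -/
def rest (σ : List Bool) : ℝ :=
  active p ν σ - (kept p ν σ (σ ++ [false]) + kept p ν σ (σ ++ [true]))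

/-- The savings made in passing from `σ` to its child `τ`. -/
def inc (σ τ : List Bool) : ℝ :=
  rest p ν σ * (p σ)⁻¹ + (kept p ν σ τ - active p ν τ) * (p τ)⁻¹

/-- The savings function. -/
def saved (σ : List Bool) : ℝ :=
  ∑ i ∈ Finset.range σ.length, inc p ν (σ.take i) (σ.take (i + 1))

/-- The total capital in the cell `σ`, as a measure. -/
def stake (σ : List Bool) : ℝ := saved p ν σ * p σ + active p ν σ

variable {p ν} (hp : IsStringMeasure p) (hν : IsStringMeasure ν)

theorem IsStringMeasure.pert (hν : IsStringMeasure ν) : IsStringMeasure (pert ν) :=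
  ⟨fun σ => add_nonneg (hν.nonneg σ) (by positivity), fun σ => by
    have := hν.add σ
    simp only [Savings.pert, List.length_append, List.length_singleton, pow_succ]
    linarith⟩

include hν in
theorem pert_pos (σ : List Bool) : 0 < pert ν σ :=
  add_pos_of_nonneg_of_pos (hν.nonneg σ) (by positivity)

theorem lt_weight_iff {σ : List Bool} {q : ℝ} :
    q < weight p ν σ ↔ ∀ i ≤ σ.length, q < ratio p ν (σ.take i) := by
  simp only [weight, Finset.lt_inf'_iff, Finset.mem_range, Nat.lt_succ_iff]

theorem weight_lt_iff {σ : List Bool} {q : ℝ} :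
    weight p ν σ < q ↔ ∃ i, ratio p ν (σ.take i) < q := by
  simp only [weight, Finset.inf'_lt_iff, Finset.mem_range, Nat.lt_succ_iff]
  constructor
  · rintro ⟨i, -, h⟩; exact ⟨i, h⟩
  · rintro ⟨i, h⟩
    rcases le_total i σ.length with hi | hi
    · exact ⟨i, hi, h⟩
    · refine ⟨σ.length, le_rfl, ?_⟩
      rwa [List.take_of_length_le hi, ← List.take_length (l := σ)] at h

theorem weight_nil : weight p ν [] = ratio p ν [] := by simp [weight]

theorem weight_snoc (σ : List Bool) (b : Bool) :
    weight p ν (σ ++ [b]) = min (weight p ν σ) (ratio p ν (σ ++ [b])) := by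
  refine eq_of_forall_lt_iff fun q => ?_
  rw [lt_min_iff, lt_weight_iff, lt_weight_iff]
  constructor
  · intro h
    refine ⟨fun i hi => ?_, ?_⟩
    · have := h i (by simp; omega)
      rwa [List.take_append_of_le_length hi] at this
    · have := h (σ.length + 1) (by simp)
      rwa [List.take_of_length_le (by simp)] at this
  · rintro ⟨h1, h2⟩ i hi
    rw [List.length_append, List.length_singleton] at hi
    rcases Nat.le_succ_iff.1 hi with h | h
    · rw [List.take_append_of_le_length h]; exact h1 i h
    · rw [List.take_of_length_le (by simp [h])]; exact h2

theorem weight_le_ratio (σ : List Bool) : weight p ν σ ≤ ratio p ν σ := by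
  have : weight p ν σ ≤ ratio p ν (σ.take σ.length) :=
    Finset.inf'_le _ (Finset.mem_range.2 (Nat.lt_succ_self _))
  simpa using this

include hν in
theorem active_snoc (σ : List Bool) (b : Bool) :
    active p ν (σ ++ [b]) = min (weight p ν σ * pert ν (σ ++ [b])) (p (σ ++ [b])) := by
  have hpos := pert_pos hν (σ ++ [b])
  rw [active, weight_snoc, min_mul_of_nonneg _ _ hpos.le, ratio, div_mul_cancel₀ _ hpos.ne']

include hν in
theorem active_le (σ : List Bool) : active p ν σ ≤ p σ := by
  have hpos := pert_pos hν σ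
  have := mul_le_mul_of_nonneg_right (weight_le_ratio (p := p) (ν := ν) σ) hpos.le
  rwa [ratio, div_mul_cancel₀ _ hpos.ne'] at this

include hν in
theorem active_nil : active p ν [] = p [] := by
  rw [active, weight_nil, ratio, div_mul_cancel₀ _ (pert_pos hν []).ne']

include hp hν

theorem ratio_nonneg (σ : List Bool) : 0 ≤ ratio p ν σ :=
  div_nonneg (hp.nonneg σ) (pert_pos hν σ).le

theorem weight_nonneg (σ : List Bool) : 0 ≤ weight p ν σ := by
  rw [weight, Finset.le_inf'_iff]
  exact fun i _ => ratio_nonneg hp hν _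

theorem active_nonneg (σ : List Bool) : 0 ≤ active p ν σ :=
  mul_nonneg (weight_nonneg hp hν σ) (pert_pos hν σ).le

theorem active_eq_zero {σ : List Bool} (h : p σ = 0) : active p ν σ = 0 :=
  le_antisymm (h ▸ active_le hν σ) (active_nonneg hp hν σ)

theorem kept_nonneg (σ τ : List Bool) : 0 ≤ kept p ν σ τ :=
  le_min (mul_nonneg (weight_nonneg hp hν σ) (pert_pos hν τ).le)
    (mul_nonneg zero_le_two (hp.nonneg τ))

theorem active_le_kept (σ : List Bool) (b : Bool) :
    active p ν (σ ++ [b]) ≤ kept p ν σ (σ ++ [b]) := by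
  rw [active_snoc hν, kept]
  exact min_le_min le_rfl (by have := hp.nonneg (σ ++ [b]); linarith)

omit hp in
theorem rest_nonneg (σ : List Bool) : 0 ≤ rest p ν σ := by
  have h1 : kept p ν σ (σ ++ [false]) ≤ weight p ν σ * pert ν (σ ++ [false]) := min_le_left _ _
  have h2 : kept p ν σ (σ ++ [true]) ≤ weight p ν σ * pert ν (σ ++ [true]) := min_le_left _ _
  have h3 := (IsStringMeasure.pert hν).add σ
  have h4 : active p ν σ = weight p ν σ * pert ν σ := rfl
  rw [← h3, mul_add] at h4
  rw [rest]; linarith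

theorem kept_eq_zero {σ τ : List Bool} (h : p τ = 0) : kept p ν σ τ = 0 := by
  refine le_antisymm ?_ (kept_nonneg hp hν σ τ)
  have : kept p ν σ τ ≤ 2 * p τ := min_le_right _ _
  rwa [h, mul_zero] at this

theorem inc_nonneg (σ : List Bool) (b : Bool) : 0 ≤ inc p ν σ (σ ++ [b]) :=
  add_nonneg (mul_nonneg (rest_nonneg hν σ) (inv_nonneg.2 (hp.nonneg σ)))
    (mul_nonneg (sub_nonneg.2 (active_le_kept hp hν σ b)) (inv_nonneg.2 (hp.nonneg _)))

omit hp hν in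
theorem saved_nil : saved p ν [] = 0 := by simp [saved]

omit hp hν in
theorem saved_snoc (σ : List Bool) (b : Bool) :
    saved p ν (σ ++ [b]) = saved p ν σ + inc p ν σ (σ ++ [b]) := by
  rw [saved, List.length_append, List.length_singleton, Finset.sum_range_succ]
  congr 1
  · refine Finset.sum_congr rfl fun i hi => ?_
    have := Finset.mem_range.1 hi
    rw [List.take_append_of_le_length (by omega), List.take_append_of_le_length (by omega)]
  · rw [List.take_append_of_le_length le_rfl, List.take_length, List.take_of_length_le (by simp)]

theorem saved_le_snoc (σ : List Bool) (b : Bool) : saved p ν σ ≤ saved p ν (σ ++ [b]) := by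
  rw [saved_snoc]; linarith [inc_nonneg hp hν σ b]

theorem saved_mono {σ τ : List Bool} (h : σ <+: τ) : saved p ν σ ≤ saved p ν τ := by
  obtain ⟨ρ, rfl⟩ := h
  induction ρ using List.reverseRecOn with
  | nil => simp
  | append_singleton ρ b ih =>
    rw [← List.append_assoc]
    exact ih.trans (saved_le_snoc hp hν _ b)

theorem saved_nonneg (σ : List Bool) : 0 ≤ saved p ν σ := by
  have := saved_mono hp hν (List.nil_prefix (l := σ))
  rwa [saved_nil] at this

theorem stake_snoc (σ : List Bool) (b : Bool) : stake p ν (σ ++ [b]) =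
    saved p ν σ * p (σ ++ [b]) + rest p ν σ * (p σ)⁻¹ * p (σ ++ [b]) + kept p ν σ (σ ++ [b]) := by
  rw [stake, saved_snoc, inc]
  by_cases h : p (σ ++ [b]) = 0
  · rw [kept_eq_zero hp hν h, active_eq_zero hp hν h, h]; ring
  · field_simp; ring

theorem stake_measure : IsStringMeasure (stake p ν) := by
  refine ⟨fun σ => add_nonneg (mul_nonneg (saved_nonneg hp hν σ) (hp.nonneg σ))
    (active_nonneg hp hν σ), fun σ => ?_⟩
  rw [stake_snoc hp hν, stake_snoc hp hν, stake]
  have h1 := hp.add σ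
  have h2 : rest p ν σ * (p σ)⁻¹ * p σ = rest p ν σ := by
    by_cases h : p σ = 0
    · have h3 : kept p ν σ (σ ++ [false]) = 0 :=
        kept_eq_zero hp hν (le_antisymm (h ▸ hp.le σ false) (hp.nonneg _))
      have h4 : kept p ν σ (σ ++ [true]) = 0 :=
        kept_eq_zero hp hν (le_antisymm (h ▸ hp.le σ true) (hp.nonneg _))
      rw [rest, active_eq_zero hp hν h, h3, h4]; simp
    · field_simp
  have h3 : rest p ν σ = active p ν σ -
    (kept p ν σ (σ ++ [false]) + kept p ν σ (σ ++ [true])) := rfl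
  have h4 : rest p ν σ * (p σ)⁻¹ * p (σ ++ [false]) + rest p ν σ * (p σ)⁻¹ * p (σ ++ [true]) =
      rest p ν σ := by rw [← mul_add, h1, h2]
  have h5 : saved p ν σ * p (σ ++ [false]) + saved p ν σ * p (σ ++ [true]) = saved p ν σ * p σ := by
    rw [← mul_add, h1]
  linarith

omit hp in
theorem stake_nil : stake p ν [] = p [] := by
  rw [stake, saved_nil, active_nil hν]; ring

theorem saved_mul_le_stake (σ : List Bool) : saved p ν σ * p σ ≤ stake p ν σ :=
  le_add_of_nonneg_right (active_nonneg hp hν σ)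

omit hp in
theorem stake_le (σ : List Bool) : stake p ν σ ≤ (saved p ν σ + 1) * p σ := by
  have := active_le (p := p) hν σ
  rw [stake, add_mul]; linarith

omit hp in
/-- The savings tend to infinity along each path on which the ratio of `ν` and `p` is
unbounded. -/
theorem tendsto_saved {y : ℕ → Bool} (hpos : ∀ n, 0 < p (initSeg y n))
    (hun : ∀ B : ℝ, ∃ n, B * p (initSeg y n) < ν (initSeg y n)) :
    Tendsto (fun n => saved p ν (initSeg y n)) atTop atTop := by
  refine tendsto_savings (w := fun n => weight p ν (initSeg y n))
    (m := fun n => p (initSeg y n)) (v := fun n => pert ν (initSeg y n)) hpos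
    (fun n => pert_pos hν _) (fun n => ?_) weight_nil (fun n => ?_) fun B => ?_
  · rw [initSeg_succ, weight_snoc]; rfl
  · rw [initSeg_succ, saved_snoc, inc, active_snoc hν, kept, div_eq_mul_inv]
    have := mul_nonneg (rest_nonneg (p := p) hν (initSeg y n)) (inv_nonneg.2 (hpos n).le)
    linarith
  · obtain ⟨n, hn⟩ := hun B
    have : (0 : ℝ) < 2⁻¹ ^ (initSeg y n).length := by positivity
    exact ⟨n, by rw [pert]; linarith⟩

end Savings

/-! ### Computability of the savings strategy -/

section SavingsComputable

variable {X : Type*} [MetricSpace X] [MeasurableSpace X] {a : ℕ → X} {μ : Measure X}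
  [BorelSpace X] [IsProbabilityMeasure μ] [CompleteSpace X]

/-- The measures of the cells. -/
def cellMass (A : CellDecomposition a μ) (σ : List Bool) : ℝ := μ.real (A.cell σ)

omit [CompleteSpace X] in
theorem isStringMeasure_cellMass (A : CellDecomposition a μ) : IsStringMeasure (cellMass A) :=
  ⟨fun _ => measureReal_nonneg, A.measureReal_cell⟩

theorem IsMeasureCode.isStringMeasure {c : Code} (h : IsMeasureCode c) :
    IsStringMeasure (measureOf c) :=
  ⟨h.computes.2.1, h.computes.2.2⟩

variable (ha : IsComputablePolish a) (hμ : IsComputableMeasure a μ) (A : CellDecomposition a μ)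
  {α : Type*} [Primcodable α] {c : α → Code} {s t : α → List Bool}

theorem computable_take {i : α → ℕ} (hi : Computable i) (hs : Computable s) :
    Computable fun p => (s p).take (i p) :=
  Primrec.list_take.to_comp.comp hi hs

theorem computable_snoc (hs : Computable s) (b : Bool) : Computable fun p => s p ++ [b] :=
  Primrec.list_append.to_comp.comp hs (Computable.const _)

open Savings

theorem cr_pert (hc : Computable c) (hs : Computable s) :
    CR (fun p => IsMeasureCode (c p)) fun p => pert (measureOf (c p)) (s p) :=
  (CR.measureOf.comp (hc.pair hs)).add (CR.pow (Computable.list_length.comp hs))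

include ha hμ

theorem cr_cellMass (hs : Computable s) {D : α → Prop} : CR D fun p => cellMass A (s p) :=
  A.cr_cell ha hμ hs

theorem cr_ratio (hc : Computable c) (hs : Computable s) :
    CR (fun p => IsMeasureCode (c p)) fun p => ratio (cellMass A) (measureOf (c p)) (s p) :=
  CR.div (cr_cellMass ha hμ A hs) (cr_pert hc hs) (fun _ _ => measureReal_nonneg)
    fun _ hp => pert_pos hp.isStringMeasure _

theorem cr_weight (hc : Computable c) (hs : Computable s) :
    CR (fun p => IsMeasureCode (c p)) fun p => weight (cellMass A) (measureOf (c p)) (s p) := by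
  have h := cr_ratio ha hμ A (α := α × ℕ) (hc.comp Computable.fst)
    (computable_take Computable.snd (hs.comp Computable.fst))
  constructor
  · exact LSC.inf_range h.1 (Computable.list_length.comp hs) fun p _ q => lt_weight_iff
  · refine LSC.iSup h.2 fun p _ q => ?_
    simp only [lt_neg (a := q)]
    exact weight_lt_iff

theorem cr_active (hc : Computable c) (hs : Computable s) :
    CR (fun p => IsMeasureCode (c p)) fun p => active (cellMass A) (measureOf (c p)) (s p) :=
  (cr_weight ha hμ A hc hs).mul_of_nonneg_right (cr_pert hc hs)
    fun _ hp => (pert_pos hp.isStringMeasure _).le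

theorem cr_kept (hc : Computable c) (hs : Computable s) (ht : Computable t) :
    CR (fun p => IsMeasureCode (c p)) fun p => kept (cellMass A) (measureOf (c p)) (s p) (t p) :=
  ((cr_weight ha hμ A hc hs).mul_of_nonneg_right (cr_pert hc ht)
    fun _ hp => (pert_pos hp.isStringMeasure _).le).min
    (((CR.const_nat 2).mul_of_nonneg_right (cr_cellMass ha hμ A ht)
      fun _ _ => measureReal_nonneg).congr fun _ _ => by push_cast; rfl)

theorem cr_rest (hc : Computable c) (hs : Computable s) :
    CR (fun p => IsMeasureCode (c p)) fun p => rest (cellMass A) (measureOf (c p)) (s p) :=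
  (cr_active ha hμ A hc hs).sub ((cr_kept ha hμ A hc hs (computable_snoc hs false)).add
    (cr_kept ha hμ A hc hs (computable_snoc hs true)))

theorem cr_inc (hc : Computable c) (hs : Computable s) (ht : Computable t) :
    CR (fun p => IsMeasureCode (c p) ∧ 0 < cellMass A (s p) ∧ 0 < cellMass A (t p))
      fun p => inc (cellMass A) (measureOf (c p)) (s p) (t p) := by
  refine CR.add ?_ ?_
  · exact ((cr_rest ha hμ A hc hs).mono fun _ h => h.1).mul_of_nonneg_right
      ((cr_cellMass ha hμ A hs).inv fun _ h => h.2.1) fun _ h => (inv_pos.2 h.2.1).le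
  · exact (((cr_kept ha hμ A hc hs ht).sub (cr_active ha hμ A hc ht)).mono
      fun _ h => h.1).mul_of_nonneg_right ((cr_cellMass ha hμ A ht).inv fun _ h => h.2.2)
      fun _ h => (inv_pos.2 h.2.2).le

theorem cr_saved (hc : Computable c) (hs : Computable s) :
    CR (fun p => IsMeasureCode (c p) ∧ 0 < cellMass A (s p))
      fun p => saved (cellMass A) (measureOf (c p)) (s p) := by
  have h := cr_inc ha hμ A (α := α × ℕ) (hc.comp Computable.fst)
    (computable_take Computable.snd (hs.comp Computable.fst))
    (computable_take (Computable.succ.comp Computable.snd) (hs.comp Computable.fst))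
  refine CR.sum_range (D := fun p => IsMeasureCode (c p) ∧ 0 < cellMass A (s p))
    (h.mono fun p hp => ⟨hp.1, ?_, ?_⟩) (Computable.list_length.comp hs)
  · exact hp.2.trans_le (A.measureReal_cell_le (List.take_prefix _ _))
  · exact hp.2.trans_le (A.measureReal_cell_le (List.take_prefix _ _))

theorem cr_stake : CR (fun p : Code × List Bool => IsMeasureCode p.1)
      fun p => stake (cellMass A) (measureOf p.1) p.2 := by
  have hp := isStringMeasure_cellMass A
  refine CR.of_additive (LSC.of_guard (G := fun p => 0 < cellMass A p.2)
    (A.rePred_pos ha hμ Computable.snd) ?_ ?_ ?_) ?_ ?_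
  · exact (((cr_saved ha hμ A Computable.fst Computable.snd).mul_of_nonneg_right
      (cr_cellMass ha hμ A Computable.snd) fun _ _ => measureReal_nonneg).add
      ((cr_active ha hμ A Computable.fst Computable.snd).mono fun _ h => h.1)).1
  · exact fun p h => (stake_measure hp h.isStringMeasure).nonneg _
  · intro p h h0
    have : cellMass A p.2 = 0 := le_antisymm (not_lt.1 h0) (hp.nonneg _)
    rw [stake, active_eq_zero hp h.isStringMeasure this, this]; ring
  · exact fun c h σ => (stake_measure hp h.isStringMeasure).add σ
  · refine (CR.const_nat 1).2.congr fun c h => ?_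
    rw [stake_nil h.isStringMeasure, cellMass, A.measureReal_cell_nil, Nat.cast_one]

omit ha hμ in
/-- The ratio of the measure `ν` and `μ` is unbounded on the cells of `x`. -/
def UnboundedAt (A : CellDecomposition a μ) (ν : List Bool → ℝ) (x : X) : Prop :=
  ∀ B : ℝ, ∃ σ, x ∈ A.cell σ ∧ B * μ.real (A.cell σ) < ν σ

omit ha hμ [BorelSpace X] [CompleteSpace X] in
theorem mass_pos_of_not_inNullCell {A : CellDecomposition a μ} {x : X} (h : ¬ A.InNullCell x)
    {σ : List Bool} (hx : x ∈ A.cell σ) : 0 < μ.real (A.cell σ) := by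
  rw [← A.pos_iff, pos_iff_ne_zero]
  exact fun h0 => h ⟨σ, hx, h0⟩

omit ha hμ [BorelSpace X] [CompleteSpace X] in
theorem UnboundedAt.tendsto_saved {A : CellDecomposition a μ} {ν : List Bool → ℝ} {x : X}
    (hν : IsStringMeasure ν) (h : UnboundedAt A ν x) (h0 : ¬ A.InNullCell x) {y : ℕ → Bool}
    (hy : A.IsName x y) :
    Tendsto (fun n => saved (cellMass A) ν (initSeg y n)) atTop atTop := by
  refine Savings.tendsto_saved hν
    (fun n => mass_pos_of_not_inNullCell h0 (hy n)) fun B => ?_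
  obtain ⟨σ, hσ, hB⟩ := h B
  rw [hy.eq_initSeg hσ] at hB
  exact ⟨_, hB⟩

/-- From a computable measure, a martingale with the savings property that succeeds on all points
at which the ratio of the measure and `μ` is unbounded. -/
theorem exists_savings_of_measure : ∃ F : Code → Code × Code, Computable F ∧
    ∀ c, IsMeasureCode c → ∃ S, SavingsTest A (F c) S ∧ ∀ x, ¬ A.Unrepresented x →
      ¬ A.InNullCell x → UnboundedAt A (measureOf c) x → x ∈ S := by
  have hp := isStringMeasure_cellMass A
  have hG : REPred fun p : Code × List Bool => 0 < cellMass A p.2 :=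
    A.rePred_pos ha hμ Computable.snd
  have hsav := cr_saved ha hμ A (α := Code × List Bool) Computable.fst Computable.snd
  have hmass : CR (fun p : Code × List Bool => IsMeasureCode p.1 ∧ 0 < cellMass A p.2)
    fun p => cellMass A p.2 := cr_cellMass ha hμ A Computable.snd
  have hcap := ((cr_stake ha hμ A).mono fun (p : Code × List Bool)
    (h : IsMeasureCode p.1 ∧ 0 < cellMass A p.2) => h.1).mul_of_nonneg_right
    (hmass.inv fun p h => h.2) fun p h => (inv_pos.2 h.2).le
  obtain ⟨F1, hF1, h1⟩ := hcap.exists_computes hG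
  obtain ⟨F2, hF2, h2⟩ := hsav.exists_computes hG
  refine ⟨fun c => (F1 c, F2 c), hF1.pair hF2, fun c hc => ?_⟩
  have hν := hc.isStringMeasure
  set N : List Bool →. ℝ := fun σ =>
    ⟨0 < cellMass A σ, fun _ => stake (cellMass A) (measureOf c) σ * (cellMass A σ)⁻¹⟩ with hN
  set f : List Bool →. ℝ := fun σ =>
    ⟨0 < cellMass A σ, fun _ => saved (cellMass A) (measureOf c) σ⟩ with hf
  have hval : ∀ σ, 0 < cellMass A σ →
      val N σ = stake (cellMass A) (measureOf c) σ * (cellMass A σ)⁻¹ :=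
    fun σ h => val_of_mem ⟨h, rfl⟩
  have hvm : ∀ σ, val N σ * μ.real (A.cell σ) = stake (cellMass A) (measureOf c) σ := by
    intro σ
    rcases (hp.nonneg σ).eq_or_lt with h | h
    · have e : μ.real (A.cell σ) = 0 := h.symm
      rw [e, mul_zero, stake, active_eq_zero hp hν h.symm, ← h]; ring
    · rw [hval σ h, mul_assoc]
      have : (cellMass A σ)⁻¹ * μ.real (A.cell σ) = 1 := inv_mul_cancel₀ h.ne'
      rw [this, mul_one]
  have hle : ∀ σ, 0 < cellMass A σ → saved (cellMass A) (measureOf c) σ ≤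
      stake (cellMass A) (measureOf c) σ * (cellMass A σ)⁻¹ ∧
      stake (cellMass A) (measureOf c) σ * (cellMass A σ)⁻¹ ≤
        saved (cellMass A) (measureOf c) σ + 1 := by
    intro σ h
    rw [← div_eq_mul_inv, le_div_iff₀ h, div_le_iff₀ h]
    exact ⟨saved_mul_le_stake hp hν σ, stake_le hν σ⟩
  refine ⟨_, ⟨N, f, h1 c hc, ⟨?_, ?_, ?_⟩, h2 c hc, ⟨?_, ?_, ?_, ?_⟩, rfl⟩, ?_⟩
  · rintro σ v ⟨h, rfl⟩
    exact mul_nonneg ((stake_measure hp hν).nonneg σ) (inv_nonneg.2 (hp.nonneg σ))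
  · intro σ
    rw [hvm, hvm, hvm]
    exact (stake_measure hp hν).add σ
  · exact fun σ => A.pos_iff.symm
  · rintro σ v ⟨h, rfl⟩
    exact saved_nonneg hp hν σ
  · rintro σ v ⟨h, rfl⟩ w ⟨-, rfl⟩
    exact hle σ h
  · rintro σ τ h v ⟨-, rfl⟩ w ⟨-, rfl⟩
    exact saved_mono hp hν h
  · exact fun σ => A.pos_iff.symm
  · intro x hx h0 hun
    obtain ⟨y, hy⟩ := not_not.1 hx
    refine ⟨y, hy, tendsto_atTop_mono (fun n => ?_) (hun.tendsto_saved hν h0 hy)⟩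
    have hpos : 0 < cellMass A (initSeg y n) := mass_pos_of_not_inNullCell h0 (hy n)
    rw [hval _ hpos]
    exact (hle _ hpos).1

end SavingsComputable

/-! ### The supremum of an increasing function on the cells of a point -/

section SupFun

variable {X : Type*} [MetricSpace X] [MeasurableSpace X] {a : ℕ → X} {μ : Measure X}
  (A : CellDecomposition a μ) (f : List Bool → ℝ)

/-- The value of `f` at the cell of level `k` of `x`. -/
def levelFun (k : ℕ) (x : X) : ℝ≥0∞ :=
  ∑' σ : List Bool, (A.cell σ).indicator
    (fun _ => if σ.length = k then ENNReal.ofReal (f σ) else 0) x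

/-- The supremum of the values of `f` at the cells of `x`. -/
def supFun (x : X) : ℝ≥0∞ := ⨆ k, levelFun A f k x

variable {A f}

theorem levelFun_of_mem {σ : List Bool} {x : X} (h : x ∈ A.cell σ) :
    levelFun A f σ.length x = ENNReal.ofReal (f σ) := by
  rw [levelFun, tsum_eq_single σ]
  · simp [h]
  · intro τ hτ
    by_cases hx : x ∈ A.cell τ
    · have : τ.length ≠ σ.length := fun hl => hτ (A.eq_of_mem_cell hx h hl)
      simp [this]
    · simp [hx]

theorem le_supFun {σ : List Bool} {x : X} (h : x ∈ A.cell σ) :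
    ENNReal.ofReal (f σ) ≤ supFun A f x := by
  rw [← levelFun_of_mem h]
  exact le_iSup (fun k => levelFun A f k x) _

variable [BorelSpace X]

theorem measurable_levelFun (k : ℕ) : Measurable (levelFun A f k) :=
  Measurable.tsum fun σ => measurable_const.indicator (A.measurableSet_cell σ)

theorem measurable_supFun : Measurable (supFun A f) :=
  Measurable.iSup fun k => measurable_levelFun k

variable [IsProbabilityMeasure μ]

theorem levelFun_le_succ (hf : ∀ σ b, f σ ≤ f (σ ++ [b])) (k : ℕ) :
    ∀ᵐ x ∂μ, levelFun A f k x ≤ levelFun A f k.succ x := by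
  filter_upwards [A.ae_represented] with x ⟨y, hy⟩
  have h1 := levelFun_of_mem (f := f) (hy k)
  have h2 := levelFun_of_mem (f := f) (hy (k + 1))
  rw [length_initSeg] at h1 h2
  rw [h1, h2, initSeg_succ]
  exact ENNReal.ofReal_le_ofReal (hf _ _)

variable {n : List Bool → ℝ}

theorem lintegral_levelFun_le (hn : IsStringMeasure n)
    (h : ∀ σ, f σ * μ.real (A.cell σ) ≤ n σ) (hf0 : ∀ σ, 0 ≤ f σ) (j : ℕ) (σ : List Bool) :
    ∫⁻ x in A.cell σ, levelFun A f (σ.length + j) x ∂μ ≤ ENNReal.ofReal (n σ) := by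
  induction j generalizing σ with
  | zero =>
    rw [add_zero, setLIntegral_congr_fun (A.measurableSet_cell σ) (g := fun _ => ENNReal.ofReal (f σ))
      (fun x hx => levelFun_of_mem hx),
      setLIntegral_const, ← ofReal_measureReal, ← ENNReal.ofReal_mul (hf0 σ)]
    exact ENNReal.ofReal_le_ofReal (h σ)
  | succ j ih =>
    rw [A.lintegral_cell, ← hn.add σ, ENNReal.ofReal_add (hn.nonneg _) (hn.nonneg _)]
    refine add_le_add ?_ ?_
    · have := ih (σ ++ [false])
      rwa [List.length_append, List.length_singleton, Nat.add_right_comm] at this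
    · have := ih (σ ++ [true])
      rwa [List.length_append, List.length_singleton, Nat.add_right_comm] at this

theorem lintegral_supFun_le (hn : IsStringMeasure n) (h : ∀ σ, f σ * μ.real (A.cell σ) ≤ n σ)
    (hf0 : ∀ σ, 0 ≤ f σ) (hf : ∀ σ b, f σ ≤ f (σ ++ [b])) (σ : List Bool) :
    ∫⁻ x in A.cell σ, supFun A f x ∂μ ≤ ENNReal.ofReal (n σ) := by
  have hmono := fun k => levelFun_le_succ (A := A) hf k
  unfold supFun
  rw [lintegral_iSup_ae (fun k => measurable_levelFun k) (fun k => ae_restrict_of_ae (hmono k))]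
  refine iSup_le fun k => le_trans ?_ (lintegral_levelFun_le hn h hf0 k σ)
  refine lintegral_mono_ae (ae_restrict_of_ae ?_)
  filter_upwards [ae_all_iff.2 hmono] with x hx
  exact monotone_nat_of_le_succ hx (Nat.le_add_left _ _)

/-- The maximal inequality. -/
theorem measureReal_exceed_le (hn : IsStringMeasure n) (h : ∀ σ, f σ * μ.real (A.cell σ) ≤ n σ)
    (hf0 : ∀ σ, 0 ≤ f σ) (hf : ∀ σ b, f σ ≤ f (σ ++ [b])) {B : ℝ} (hB : 0 < B) {V : Set X}
    (hV : ∀ x ∈ V, ∃ σ, x ∈ A.cell σ ∧ B < f σ) (σ : List Bool) :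
    μ (V ∩ A.cell σ) ≤ ENNReal.ofReal (B⁻¹ * n σ) := by
  have h1 := mul_meas_ge_le_lintegral (μ := μ.restrict (A.cell σ))
    (measurable_supFun (A := A) (f := f)) (ENNReal.ofReal B)
  have h2 : μ (V ∩ A.cell σ) ≤
      μ.restrict (A.cell σ) {x | ENNReal.ofReal B ≤ supFun A f x} := by
    rw [Measure.restrict_apply' (A.measurableSet_cell σ)]
    refine measure_mono (Set.inter_subset_inter_left _ fun x hx => ?_)
    obtain ⟨τ, h3, h4⟩ := hV x hx
    exact (ENNReal.ofReal_le_ofReal h4.le).trans (le_supFun h3)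
  have h3 := (h1.trans (lintegral_supFun_le hn h hf0 hf σ))
  have h4 : μ (V ∩ A.cell σ) * ENNReal.ofReal B ≤ ENNReal.ofReal (n σ) := by
    rw [mul_comm]
    exact (mul_le_mul' le_rfl h2).trans h3
  rw [ENNReal.ofReal_mul (inv_nonneg.2 hB.le), ENNReal.ofReal_inv_of_pos hB, mul_comm,
    ← div_eq_mul_inv]
  rwa [ENNReal.le_div_iff_mul_le (Or.inl (by simpa using hB)) (Or.inl ENNReal.ofReal_ne_top)]

theorem exists_density (hn : IsStringMeasure n) (h : ∀ σ, f σ * μ.real (A.cell σ) ≤ n σ)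
    (h' : ∀ σ, n σ ≤ (f σ + 1) * μ.real (A.cell σ))
    (hf0 : ∀ σ, 0 ≤ f σ) (hf : ∀ σ b, f σ ≤ f (σ ++ [b])) :
    ∃ g : X → ℝ, Integrable g μ ∧ ∀ σ, n σ ≤ ∫ x in A.cell σ, g x ∂μ := by
  have h1 := lintegral_supFun_le (A := A) hn h hf0 hf []
  rw [A.cell_nil, setLIntegral_univ] at h1
  have hfin : ∫⁻ x, supFun A f x ∂μ ≠ ⊤ := ne_top_of_le_ne_top ENNReal.ofReal_ne_top h1
  have hint := integrable_toReal_of_lintegral_ne_top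
    (measurable_supFun (A := A) (f := f)).aemeasurable hfin
  refine ⟨fun x => (supFun A f x).toReal + 1, hint.add (integrable_const 1), fun σ => ?_⟩
  have h2 : (f σ + 1) * μ.real (A.cell σ) = ∫ _ in A.cell σ, (f σ + 1) ∂μ := by
    rw [setIntegral_const, smul_eq_mul, mul_comm]
  refine (h' σ).trans (h2.le.trans ?_)
  refine setIntegral_mono_on_ae (integrable_const _).integrableOn
    (hint.add (integrable_const 1)).integrableOn (A.measurableSet_cell σ) ?_
  filter_upwards [ae_lt_top (measurable_supFun (A := A) (f := f)) hfin] with x hx hxσ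
  have := ENNReal.toReal_mono hx.ne (le_supFun (f := f) hxσ)
  rw [ENNReal.toReal_ofReal (hf0 σ)] at this
  simpa using this

end SupFun

/-! ### Effectively convergent series -/

section Series

variable {α : Type*} [Primcodable α] {D : α → Prop} {t : α × ℕ → ℝ}

theorem summable_quarter : Summable fun m : ℕ => (2⁻¹ : ℝ) ^ (m + 2) :=
  ((summable_geometric_of_lt_one (by norm_num) (by norm_num)).mul_right ((2⁻¹ : ℝ) ^ 2)).congr
    fun m => (pow_add _ _ _).symm

theorem tsum_tail_quarter (N : ℕ) : ∑' m : ℕ, (2⁻¹ : ℝ) ^ (m + N + 2) = 2⁻¹ ^ (N + 1) := by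
  have : ∀ m : ℕ, (2⁻¹ : ℝ) ^ (m + N + 2) = 2⁻¹ ^ m * 2⁻¹ ^ (N + 2) := fun m => by
    rw [add_assoc, pow_add]
  simp_rw [this]
  rw [tsum_mul_right, tsum_geometric_of_lt_one (by norm_num) (by norm_num), pow_succ _ (N + 1)]
  ring

theorem CR.tsum (ht : CR (fun x => D x.1) t) (h0 : ∀ p, D p → ∀ m, 0 ≤ t (p, m))
    (h1 : ∀ p, D p → ∀ m, t (p, m) ≤ 2⁻¹ ^ (m + 2)) : CR D fun p => ∑' m, t (p, m) := by
  have hs : ∀ p, D p → Summable fun m => t (p, m) := fun p hp =>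
    Summable.of_nonneg_of_le (h0 p hp) (h1 p hp) summable_quarter
  have hsum : CR (fun x : α × ℕ => D x.1) fun x => ∑ m ∈ Finset.range x.2, t (x.1, m) :=
    CR.sum_range (f := fun y : (α × ℕ) × ℕ => t (y.1.1, y.2))
      (ht.comp ((Computable.fst.comp Computable.fst).pair Computable.snd)) Computable.snd
  have hlim : ∀ p, D p → Tendsto (fun N => ∑ m ∈ Finset.range N, t (p, m)) atTop
      (𝓝 (∑' m, t (p, m))) := fun p hp => (hs p hp).hasSum.tendsto_sum_nat
  constructor
  · refine LSC.iSup hsum.1 fun p hp q => ⟨fun hq => ?_, ?_⟩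
    · exact ((hlim p hp).eventually_const_lt hq).exists
    · rintro ⟨N, hN⟩
      exact hN.trans_le ((hs p hp).sum_le_tsum _ fun m _ => h0 p hp m)
  · refine LSC.iSup (G := fun x : α × ℕ => -((∑ m ∈ Finset.range x.2, t (x.1, m)) +
      2⁻¹ ^ (x.2 + 1))) (hsum.add (CR.pow (Computable.succ.comp Computable.snd))).2
      fun p hp q => ⟨fun hq => ?_, ?_⟩
    · have h2 : Tendsto (fun N : ℕ => (2⁻¹ : ℝ) ^ (N + 1)) atTop (𝓝 0) :=
        (tendsto_add_atTop_iff_nat 1).2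
          (tendsto_pow_atTop_nhds_zero_of_lt_one (by norm_num) (by norm_num))
      have h3 := ((hlim p hp).add h2).neg
      rw [add_zero] at h3
      exact (h3.eventually_const_lt hq).exists
    · rintro ⟨N, hN⟩
      refine hN.trans_le (neg_le_neg ?_)
      change ∑' m, t (p, m) ≤ (∑ m ∈ Finset.range N, t (p, m)) + 2⁻¹ ^ (N + 1)
      rw [← (hs p hp).sum_add_tsum_nat_add N, ← tsum_tail_quarter N]
      refine add_le_add le_rfl (((summable_nat_add_iff N).2 (hs p hp)).tsum_le_tsum
        (fun m => h1 p hp _) ((summable_nat_add_iff N).2 summable_quarter))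

end Series

/-! ### Covering effectively open sets by cells -/

/-- The list of all strings of length `n`. -/
def allStrings (n : ℕ) : List (List Bool) :=
  Nat.rec [[]] (fun _ l => l.flatMap fun σ => [σ ++ [false], σ ++ [true]]) n

theorem mem_allStrings {n : ℕ} {σ : List Bool} : σ ∈ allStrings n ↔ σ.length = n := by
  induction n generalizing σ with
  | zero => simp [allStrings]
  | succ n ih =>
    have h : allStrings (n + 1) = (allStrings n).flatMap fun σ => [σ ++ [false], σ ++ [true]] := rfl
    rw [h, List.mem_flatMap]
    constructor
    · rintro ⟨τ, hτ, hσ⟩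
      rw [ih] at hτ
      rcases List.mem_cons.1 hσ with rfl | hσ
      · simp [hτ]
      · rw [List.mem_singleton.1 hσ]; simp [hτ]
    · intro hl
      obtain ⟨τ, b, rfl⟩ : ∃ τ b, σ = τ ++ [b] := by
        induction σ using List.reverseRecOn with
        | nil => simp at hl
        | append_singleton τ b _ => exact ⟨τ, b, rfl⟩
      refine ⟨τ, ih.2 (by simpa using hl), ?_⟩
      cases b <;> simp

theorem primrec_allStrings : Primrec allStrings := by
  refine Primrec.nat_rec₁ _ ?_
  refine (Primrec.list_flatMap Primrec.snd ?_)
  have h : ∀ b, Primrec fun p : (ℕ × List (List Bool)) × List Bool => p.2 ++ [b] := fun b =>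
    Primrec.list_append.comp Primrec.snd (Primrec.const _)
  exact Primrec.list_cons.comp (h false) (Primrec.list_cons.comp (h true) (Primrec.const []))

section Cover

variable {X : Type*} [MetricSpace X] [MeasurableSpace X] {a : ℕ → X} {μ : Measure X}
  [BorelSpace X] [IsProbabilityMeasure μ]

theorem exists_level_cover (A : CellDecomposition a μ) {C : List Bool → Prop}
    (hC : ∀ σ τ, σ <+: τ → C σ → C τ) (h : ∀ᵐ x ∂μ, ∃ σ, C σ ∧ x ∈ A.cell σ) {ε : ℝ} (hε : 0 < ε) :
    ∃ (L : ℕ) (Z : List (List Bool)), (∀ τ ∈ allStrings L, τ ∈ Z ∨ C τ) ∧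
      (Z.map (cellMass A)).sum < ε := by
  classical
  let F : ℕ → Finset (List Bool) := fun L => (allStrings L).toFinset.filter fun τ => ¬ C τ
  have hF : ∀ L τ, τ ∈ F L ↔ τ.length = L ∧ ¬ C τ := by
    intro L τ; simp [F, mem_allStrings]
  let S : ℕ → Set X := fun L => ⋃ τ ∈ F L, A.cell τ
  have hS : ∀ L x, x ∈ S L ↔ ∃ τ, (τ.length = L ∧ ¬ C τ) ∧ x ∈ A.cell τ := by
    intro L x; simp [S, hF]
  have hanti : Antitone S := by
    refine antitone_nat_of_succ_le fun L x hx => ?_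
    obtain ⟨τ, ⟨h1, h2⟩, h3⟩ := (hS _ _).1 hx
    refine (hS _ _).2 ⟨τ.take L, ⟨by simp [h1], fun h4 => h2 (hC _ _ (List.take_prefix _ _) h4)⟩,
      A.cell_anti (List.take_prefix _ _) h3⟩
  have hmeas : ∀ L, MeasurableSet (S L) := fun L =>
    Finset.measurableSet_biUnion _ fun τ _ => A.measurableSet_cell τ
  have hlim := tendsto_measure_iInter_atTop (μ := μ) (fun L => (hmeas L).nullMeasurableSet) hanti
    ⟨0, measure_ne_top _ _⟩
  have hnull : μ (⋂ L, S L) = 0 := by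
    rw [measure_eq_zero_iff_ae_notMem]
    filter_upwards [h] with x ⟨σ, h1, h2⟩ hx
    obtain ⟨τ, ⟨h3, h4⟩, h5⟩ := (hS _ _).1 (Set.mem_iInter.1 hx σ.length)
    exact h4 (A.eq_of_mem_cell h5 h2 h3 ▸ h1)
  rw [hnull] at hlim
  obtain ⟨L, hL⟩ := (hlim.eventually_lt_const (ENNReal.ofReal_pos.2 hε)).exists
  refine ⟨L, (F L).toList, fun τ hτ => ?_, ?_⟩
  · by_cases hc : C τ
    · exact Or.inr hc
    · exact Or.inl (Finset.mem_toList.2 ((hF _ _).2 ⟨mem_allStrings.1 hτ, hc⟩))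
  · rw [Finset.sum_map_toList]
    have h1 : μ (S L) = ∑ τ ∈ F L, μ (A.cell τ) := by
      refine measure_biUnion_finset (fun σ hσ τ hτ hne => ?_) fun τ _ => A.measurableSet_cell τ
      exact A.disjoint_cell hne (((hF _ _).1 hσ).1.trans ((hF _ _).1 hτ).1.symm)
    have h2 : ∑ τ ∈ F L, cellMass A τ = (μ (S L)).toReal := by
      rw [h1, ENNReal.toReal_sum fun _ _ => measure_ne_top _ _]; rfl
    rw [h2]
    exact (ENNReal.lt_ofReal_iff_toReal_lt (measure_ne_top _ _)).1 hL

variable [CompleteSpace X]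

/-- The effectively open sets are covered, effectively, by cells that they contain almost
everywhere and by effectively open sets `E` that are contained, almost everywhere, in finite unions
of cells of small measure. -/
theorem exists_small_covers (ha : IsComputablePolish a) (hμ : IsComputableMeasure a μ)
    (A : CellDecomposition a μ) : ∃ (Z : Code × ℕ → List (List Bool)) (E : Code × ℕ → Set X),
      GComp (fun _ => True) Z ∧ SigmaOne a (fun _ => True) E ∧
      (∀ y, ((Z y).map (cellMass A)).sum ≤ 2⁻¹ ^ (y.2 + 2)) ∧
      (∀ y, μ (E y \ {x | ∃ τ ∈ Z y, x ∈ A.cell τ}) = 0) ∧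
      ∀ c n x, ¬ A.Unrepresented x → x ∈ opensOf a c n →
        (∃ σ, x ∈ A.cell σ ∧ μ (A.cell σ \ opensOf a c n) = 0) ∨
        ∃ m : ℕ, m.unpair.1 = n ∧ x ∈ E (c, m) := by
  obtain ⟨Cov, hCov, hext, hsub, hex⟩ := A.exists_cover
  obtain ⟨R, hR, HR'⟩ := sigmaOne_opensOf (a := a)
  have HR : ∀ c n, opensOf a c n = ballUnion a fun b => R ((c, n), b) :=
    fun c n => HR' (c, n) trivial
  obtain ⟨K, hK, HK⟩ := rePred_iff_exists_primrecPred.1 hR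
  obtain ⟨e1, he1, H1⟩ := (sigmaOne_opensOf (a := a)).exists_code
  obtain ⟨e2, he2, H2⟩ := (sigmaOne_coball (D := fun _ : ℕ × ℕ => True) ha Computable.fst
    Computable.snd).exists_code
  let nn : Code × ℕ → ℕ := fun y => y.2.unpair.1
  let ii : Code × ℕ → ℕ := fun y => y.2.unpair.2.unpair.1.unpair.1
  let rs : Code × ℕ → ℕ := fun y => y.2.unpair.2.unpair.1.unpair.2
  let rr : Code × ℕ → ℕ := fun y => y.2.unpair.2.unpair.2.unpair.1
  let kk : Code × ℕ → ℕ := fun y => y.2.unpair.2.unpair.2.unpair.2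
  have u1 : ∀ {f : Code × ℕ → ℕ}, Primrec f → Primrec fun y => (f y).unpair.1 := fun hf =>
    Primrec.fst.comp (Primrec.unpair.comp hf)
  have u2 : ∀ {f : Code × ℕ → ℕ}, Primrec f → Primrec fun y => (f y).unpair.2 := fun hf =>
    Primrec.snd.comp (Primrec.unpair.comp hf)
  have hnn : Primrec nn := u1 Primrec.snd
  have hii : Primrec ii := u1 (u1 (u2 Primrec.snd))
  have hrs : Primrec rs := u2 (u1 (u2 Primrec.snd))
  have hrr : Primrec rr := u1 (u2 (u2 Primrec.snd))
  have hkk : Primrec kk := u2 (u2 (u2 Primrec.snd))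
  let valid : Code × ℕ → Prop := fun y =>
    K (((y.1, nn y), (ii y, rr y)), kk y) ∧ ratCode (rs y) < ratCode (rr y)
  have hvalid : PrimrecPred valid :=
    (hK.comp (((Primrec.fst.pair hnn).pair (hii.pair hrr)).pair hkk)).and
      (primrecRel_ratLT.comp hrs hrr)
  let c1 : Code × ℕ → Code := fun y => e1 (y.1, nn y)
  let c2 : Code × ℕ → Code := fun y => e2 (ii y, rs y)
  have hc1 : Computable c1 := he1.comp (Computable.fst.pair hnn.to_comp)
  have hc2 : Computable c2 := he2.comp (hii.to_comp.pair hrs.to_comp)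
  -- certificates: a level `L` and a list `Z` of strings
  have hsumCR : CR (fun _ : Unit × List (List Bool) => True)
      fun x => (x.2.map fun b => cellMass A b).sum :=
    CR.list_sum (D := fun _ : Unit => True) (f := fun x : Unit × List Bool => cellMass A x.2)
      (cr_cellMass ha hμ A Computable.snd)
  have hcomp : Computable fun x : (Code × ℕ) × (ℕ × List (List Bool)) => ((), x.2.2) :=
    (Computable.const ()).pair (Computable.snd.comp Computable.snd)
  have hpw : Computable fun x : (Code × ℕ) × (ℕ × List (List Bool)) =>
      ratNeg (ratPow (x.1.2 + 2)) := primrec_ratNeg.to_comp.comp (primrec_ratPow.to_comp.comp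
    (Primrec.nat_add.to_comp.comp (Computable.snd.comp Computable.fst) (Computable.const 2)))
  obtain ⟨T, hT, HT⟩ := (hsumCR.comp hcomp).2.exists_rePred hpw
  let Cert : (Code × ℕ) × (ℕ × List (List Bool)) → Prop := fun x =>
    (¬ valid x.1 ∧ x.2.2 = []) ∨ (valid x.1 ∧ ((∀ τ ∈ allStrings x.2.1,
      τ ∈ x.2.2 ∨ (Cov (c1 x.1, τ) ∨ Cov (c2 x.1, τ))) ∧ T x))
  have hmem : ∀ {γ : Type} [Primcodable γ] {f : γ → List Bool} {g : γ → List (List Bool)},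
      Computable f → Computable g → REPred fun x => f x ∈ g x := by
    intro γ _ f g hf hg
    have h1 : PrimrecRel fun (l : List (List Bool)) (τ : List Bool) => ∃ σ ∈ l, σ = τ :=
      PrimrecRel.exists_mem_list Primrec.eq
    have h2 : PrimrecPred fun y : List Bool × List (List Bool) => y.1 ∈ y.2 :=
      (h1.comp Primrec.snd Primrec.fst).of_eq fun y => by simp
    exact REPred.comp h2.rePred (hf.pair hg)
  have hCert : REPred Cert := by
    refine ((hvalid.not.comp Primrec.fst).rePred.and (rePred_eq
      (Computable.snd.comp Computable.snd) (Computable.const []))).or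
      ((hvalid.comp Primrec.fst).rePred.and (REPred.and ?_ hT))
    refine (REPred.forall_mem (p := fun z : ((Code × ℕ) × (ℕ × List (List Bool))) × List Bool =>
      z.2 ∈ z.1.2.2 ∨ (Cov (c1 z.1.1, z.2) ∨ Cov (c2 z.1.1, z.2)))
      ((hmem Computable.snd (Computable.snd.comp (Computable.snd.comp Computable.fst))).or
        ((hCov.comp ((hc1.comp (Computable.fst.comp Computable.fst)).pair Computable.snd)).or
        (hCov.comp ((hc2.comp (Computable.fst.comp Computable.fst)).pair Computable.snd))))).comp
      (f := fun x : (Code × ℕ) × (ℕ × List (List Bool)) => (x, allStrings x.2.1))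
      (Computable.id.pair (primrec_allStrings.to_comp.comp
        (Computable.fst.comp Computable.snd)))
  have hTiff : ∀ y L Z, T (y, (L, Z)) ↔ (Z.map (cellMass A)).sum < 2⁻¹ ^ (y.2 + 2) := by
    intro y L Z
    rw [HT _ trivial, ratCode_ratNeg, Rat.cast_neg, ratCode_ratPow_real, neg_lt_neg_iff]
  have htot : ∀ y : Code × ℕ, True → ∃ z, Cert (y, z) := by
    intro y _
    by_cases hv : valid y
    · obtain ⟨L, Z, h1, h2⟩ := exists_level_cover A
        (C := fun τ => Cov (c1 y, τ) ∨ Cov (c2 y, τ))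
        (fun σ τ h => Or.imp (hext _ σ τ h) (hext _ σ τ h)) (by
          filter_upwards [hex (c1 y), hex (c2 y)] with x h1 h2
          by_cases hx : (ratCode (rs y) : ℝ) < dist x (a (ii y))
          · obtain ⟨σ, h3, h4⟩ := h2 (by rw [← H2 _ trivial]; exact hx)
            exact ⟨σ, Or.inr h3, h4⟩
          · obtain ⟨σ, h3, h4⟩ := h1 (by
              rw [← H1 _ trivial, HR]
              refine ⟨ii y, rr y, (HK _).2 ⟨_, hv.1⟩, (not_lt.1 hx).trans_lt ?_⟩
              exact_mod_cast hv.2)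
            exact ⟨σ, Or.inl h3, h4⟩) (inv_two_pow_pos (y.2 + 2))
      exact ⟨(L, Z), Or.inr ⟨hv, h1, (hTiff _ _ _).2 h2⟩⟩
    · exact ⟨(0, []), Or.inl ⟨hv, rfl⟩⟩
  obtain ⟨g, hg, Hg⟩ := exists_gComp_choice hCert htot
  have hball : SigmaOne a (fun _ : Code × ℕ => True)
      fun y => {x | dist x (a (ii y)) < (ratCode (rs y) : ℝ)} :=
    sigmaOne_ball hii.to_comp hrs.to_comp
  obtain ⟨Q, hQ, HQ⟩ := REPred.exists_comp_gComp
    (p := fun z : ((Code × ℕ) × List Bool) × (ℕ × List (List Bool)) =>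
      valid z.1.1 ∧ (z.1.2.length = z.2.1 ∧ (z.1.2 ∈ z.2.2 ∨ Cov (c2 z.1.1, z.1.2))))
    (D := fun _ : (Code × ℕ) × List Bool => True) (g := fun z => (z, g z.1))
    ((hvalid.comp (Primrec.fst.comp Primrec.fst)).rePred.and ((rePred_eq
      (Computable.list_length.comp (Computable.snd.comp Computable.fst))
      (Computable.fst.comp Computable.snd)).and
      ((hmem (Computable.snd.comp Computable.fst) (Computable.snd.comp Computable.snd)).or
        (hCov.comp ((hc2.comp (Computable.fst.comp Computable.fst)).pair
          (Computable.snd.comp Computable.fst))))))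
    ((Computable.id.gComp _).pair (hg.comp (Computable.fst.gComp _) fun _ _ => trivial))
  have hcells : SigmaOne a (fun _ : Code × ℕ => True)
      fun y => {x | ∃ τ, Q (y, τ) ∧ x ∈ A.cell τ} :=
    SigmaOne.iUnion (U := fun z : (Code × ℕ) × List Bool => A.cell z.2) hQ
      (((A.sigmaOne_cell ha).comp Computable.snd).mono fun _ _ => trivial)
  refine ⟨fun y => (g y).2, _, (Computable.snd.gComp fun _ => True).comp hg fun _ _ => trivial,
    hball.inter ha hcells, fun y => ?_, fun y => ?_, fun c n x hx hxU => ?_⟩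
  · rcases Hg y trivial with ⟨-, h⟩ | ⟨-, -, h⟩
    · dsimp only at h ⊢
      rw [h]; simp
    · exact ((hTiff y (g y).1 (g y).2).1 h).le
  · have hnull : ∀ τ : List Bool, μ {x | Cov (c2 y, τ) ∧ x ∈ A.cell τ \ effOpen a (c2 y)} = 0 := by
      intro τ
      by_cases hc : Cov (c2 y, τ)
      · exact measure_mono_null (fun x hx => hx.2) (hsub _ _ hc)
      · simp [hc]
    refine measure_mono_null ?_ (measure_iUnion_null hnull)
    rintro x ⟨⟨h1, τ, h2, h3⟩, h4⟩
    rw [HQ _ trivial] at h2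
    rcases h2.2.2 with h5 | h5
    · exact absurd ⟨τ, h5, h3⟩ h4
    · refine Set.mem_iUnion.2 ⟨τ, h5, h3, ?_⟩
      rw [← H2 _ trivial]
      have h1' : dist x (a (ii y)) < (ratCode (rs y) : ℝ) := h1
      exact not_lt.2 h1'.le
  · obtain ⟨ν, hν⟩ := not_not.1 hx
    have hxU' := hxU
    rw [HR] at hxU'
    obtain ⟨i, r, h1, h2⟩ := hxU'
    obtain ⟨k, hk⟩ := (HK _).1 h1
    obtain ⟨r', h3, h4⟩ := exists_ratCode_between h2
    let m := Nat.pair n (Nat.pair (Nat.pair i r') (Nat.pair r k))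
    have en : nn (c, m) = n := by simp [nn, m]
    have ei : ii (c, m) = i := by simp [ii, m]
    have er' : rs (c, m) = r' := by simp [rs, m]
    have er : rr (c, m) = r := by simp [rr, m]
    have ek : kk (c, m) = k := by simp [kk, m]
    have hv : valid (c, m) := by
      refine ⟨?_, ?_⟩
      · rw [en, ei, er, ek]; exact hk
      · rw [er', er]; exact_mod_cast h4
    rcases Hg (c, m) trivial with ⟨h5, -⟩ | ⟨-, h5, -⟩
    · exact absurd hv h5
    · have h6 := h5 (initSeg ν (g (c, m)).1) (mem_allStrings.2 (length_initSeg _ _))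
      have hE : (initSeg ν (g (c, m)).1 ∈ (g (c, m)).2 ∨ Cov (c2 (c, m), initSeg ν (g (c, m)).1)) →
          x ∈ {x | dist x (a (ii (c, m))) < (ratCode (rs (c, m)) : ℝ)} ∩
            {x | ∃ τ, Q ((c, m), τ) ∧ x ∈ A.cell τ} := by
        intro h
        refine ⟨?_, initSeg ν (g (c, m)).1, (HQ _ trivial).2 ⟨hv, length_initSeg _ _, h⟩, hν _⟩
        rw [ei, er']; exact h3
      rcases h6 with h6 | h6 | h6
      · exact Or.inr ⟨m, by simp [m], hE (Or.inl h6)⟩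
      · left
        refine ⟨initSeg ν (g (c, m)).1, hν _, ?_⟩
        have := hsub _ _ h6
        rwa [← H1 (c, nn (c, m)) trivial, en] at this
      · exact Or.inr ⟨m, by simp [m], hE (Or.inr h6)⟩

end Cover

/-! ### The measure of a sequence of finite unions of cells -/

section CoverMeasure

variable {X : Type*} [MetricSpace X] [MeasurableSpace X] {a : ℕ → X} {μ : Measure X}
  (A : CellDecomposition a μ)

/-- The total measure, in the cell `σ`, of the cells with strings in the list `Z`. -/
def coverTerm (Z : List (List Bool)) (σ : List Bool) : ℝ :=
  (Z.map fun τ => μ.real (A.cell τ ∩ A.cell σ)).sum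

/-- The total measure, in the cell `σ`, of the cells with strings in one of the lists `Z m`. -/
def coverMeasure (Z : ℕ → List (List Bool)) (σ : List Bool) : ℝ := ∑' m, coverTerm A (Z m) σ

variable {A}

theorem coverTerm_nonneg (Z : List (List Bool)) (σ : List Bool) : 0 ≤ coverTerm A Z σ := by
  refine List.sum_nonneg fun x hx => ?_
  obtain ⟨τ, -, rfl⟩ := List.mem_map.1 hx
  exact measureReal_nonneg

variable [IsProbabilityMeasure μ]

theorem ofReal_coverTerm (Z : List (List Bool)) (σ : List Bool) :
    ENNReal.ofReal (coverTerm A Z σ) = (Z.map fun τ => μ (A.cell τ ∩ A.cell σ)).sum := by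
  induction Z with
  | nil => simp [coverTerm]
  | cons τ Z ih =>
    have h : coverTerm A (τ :: Z) σ = μ.real (A.cell τ ∩ A.cell σ) + coverTerm A Z σ := rfl
    rw [h, ENNReal.ofReal_add measureReal_nonneg (coverTerm_nonneg _ _), ih, ofReal_measureReal]
    rfl

theorem coverTerm_le (Z : List (List Bool)) (σ : List Bool) :
    coverTerm A Z σ ≤ (Z.map (cellMass A)).sum :=
  List.sum_le_sum fun _ _ => measureReal_mono Set.inter_subset_left

variable [BorelSpace X]

theorem coverTerm_add (Z : List (List Bool)) (σ : List Bool) :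
    coverTerm A Z (σ ++ [false]) + coverTerm A Z (σ ++ [true]) = coverTerm A Z σ := by
  simp only [coverTerm]
  rw [← List.sum_map_add]
  simp only [A.measureReal_inter_cell]

variable {Z : ℕ → List (List Bool)} (hZ : ∀ m, ((Z m).map (cellMass A)).sum ≤ 2⁻¹ ^ (m + 2))
include hZ

omit [BorelSpace X] in
theorem summable_coverTerm (σ : List Bool) : Summable fun m => coverTerm A (Z m) σ :=
  Summable.of_nonneg_of_le (fun _ => coverTerm_nonneg _ _)
    (fun m => (coverTerm_le _ _).trans (hZ m)) summable_quarter

theorem isStringMeasure_coverMeasure : IsStringMeasure (coverMeasure A Z) :=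
  ⟨fun _ => tsum_nonneg fun _ => coverTerm_nonneg _ _, fun σ => by
    rw [coverMeasure, coverMeasure, ← (summable_coverTerm hZ _).tsum_add (summable_coverTerm hZ _)]
    simp only [coverTerm_add]
    rfl⟩

omit [BorelSpace X] in
theorem coverMeasure_le (σ : List Bool) : coverMeasure A Z σ ≤ 2⁻¹ := by
  refine ((summable_coverTerm hZ σ).tsum_le_tsum
    (fun m => (coverTerm_le _ _).trans (hZ m)) summable_quarter).trans ?_
  simpa using (tsum_tail_quarter 0).le

omit [BorelSpace X] in
theorem ofReal_coverMeasure (σ : List Bool) : ENNReal.ofReal (coverMeasure A Z σ) =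
    ∑' m, ((Z m).map fun τ => μ (A.cell τ ∩ A.cell σ)).sum := by
  rw [coverMeasure, ENNReal.ofReal_tsum_of_nonneg (fun _ => coverTerm_nonneg _ _)
    (summable_coverTerm hZ σ)]
  simp only [ofReal_coverTerm]

theorem exists_coverMeasure_density : ∃ g : X → ℝ, Integrable g μ ∧
    ∀ σ, coverMeasure A Z σ ≤ ∫ x in A.cell σ, g x ∂μ := by
  let t : List (List Bool) → X → ℝ≥0∞ := fun l x =>
    (l.map fun τ => (A.cell τ).indicator (1 : X → ℝ≥0∞) x).sum
  have ht : ∀ l, Measurable (t l) := by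
    intro l
    induction l with
    | nil => exact measurable_const
    | cons τ l ih => exact (measurable_one.indicator (A.measurableSet_cell τ)).add ih
  have hti : ∀ l σ, ∫⁻ x in A.cell σ, t l x ∂μ = (l.map fun τ => μ (A.cell τ ∩ A.cell σ)).sum := by
    intro l σ
    induction l with
    | nil => simp [t]
    | cons τ l ih =>
      have : ∀ x, t (τ :: l) x = (A.cell τ).indicator 1 x + t l x := fun _ => rfl
      simp only [this]
      rw [lintegral_add_left (measurable_one.indicator (A.measurableSet_cell τ)), ih,
        lintegral_indicator_one (A.measurableSet_cell τ),
        Measure.restrict_apply (A.measurableSet_cell τ)]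
      rfl
  let G : X → ℝ≥0∞ := fun x => ∑' m, t (Z m) x
  have hG : Measurable G := Measurable.tsum fun m => ht (Z m)
  have hGi : ∀ σ, ∫⁻ x in A.cell σ, G x ∂μ = ENNReal.ofReal (coverMeasure A Z σ) := by
    intro σ
    rw [ofReal_coverMeasure hZ, lintegral_tsum fun m => (ht (Z m)).aemeasurable]
    simp only [hti]
  have hfin : ∫⁻ x, G x ∂μ ≠ ⊤ := by
    have := hGi []
    rw [A.cell_nil, setLIntegral_univ] at this
    rw [this]; exact ENNReal.ofReal_ne_top
  refine ⟨fun x => (G x).toReal, integrable_toReal_of_lintegral_ne_top hG.aemeasurable hfin,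
    fun σ => ?_⟩
  rw [integral_toReal hG.aemeasurable (ae_restrict_of_ae (ae_lt_top hG hfin)), hGi,
    ENNReal.toReal_ofReal ((isStringMeasure_coverMeasure hZ).nonneg σ)]

omit [BorelSpace X] in
theorem tsum_measure_le_coverMeasure {E : ℕ → Set X}
    (hE : ∀ m, μ (E m \ {x | ∃ τ ∈ Z m, x ∈ A.cell τ}) = 0) (σ : List Bool) :
    ∑' n, μ ({x | ∃ m : ℕ, m.unpair.1 = n ∧ x ∈ E m} ∩ A.cell σ) ≤
      ENNReal.ofReal (coverMeasure A Z σ) := by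
  have h1 : ∀ l : List (List Bool), μ ({x | ∃ τ ∈ l, x ∈ A.cell τ} ∩ A.cell σ) ≤
      (l.map fun τ => μ (A.cell τ ∩ A.cell σ)).sum := by
    intro l
    induction l with
    | nil => simp
    | cons τ l ih =>
      have : {x | ∃ ρ ∈ τ :: l, x ∈ A.cell ρ} ∩ A.cell σ =
          (A.cell τ ∩ A.cell σ) ∪ ({x | ∃ ρ ∈ l, x ∈ A.cell ρ} ∩ A.cell σ) := by
        ext x; simp [or_and_right, exists_or]
      rw [this]
      exact (measure_union_le _ _).trans (add_le_add_right ih _)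
  have h2 : ∀ m, μ (E m ∩ A.cell σ) ≤ ((Z m).map fun τ => μ (A.cell τ ∩ A.cell σ)).sum := by
    intro m
    refine le_trans ?_ (h1 (Z m))
    refine (measure_mono (t := ({x | ∃ τ ∈ Z m, x ∈ A.cell τ} ∩ A.cell σ) ∪
      (E m \ {x | ∃ τ ∈ Z m, x ∈ A.cell τ})) ?_).trans ((measure_union_le _ _).trans ?_)
    · rintro x ⟨hx, hx'⟩
      by_cases h : x ∈ {x | ∃ τ ∈ Z m, x ∈ A.cell τ}
      · exact Or.inl ⟨h, hx'⟩
      · exact Or.inr ⟨hx, h⟩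
    · rw [hE, add_zero]
  rw [ofReal_coverMeasure hZ]
  calc ∑' n, μ ({x | ∃ m : ℕ, m.unpair.1 = n ∧ x ∈ E m} ∩ A.cell σ)
      ≤ ∑' n, ∑' k, μ (E (Nat.pair n k) ∩ A.cell σ) := by
        refine ENNReal.tsum_le_tsum fun n => ?_
        refine (measure_mono ?_).trans (measure_iUnion_le fun k => E (Nat.pair n k) ∩ A.cell σ)
        rintro x ⟨⟨m, rfl, hm⟩, hx⟩
        exact Set.mem_iUnion.2 ⟨m.unpair.2, by rwa [Nat.pair_unpair], hx⟩
    _ = ∑' m, μ (E m ∩ A.cell σ) := by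
        rw [← ENNReal.tsum_prod (f := fun n k => μ (E (Nat.pair n k) ∩ A.cell σ))]
        exact Nat.pairEquiv.tsum_eq fun m => μ (E m ∩ A.cell σ)
    _ ≤ _ := ENNReal.tsum_le_tsum h2

end CoverMeasure

/-! ### From bounded Martin-Löf tests to Vitali cover tests -/

section ToVitali

variable {X : Type*} [MetricSpace X] [MeasurableSpace X] {a : ℕ → X} {μ : Measure X}
  [BorelSpace X] [IsProbabilityMeasure μ] [CompleteSpace X]

open Savings

theorem cr_coverMeasure (ha : IsComputablePolish a) (hμ : IsComputableMeasure a μ)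
    (A : CellDecomposition a μ) {Z : Code × ℕ → List (List Bool)} (hZc : GComp (fun _ => True) Z)
    (hZ : ∀ y, ((Z y).map (cellMass A)).sum ≤ 2⁻¹ ^ (y.2 + 2)) :
    CR (fun _ : Code × List Bool => True) fun p => coverMeasure A (fun m => Z (p.1, m)) p.2 := by
  have h1 : CR (fun _ : List Bool × List Bool => True)
      fun p => μ.real (A.cell p.1 ∩ A.cell p.2) :=
    A.cr_inter_cell ha hμ (A.sigmaOne_cell ha) (cr_cellMass ha hμ A Computable.id).2
  have h2 : CR (fun _ : List Bool × List (List Bool) => True) fun p => coverTerm A p.2 p.1 :=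
    CR.list_sum (D := fun _ => True)
      (f := fun p : List Bool × List Bool => μ.real (A.cell p.2 ∩ A.cell p.1))
      (h1.comp (g := fun p : List Bool × List Bool => (p.2, p.1))
        (Computable.snd.pair Computable.fst))
  have hc : Computable fun x : (Code × List Bool) × ℕ => (x.1.1, x.2) :=
    (Computable.fst.comp Computable.fst).pair Computable.snd
  have hs : Computable fun x : (Code × List Bool) × ℕ => x.1.2 :=
    Computable.snd.comp Computable.fst
  have hz : GComp (fun _ : (Code × List Bool) × ℕ => True) fun x => Z (x.1.1, x.2) :=
    hZc.comp (hc.gComp _) fun _ _ => True.intro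
  have hg : GComp (fun _ : (Code × List Bool) × ℕ => True) fun x => (x.1.2, Z (x.1.1, x.2)) :=
    (hs.gComp _).pair hz
  exact CR.tsum (D := fun _ : Code × List Bool => True)
    (t := fun x => coverTerm A (Z (x.1.1, x.2)) x.1.2)
    (h2.comp_gComp (g := fun x : (Code × List Bool) × ℕ => (x.1.2, Z (x.1.1, x.2))) hg
      fun _ _ => trivial) (fun _ _ _ => coverTerm_nonneg _ _)
    fun p _ m => (coverTerm_le _ _).trans (hZ (p.1, m))

omit [IsProbabilityMeasure μ] [CompleteSpace X] in
theorem measureReal_le_inter_of_null [IsFiniteMeasure μ] {O S : Set X} (hO : IsOpen O)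
    (h : μ (S \ O) = 0) : μ.real S ≤ μ.real (O ∩ S) := by
  refine ENNReal.toReal_mono (measure_ne_top _ _) ?_
  rw [← measure_inter_add_sdiff₀ S hO.measurableSet.nullMeasurableSet, h, add_zero, Set.inter_comm]

/-- From a computable measure and a computable sequence of effectively open sets, a Vitali cover
test with normalized bounding measure that all points fail at which the ratio of the measure and `μ`
is unbounded, or that fail the sequence of open sets as a bounded Martin-Löf test. -/
theorem exists_vitali_of_measure (ha : IsComputablePolish a) (hμ : IsComputableMeasure a μ)
    (A : CellDecomposition a μ) : ∃ F : Code × Code → Code × Code, Computable F ∧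
    ∀ c, IsMeasureCode c.1 → ∃ S, VitaliTest A (ProbAC A) (F c) S ∧ ∀ x, ¬ A.Unrepresented x →
      ¬ A.InNullCell x → (UnboundedAt A (measureOf c.1) x ∨
        ((∀ n σ, μ.real (opensOf a c.2 n ∩ A.cell σ) ≤ 2⁻¹ ^ n * measureOf c.1 σ) ∧
          ∀ n, x ∈ opensOf a c.2 n)) → x ∈ S := by
  obtain ⟨Z, E, hZc, hEo, hZ, hE, hcov⟩ := exists_small_covers ha hμ A
  have hp := isStringMeasure_cellMass A
  -- the bounding measure
  let n2 : Code × Code → List Bool → ℝ := fun c => coverMeasure A fun m => Z (c.2, m)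
  let ν : (Code × Code) × List Bool → ℝ := fun y =>
    stake (cellMass A) (measureOf y.1.1) y.2 * 2⁻¹ ^ 1 + n2 y.1 y.2 +
      (2⁻¹ ^ 1 - n2 y.1 []) * cellMass A y.2
  have hn2 : CR (fun _ : (Code × Code) × List Bool => True) fun y => n2 y.1 y.2 :=
    (cr_coverMeasure ha hμ A hZc hZ).comp (g := fun y : (Code × Code) × List Bool => (y.1.2, y.2))
      ((Computable.snd.comp Computable.fst).pair Computable.snd)
  have hhalf : ∀ {β : Type} [Primcodable β] {D : β → Prop}, CR D fun _ => (2⁻¹ : ℝ) ^ 1 :=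
    CR.pow (Computable.const 1)
  have hνCR : CR (fun y : (Code × Code) × List Bool => IsMeasureCode y.1.1) ν := by
    refine CR.add (CR.add ?_ (hn2.mono fun _ _ => trivial)) ?_
    · exact ((cr_stake ha hμ A).comp (g := fun y : (Code × Code) × List Bool => (y.1.1, y.2)) ((Computable.fst.comp Computable.fst).pair
        Computable.snd)).mul_of_nonneg_right hhalf fun _ _ => by positivity
    · exact (hhalf.sub ((hn2.comp (g := fun y : (Code × Code) × List Bool => (y.1, ([] : List Bool)))
        (Computable.fst.pair (Computable.const []))).mono
        fun _ _ => trivial)).mul_of_nonneg_right (cr_cellMass ha hμ A Computable.snd)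
        fun _ _ => measureReal_nonneg
  -- the open sets
  obtain ⟨T, hT, HT⟩ := (cr_saved ha hμ A (α := (((Code × Code) × ℕ) × List Bool))
    (Computable.fst.comp (Computable.fst.comp Computable.fst)) Computable.snd).1.exists_rePred
    (g := fun y => ratNat (2 ^ (y.1.2 + 2))) (primrec_ratNat.to_comp.comp
      (primrec_two_pow.to_comp.comp (Primrec.nat_add.to_comp.comp
        (Computable.snd.comp Computable.fst) (Computable.const 2))))
  let G : ((Code × Code) × ℕ) × List Bool → Prop := fun y => 0 < cellMass A y.2 ∧ T y
  have hG : REPred G := (A.rePred_pos ha hμ Computable.snd).and hT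
  have hGiff : ∀ y, IsMeasureCode y.1.1.1 → (G y ↔ 0 < cellMass A y.2 ∧
      (2 : ℝ) ^ (y.1.2 + 2) < saved (cellMass A) (measureOf y.1.1.1) y.2) := by
    intro y hy
    refine and_congr_right fun h => ?_
    rw [HT y ⟨hy, h⟩, ratCode_ratNat]
    push_cast
    rfl
  let V1 : (Code × Code) × ℕ → Set X := fun y => {x | ∃ σ, G (y, σ) ∧ x ∈ A.cell σ}
  have hV1 : SigmaOne a (fun _ => True) V1 :=
    SigmaOne.iUnion (D := fun _ => True) (U := fun z : ((Code × Code) × ℕ) × List Bool =>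
      A.cell z.2) hG (((A.sigmaOne_cell ha).comp (g := fun z : ((Code × Code) × ℕ) × List Bool => z.2) Computable.snd).mono fun _ _ => trivial)
  let W : (Code × Code) × ℕ → Set X := fun y => {x | ∃ m : ℕ, m.unpair.1 = y.2 ∧ x ∈ E (y.1.2, m)}
  have hW : SigmaOne a (fun _ => True) W :=
    SigmaOne.iUnion (D := fun _ => True) (G := fun z : ((Code × Code) × ℕ) × ℕ =>
      z.2.unpair.1 = z.1.2) (U := fun z : ((Code × Code) × ℕ) × ℕ => E (z.1.1.2, z.2))
      (rePred_eq (Computable.fst.comp (Computable.unpair.comp Computable.snd))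
        (Computable.snd.comp Computable.fst))
      ((hEo.comp (g := fun z : ((Code × Code) × ℕ) × ℕ => (z.1.1.2, z.2)) ((Computable.snd.comp (Computable.fst.comp Computable.fst)).pair
        Computable.snd)).mono fun _ _ => trivial)
  obtain ⟨F1, hF1, H1⟩ := CR.exists_computes_total
    (D := fun c : Code × Code => IsMeasureCode c.1) hνCR
  obtain ⟨F2, hF2, H2⟩ := ((hV1.union hW).mono
    (D' := fun y : (Code × Code) × ℕ => True) fun _ _ => trivial).exists_computesOpens
    (D := fun _ => True)
  refine ⟨fun c => (F1 c, F2 c), hF1.pair hF2, fun c hc => ?_⟩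
  have hν := hc.isStringMeasure
  have hst := stake_measure hp hν
  have hZc' : ∀ m, ((Z (c.2, m)).map (cellMass A)).sum ≤ 2⁻¹ ^ (m + 2) := fun m => hZ (c.2, m)
  have hcm := isStringMeasure_coverMeasure hZc'
  have hn2le : n2 c [] ≤ 2⁻¹ := coverMeasure_le hZc' []
  have hc0 : 0 ≤ (2⁻¹ : ℝ) ^ 1 - n2 c [] := by rw [pow_one]; linarith
  have hsum : ∀ σ, ∑' n, μ ((V1 (c, n) ∪ W (c, n)) ∩ A.cell σ) ≤ ENNReal.ofReal (ν (c, σ)) := by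
    intro σ
    have h1 : ∀ n, μ (V1 (c, n) ∩ A.cell σ) ≤
        ENNReal.ofReal (2⁻¹ ^ (n + 2) * stake (cellMass A) (measureOf c.1) σ) := by
      intro n
      rw [inv_pow]
      refine measureReal_exceed_le hst (saved_mul_le_stake hp hν) (saved_nonneg hp hν)
        (saved_le_snoc hp hν) (by positivity) (fun x hx => ?_) σ
      obtain ⟨τ, h, hx⟩ := hx
      exact ⟨τ, hx, ((hGiff _ hc).1 h).2⟩
    have h2 : ∑' n, μ (V1 (c, n) ∩ A.cell σ) ≤
        ENNReal.ofReal (stake (cellMass A) (measureOf c.1) σ * 2⁻¹ ^ 1) := by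
      refine (ENNReal.tsum_le_tsum h1).trans ?_
      rw [← ENNReal.ofReal_tsum_of_nonneg (fun n => mul_nonneg (by positivity) (hst.nonneg σ))
        (summable_quarter.mul_right _), tsum_mul_right, mul_comm]
      have := tsum_tail_quarter 0
      simp only [add_zero, zero_add] at this
      rw [this]
    have h3 : ∑' n, μ (W (c, n) ∩ A.cell σ) ≤ ENNReal.ofReal (n2 c σ) :=
      tsum_measure_le_coverMeasure (E := fun m => E (c.2, m)) hZc' (fun m => hE (c.2, m)) σ
    calc ∑' n, μ ((V1 (c, n) ∪ W (c, n)) ∩ A.cell σ)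
        ≤ ∑' n, (μ (V1 (c, n) ∩ A.cell σ) + μ (W (c, n) ∩ A.cell σ)) := by
          refine ENNReal.tsum_le_tsum fun n => ?_
          rw [Set.union_inter_distrib_right]
          exact measure_union_le _ _
      _ = ∑' n, μ (V1 (c, n) ∩ A.cell σ) + ∑' n, μ (W (c, n) ∩ A.cell σ) := ENNReal.tsum_add
      _ ≤ _ := add_le_add h2 h3
      _ = ENNReal.ofReal (stake (cellMass A) (measureOf c.1) σ * 2⁻¹ ^ 1 + n2 c σ) :=
          (ENNReal.ofReal_add (mul_nonneg (hst.nonneg σ) (by positivity)) (hcm.nonneg σ)).symm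
      _ ≤ _ := ENNReal.ofReal_le_ofReal
          (le_add_of_nonneg_right (mul_nonneg hc0 measureReal_nonneg))
  refine ⟨_, ⟨fun σ => ν (c, σ), fun n => V1 (c, n) ∪ W (c, n), ⟨H1 c hc, fun σ => ?_, fun σ => ?_⟩,
    ⟨?_, ?_⟩, H2 c trivial, ?_, hsum, rfl⟩, ?_⟩
  · exact add_nonneg (add_nonneg (mul_nonneg (hst.nonneg σ) (by positivity)) (hcm.nonneg σ))
      (mul_nonneg hc0 measureReal_nonneg)
  · have e1 := hst.add σ
    have e2 : n2 c (σ ++ [false]) + n2 c (σ ++ [true]) = n2 c σ := hcm.add σ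
    have e3 := hp.add σ
    change _ = stake (cellMass A) (measureOf c.1) σ * 2⁻¹ ^ 1 + n2 c σ +
      (2⁻¹ ^ 1 - n2 c []) * cellMass A σ
    rw [← e1, ← e2, ← e3]
    change stake (cellMass A) (measureOf c.1) _ * 2⁻¹ ^ 1 + n2 c _ +
      (2⁻¹ ^ 1 - n2 c []) * cellMass A _ + (stake (cellMass A) (measureOf c.1) _ * 2⁻¹ ^ 1 + n2 c _ +
      (2⁻¹ ^ 1 - n2 c []) * cellMass A _) = _
    ring
  · change stake (cellMass A) (measureOf c.1) [] * 2⁻¹ ^ 1 + n2 c [] +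
      (2⁻¹ ^ 1 - n2 c []) * cellMass A [] = 1
    have : cellMass A [] = 1 := A.measureReal_cell_nil
    rw [stake_nil hν, this]
    ring
  · obtain ⟨g, hg, Hg⟩ := exists_density (A := A) hst (saved_mul_le_stake hp hν) (stake_le hν)
      (saved_nonneg hp hν) (saved_le_snoc hp hν)
    obtain ⟨g', hg', Hg'⟩ := exists_coverMeasure_density hZc'
    refine ⟨fun x => g x * 2⁻¹ ^ 1 + g' x + (2⁻¹ ^ 1 - n2 c []),
      ((hg.mul_const _).add hg').add (integrable_const _), fun σ => ?_⟩
    have hg1 : Integrable (fun x => g x * (2⁻¹ : ℝ) ^ 1) μ := hg.mul_const _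
    have hg2 : Integrable (fun x => g x * (2⁻¹ : ℝ) ^ 1 + g' x) μ := hg1.add hg'
    change _ ≤ ∫ x in A.cell σ, g x * 2⁻¹ ^ 1 + g' x + (2⁻¹ ^ 1 - n2 c []) ∂μ
    rw [integral_add hg2.integrableOn (integrable_const _),
      integral_add hg1.integrableOn hg'.integrableOn, integral_mul_const,
      setIntegral_const, smul_eq_mul, mul_comm (μ.real _)]
    exact add_le_add (add_le_add (mul_le_mul_of_nonneg_right (Hg σ) (by positivity)) (Hg' σ)) le_rfl
  · have := hsum []
    simp only [A.cell_nil, Set.inter_univ] at this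
    exact this.trans_lt ENNReal.ofReal_lt_top
  · intro x hx h0 h
    obtain ⟨y, hy⟩ := not_not.1 hx
    by_cases hun : UnboundedAt A (measureOf c.1) x
    · refine Frequently.of_forall fun n => Or.inl ?_
      obtain ⟨k, hk⟩ := ((hun.tendsto_saved hν h0 hy).eventually_gt_atTop
        ((2 : ℝ) ^ (n + 2))).exists
      exact ⟨initSeg y k, (hGiff _ hc).2 ⟨mass_pos_of_not_inNullCell h0 (hy k), hk⟩, hy k⟩
    · obtain ⟨hb, hxU⟩ := h.resolve_left hun
      simp only [UnboundedAt, not_forall, not_exists, not_and, not_lt] at hun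
      obtain ⟨B, hB⟩ := hun
      refine Eventually.frequently ?_
      filter_upwards [(tendsto_pow_atTop_atTop_of_one_lt (one_lt_two (α := ℝ))).eventually_gt_atTop B]
        with n hn
      rcases hcov c.2 n x hx (hxU n) with ⟨σ, hσ, hnull⟩ | h
      · exfalso
        have hpos := mass_pos_of_not_inNullCell h0 hσ
        have e1 : μ.real (A.cell σ) ≤ μ.real (opensOf a c.2 n ∩ A.cell σ) :=
          measureReal_le_inter_of_null (sigmaOne_opensOf.isOpen (p := (c.2, n)) trivial) hnull
        have e2 := (e1.trans (hb n σ)).trans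
          (mul_le_mul_of_nonneg_left (hB σ hσ) (by positivity))
        rw [← mul_assoc, inv_pow] at e2
        have e3 : ((2 : ℝ) ^ n)⁻¹ * B < 1 := by
          rw [inv_mul_lt_iff₀ (by positivity), mul_one]; exact hn
        nlinarith
      · exact Or.inr h

end ToVitali

/-! ### Effectively Lipschitz functions -/

section Lipschitz

variable {X : Type*} [MetricSpace X] [CompleteSpace X] {a : ℕ → X} {γ : Type*} [Primcodable γ]

theorem CR.abs {α : Type*} [Primcodable α] {D : α → Prop} {f : α → ℝ} (hf : CR D f) :
    CR D fun p => |f p| :=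
  (hf.max hf.neg).congr fun _ _ => rfl

theorem computable_code_ofNat {α : Type*} [Primcodable α] {f : α → ℕ} (hf : Computable f) :
    Computable fun p => ofNat Code (f p) := (Computable.ofNat Code).comp hf

/-- Functions with computable Lipschitz constants and computable values at the simple points are
computable. -/
theorem exists_computesFunctions (ha : IsComputablePolish a) {D : γ → Prop}
    {f : γ × ℕ → X → ℝ} (hf : CR (fun y : (γ × ℕ) × ℕ => D y.1.1) fun y => f y.1 (a y.2))
    {K : γ × ℕ → ℕ} (hK : Computable K) (hL : ∀ p x y, |f p x - f p y| ≤ K p * dist x y) :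
    ∃ F : γ → Code, Computable F ∧
      ∀ c, D c → ComputesFunctions a (F c) fun n => f (c, n) := by
  -- parameters: ((p, e), (j, r)), (i, n)
  have hc : CR (fun z : (((γ × ℕ) × Code) × (ℕ × ℕ)) × (ℕ × ℕ) => D z.1.1.1.1) fun z =>
      (ratCode z.2.2 : ℝ) - (|f z.1.1.1 (a z.1.2.1) - ratCode z.2.1| +
        ratCode z.1.2.2 * (K z.1.1.1 : ℕ)) := by
    refine CR.sub (CR.ratCast (Computable.snd.comp Computable.snd)) (CR.add (CR.abs (CR.sub
      ?_ (CR.ratCast (Computable.fst.comp Computable.snd)))) (CR.mul_of_nonneg_right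
        (CR.ratCast (Computable.snd.comp (Computable.snd.comp Computable.fst)))
        (CR.natCast (hK.comp (Computable.fst.comp (Computable.fst.comp Computable.fst))))
        fun _ _ => Nat.cast_nonneg _))
    exact hf.comp (g := fun z : (((γ × ℕ) × Code) × (ℕ × ℕ)) × (ℕ × ℕ) => (z.1.1.1, z.1.2.1))
      ((Computable.fst.comp (Computable.fst.comp Computable.fst)).pair
        (Computable.fst.comp (Computable.snd.comp Computable.fst)))
  obtain ⟨T, hT, HT⟩ := hc.1.exists_rePred (Computable.const (ratNat 0))
  have hS : SigmaOne a (fun z : (γ × ℕ) × Code => D z.1.1)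
      fun z => f z.1 ⁻¹' effOpen realPts z.2 := by
    refine ⟨fun y => ∃ b : ℕ × ℕ, (y.1.2.eval (Nat.pair b.1 b.2)).Dom ∧ T (y, b),
      REPred.exists (p := fun z : (((γ × ℕ) × Code) × (ℕ × ℕ)) × (ℕ × ℕ) =>
        (z.1.1.2.eval (Nat.pair z.2.1 z.2.2)).Dom ∧ T z)
        ((rePred_eval_dom (Computable.snd.comp (Computable.fst.comp Computable.fst))
          (Primrec₂.natPair.to_comp.comp (Computable.fst.comp Computable.snd)
            (Computable.snd.comp Computable.snd))).and hT), fun p hp => ?_⟩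
    have HT' : ∀ j r b, T ((p, (j, r)), b) ↔
        |f p.1 (a j) - ratCode b.1| + ratCode r * (K p.1 : ℕ) < (ratCode b.2 : ℝ) := by
      intro j r b
      rw [HT ((p, (j, r)), b) hp, ratCode_ratNat_zero, Rat.cast_zero, sub_pos]
    ext x
    constructor
    · rintro ⟨i, n, h1, h2⟩
      have h2' : |f p.1 x - ratCode i| < (ratCode n : ℝ) := h2
      have hgap : 0 < ((ratCode n : ℝ) - |f p.1 x - ratCode i|) / (2 * (K p.1 + 1)) := by
        apply div_pos <;> [linarith; positivity]
      obtain ⟨r, h3, h4⟩ := exists_ratCode_between hgap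
      obtain ⟨j, hj⟩ := exists_simple_near ha x h3
      refine ⟨j, r, ⟨(i, n), h1, (HT' _ _ _).2 ?_⟩, hj⟩
      have h5 := hL p.1 (a j) x
      rw [dist_comm] at h5
      have h6 : (K p.1 : ℝ) * dist x (a j) ≤ K p.1 * ratCode r :=
        mul_le_mul_of_nonneg_left hj.le (Nat.cast_nonneg _)
      rw [lt_div_iff₀ (by positivity)] at h4
      have h7 : |f p.1 (a j) - ratCode i| ≤ |f p.1 (a j) - f p.1 x| + |f p.1 x - ratCode i| :=
        abs_sub_le _ _ _
      change |f p.1 (a j) - ratCode i| + ratCode r * (K p.1 : ℕ) < (ratCode n : ℝ)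
      nlinarith
    · rintro ⟨j, r, ⟨⟨i, n⟩, h1, h2⟩, h3⟩
      rw [HT'] at h2
      refine ⟨i, n, h1, ?_⟩
      change |f p.1 x - ratCode i| < (ratCode n : ℝ)
      have h5 := hL p.1 x (a j)
      have h6 : (K p.1 : ℝ) * dist x (a j) ≤ K p.1 * ratCode r :=
        mul_le_mul_of_nonneg_left h3.le (Nat.cast_nonneg _)
      have h7 : |f p.1 x - ratCode i| ≤ |f p.1 x - f p.1 (a j)| + |f p.1 (a j) - ratCode i| :=
        abs_sub_le _ _ _
      dsimp only at h2
      linarith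
  obtain ⟨e, he, He⟩ := hS.exists_code
  have hpart : Computable fun y : γ × ℕ =>
      encode (e ((y.1, y.2.unpair.1), ofNat Code y.2.unpair.2)) :=
    Computable.encode.comp (he.comp ((Computable.fst.pair
      (Computable.fst.comp (Computable.unpair.comp Computable.snd))).pair
        (computable_code_ofNat (Computable.snd.comp (Computable.unpair.comp Computable.snd)))))
  obtain ⟨F, hF, HF⟩ := exists_code_of_partrec hpart.partrec
  refine ⟨F, hF, fun c hc n e' => ⟨encode (e ((c, n), e')), ?_, ?_⟩⟩
  · have := HF c (Nat.pair n (encode e'))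
    rw [encode_nat] at this
    rw [this]
    simp
  · rw [ofNat_encode]
    exact He ((c, n), e') hc

end Lipschitz

/-! ### From Vitali cover tests to integral tests -/

section Tents

variable {X : Type*} [MetricSpace X] {a : ℕ → X}

/-- The number `1` if `K b` and `0` otherwise. -/
def guard (K : ℕ → Prop) [DecidablePred K] (b : ℕ) : ℕ := if K b then 1 else 0

/-- A function that is positive on the first `s` of the balls enumerated by `K`. -/
def bump (a : ℕ → X) (K : ℕ → Prop) [DecidablePred K] (s : ℕ) (x : X) : ℝ :=
  ∑ b ∈ Finset.range s, max ((ratCode b.unpair.1.unpair.2 : ℝ) - dist x (a b.unpair.1.unpair.1)) 0 *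
    (guard K b : ℕ)

/-- Lipschitz approximations to the indicator functions of unions of balls. -/
def tent (a : ℕ → X) (K : ℕ → Prop) [DecidablePred K] (s : ℕ) (x : X) : ℝ :=
  min (bump a K s x * (s : ℕ)) 1

variable {K : ℕ → Prop} [DecidablePred K]

theorem bump_nonneg (s : ℕ) (x : X) : 0 ≤ bump a K s x :=
  Finset.sum_nonneg fun _ _ => mul_nonneg (le_max_right _ _) (Nat.cast_nonneg _)

theorem tent_nonneg (s : ℕ) (x : X) : 0 ≤ tent a K s x :=
  le_min (mul_nonneg (bump_nonneg s x) (Nat.cast_nonneg _)) zero_le_one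

theorem tent_le_one (s : ℕ) (x : X) : tent a K s x ≤ 1 := min_le_right _ _

theorem guard_le (b : ℕ) : (guard K b : ℝ) ≤ 1 := by
  unfold guard; split_ifs <;> simp

theorem bump_lipschitz (s : ℕ) (x y : X) : |bump a K s x - bump a K s y| ≤ s * dist x y := by
  rw [bump, bump, ← Finset.sum_sub_distrib]
  refine (Finset.abs_sum_le_sum_abs _ _).trans ((Finset.sum_le_sum (g := fun _ => dist x y)
    fun b _ => ?_).trans_eq (by simp))
  rw [← sub_mul, abs_mul, abs_of_nonneg (Nat.cast_nonneg _ : (0 : ℝ) ≤ (guard K b : ℕ))]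
  refine (mul_le_of_le_one_right (abs_nonneg _) (guard_le b)).trans ?_
  refine (abs_max_sub_max_le_abs _ _ _).trans ?_
  rw [sub_sub_sub_cancel_left, dist_comm x y]
  exact abs_dist_sub_le y x _

theorem tent_lipschitz (s : ℕ) (x y : X) :
    |tent a K s x - tent a K s y| ≤ (s * s : ℕ) * dist x y := by
  refine (abs_min_sub_min_le_max _ _ _ _).trans ?_
  rw [sub_self, abs_zero, max_eq_left (abs_nonneg _), ← sub_mul, abs_mul, Nat.abs_cast]
  push_cast
  have := mul_le_mul_of_nonneg_right (bump_lipschitz (a := a) (K := K) s x y)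
    (Nat.cast_nonneg s : (0 : ℝ) ≤ s)
  linarith

theorem tent_eq_zero {s : ℕ} {x : X} (h : ∀ b, K b → (ratCode b.unpair.1.unpair.2 : ℝ) ≤
    dist x (a b.unpair.1.unpair.1)) : tent a K s x = 0 := by
  have : bump a K s x = 0 := by
    refine Finset.sum_eq_zero fun b _ => ?_
    by_cases hb : K b
    · rw [max_eq_right (sub_nonpos.2 (h b hb)), zero_mul]
    · simp [guard, hb]
  simp [tent, this]

theorem eventually_tent_eq_one {x : X} {b : ℕ} (hb : K b)
    (h : dist x (a b.unpair.1.unpair.1) < (ratCode b.unpair.1.unpair.2 : ℝ)) :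
    ∀ᶠ s in atTop, tent a K s x = 1 := by
  have hpos := sub_pos.2 h
  have h1 := (tendsto_natCast_atTop_atTop (R := ℝ)).const_mul_atTop hpos
  filter_upwards [h1.eventually_ge_atTop 1, eventually_gt_atTop b] with s hs hsb
  refine min_eq_right (hs.trans (mul_le_mul_of_nonneg_right ?_ (Nat.cast_nonneg _)))
  refine le_trans ?_ (Finset.single_le_sum (f := fun b : ℕ =>
    max ((ratCode b.unpair.1.unpair.2 : ℝ) - dist x (a b.unpair.1.unpair.1)) 0 * (guard K b : ℕ))
    (fun _ _ => mul_nonneg (le_max_right _ _) (Nat.cast_nonneg _)) (Finset.mem_range.2 hsb))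
  simp [guard, hb]

end Tents

section ToIntegral

variable {X : Type*} [MetricSpace X] {a : ℕ → X}

theorem cr_tent [CompleteSpace X] (ha : IsComputablePolish a) {β : Type*} [Primcodable β]
    {K : β → ℕ → Prop} [∀ y, DecidablePred (K y)] (hK : PrimrecPred fun z : β × ℕ => K z.1 z.2)
    {D : (β × ℕ) × ℕ → Prop} :
    CR D fun y => tent a (K y.1.1) y.1.2 (a y.2) := by
  have hi : Computable fun z : ((β × ℕ) × ℕ) × ℕ => z.2.unpair.1.unpair.1 :=
    Computable.fst.comp (Computable.unpair.comp (Computable.fst.comp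
      (Computable.unpair.comp Computable.snd)))
  have hr : Computable fun z : ((β × ℕ) × ℕ) × ℕ => z.2.unpair.1.unpair.2 :=
    Computable.snd.comp (Computable.unpair.comp (Computable.fst.comp
      (Computable.unpair.comp Computable.snd)))
  have hs : Computable fun y : (β × ℕ) × ℕ => y.1.2 := Computable.snd.comp Computable.fst
  have hg : Computable fun z : ((β × ℕ) × ℕ) × ℕ => guard (K z.1.1.1) z.2 := by
    have hK' : PrimrecPred fun z : ((β × ℕ) × ℕ) × ℕ => K z.1.1.1 z.2 :=
      hK.comp ((Primrec.fst.comp (Primrec.fst.comp Primrec.fst)).pair Primrec.snd)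
    exact (Primrec.ite hK' (Primrec.const 1) (Primrec.const 0)).to_comp
  have hzero : CR (fun z : ((β × ℕ) × ℕ) × ℕ => D z.1) fun _ => (0 : ℝ) :=
    (CR.const_nat 0).congr fun _ _ => Nat.cast_zero
  have hone : CR D fun _ => (1 : ℝ) := (CR.const_nat 1).congr fun _ _ => Nat.cast_one
  have hterm : CR (fun z : ((β × ℕ) × ℕ) × ℕ => D z.1) fun z =>
      max ((ratCode z.2.unpair.1.unpair.2 : ℝ) - dist (a z.1.2) (a z.2.unpair.1.unpair.1)) 0 *
        (guard (K z.1.1.1) z.2 : ℕ) :=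
    (((CR.ratCast hr).sub (CR.dist_simple ha (Computable.snd.comp Computable.fst) hi)).max
      hzero).mul_of_nonneg_right (CR.natCast hg) fun _ _ => Nat.cast_nonneg _
  exact ((CR.sum_range (D := D) hterm hs).mul_of_nonneg_right (CR.natCast hs)
    fun _ _ => Nat.cast_nonneg _).min hone

open scoped Classical in
/-- Finite sums of approximations to the indicator functions of sets in a sequence. -/
def tentSum (a : ℕ → X) (K : ℕ → ℕ → Prop) (s : ℕ) (x : X) : ℝ :=
  ∑ n ∈ Finset.range s, tent a (K n) s x

theorem tentSum_nonneg (K : ℕ → ℕ → Prop) (s : ℕ) (x : X) : 0 ≤ tentSum a K s x := by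
  classical
  exact Finset.sum_nonneg fun n _ => tent_nonneg (K := K n) s x

theorem tentSum_lipschitz (K : ℕ → ℕ → Prop) (s : ℕ) (x y : X) :
    |tentSum a K s x - tentSum a K s y| ≤ (s * (s * s) : ℕ) * dist x y := by
  classical
  rw [tentSum, tentSum, ← Finset.sum_sub_distrib]
  refine (Finset.abs_sum_le_sum_abs _ _).trans ((Finset.sum_le_sum
    fun n _ => tent_lipschitz (K := K n) s x y).trans_eq ?_)
  simp only [Finset.sum_const, Finset.card_range, nsmul_eq_mul]
  push_cast
  ring

theorem iSup_tentSum {K : ℕ → ℕ → Prop} {V : ℕ → Set X}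
    (hV : ∀ n x, x ∈ V n ↔ ∃ b, K n b ∧
      dist x (a b.unpair.1.unpair.1) < (ratCode b.unpair.1.unpair.2 : ℝ)) (x : X) :
    ⨆ s, ENNReal.ofReal (tentSum a K s x) = ∑' n, (V n).indicator (1 : X → ℝ≥0∞) x := by
  classical
  have hout : ∀ n s, x ∉ V n → tent a (K n) s x = 0 := fun n s h =>
    tent_eq_zero fun b hb => not_lt.1 fun hlt => h ((hV n x).2 ⟨b, hb, hlt⟩)
  apply le_antisymm
  · refine iSup_le fun s => ?_
    rw [tentSum, ENNReal.ofReal_sum_of_nonneg fun _ _ => tent_nonneg _ _]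
    refine (Finset.sum_le_sum fun n _ => ?_).trans (ENNReal.sum_le_tsum (Finset.range s))
    by_cases h : x ∈ V n
    · rw [Set.indicator_of_mem h, Pi.one_apply, ENNReal.ofReal_le_one]
      exact tent_le_one _ _
    · rw [hout n s h, ENNReal.ofReal_zero]; exact zero_le
  · rw [ENNReal.tsum_eq_iSup_nat]
    refine iSup_le fun N => ?_
    have hev : ∀ n, ∀ᶠ s in atTop,
        (V n).indicator (1 : X → ℝ≥0∞) x ≤ ENNReal.ofReal (tent a (K n) s x) := by
      intro n
      by_cases h : x ∈ V n
      · obtain ⟨b, hb, hlt⟩ := (hV n x).1 h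
        filter_upwards [eventually_tent_eq_one (a := a) (K := K n) hb hlt] with s hs
        rw [hs, Set.indicator_of_mem h]; simp
      · exact Eventually.of_forall fun s => by rw [Set.indicator_of_notMem h]; exact zero_le
    obtain ⟨s, hs, hsN⟩ := (((Finset.range N).eventually_all.2 fun n _ => hev n).and
      (eventually_ge_atTop N)).exists
    refine le_trans ?_ (le_iSup _ s)
    rw [tentSum, ENNReal.ofReal_sum_of_nonneg fun _ _ => tent_nonneg _ _]
    exact (Finset.sum_le_sum hs).trans (Finset.sum_le_sum_of_subset
      (Finset.range_subset_range.2 hsN))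

omit [MetricSpace X] in
theorem tsum_indicator_eq_top {V : ℕ → Set X} {x : X} (h : ∃ᶠ n in atTop, x ∈ V n) :
    ∑' n, (V n).indicator (1 : X → ℝ≥0∞) x = ⊤ := by
  have hinf : {n | x ∈ V n}.Infinite := Nat.frequently_atTop_iff_infinite.1 h
  have : (fun n => (V n).indicator (1 : X → ℝ≥0∞) x) =
      {n | x ∈ V n}.indicator fun _ => (1 : ℝ≥0∞) := by
    funext n
    by_cases hn : x ∈ V n <;> simp [hn]
  rw [this, ← tsum_subtype]
  have := hinf.to_subtype
  exact ENNReal.tsum_const_eq_top_of_ne_zero one_ne_zero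

variable [CompleteSpace X] [MeasurableSpace X] [BorelSpace X] {μ : Measure X}

/-- From a Vitali cover test, an integral test with the same bounding measure. -/
theorem exists_integral_of_vitali (ha : IsComputablePolish a) (A : CellDecomposition a μ) :
    ∃ F : Code → Code, Computable F ∧ ∀ (P : (List Bool → ℝ) → Prop) (c : Code × Code) (S : Set X),
      VitaliTest A P c S → ∃ S', IntegralTest A P (c.1, F c.2) S' ∧ S ⊆ S' := by
  classical
  obtain ⟨R, hR, HR⟩ := sigmaOne_opensOf (a := a)
  obtain ⟨T, hT, HT⟩ := rePred_iff_exists_primrecPred.1 hR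
  let K : Code × ℕ → ℕ → Prop := fun y b => T ((y, b.unpair.1.unpair), b.unpair.2)
  have hK : PrimrecPred fun z : (Code × ℕ) × ℕ => K z.1 z.2 :=
    hT.comp ((Primrec.fst.pair (Primrec.unpair.comp (Primrec.fst.comp
      (Primrec.unpair.comp Primrec.snd)))).pair (Primrec.snd.comp (Primrec.unpair.comp Primrec.snd)))
  have hV : ∀ c n x, x ∈ opensOf a c n ↔ ∃ b, K (c, n) b ∧
      dist x (a b.unpair.1.unpair.1) < (ratCode b.unpair.1.unpair.2 : ℝ) := by
    intro c n x
    have h : opensOf a c n = ballUnion a fun b => R ((c, n), b) := HR (c, n) trivial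
    rw [h]
    constructor
    · rintro ⟨i, r, h1, h2⟩
      obtain ⟨k, hk⟩ := (HT _).1 h1
      exact ⟨Nat.pair (Nat.pair i r) k, by simpa [K] using hk, by simpa using h2⟩
    · rintro ⟨b, h1, h2⟩
      exact ⟨_, _, (HT _).2 ⟨_, h1⟩, h2⟩
  let f : Code × ℕ → X → ℝ := fun y => tentSum a (fun n => K (y.1, n)) y.2
  have hterm : CR (fun z : ((Code × ℕ) × ℕ) × ℕ => True) fun z =>
      tent a (K (z.1.1.1, z.2)) z.1.1.2 (a z.1.2) :=
    (cr_tent ha hK (D := fun _ => True)).comp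
      (g := fun z : ((Code × ℕ) × ℕ) × ℕ => (((z.1.1.1, z.2), z.1.1.2), z.1.2))
      ((((Computable.fst.comp (Computable.fst.comp Computable.fst)).pair Computable.snd).pair
        (Computable.snd.comp (Computable.fst.comp Computable.fst))).pair
        (Computable.snd.comp Computable.fst))
  have hf : CR (fun _ : (Code × ℕ) × ℕ => True) fun y => f y.1 (a y.2) :=
    CR.sum_range (D := fun _ : (Code × ℕ) × ℕ => True)
      (f := fun z => tent a (K (z.1.1.1, z.2)) z.1.1.2 (a z.1.2)) hterm
      (Computable.snd.comp Computable.fst)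
  obtain ⟨F, hF, HF⟩ := exists_computesFunctions (D := fun _ => True) ha hf
    (K := fun y => y.2 * (y.2 * y.2))
    (Primrec.nat_mul.comp Primrec.snd (Primrec.nat_mul.comp Primrec.snd Primrec.snd)).to_comp
    fun y x x' => tentSum_lipschitz _ _ x x'
  refine ⟨F, hF, fun P c S => ?_⟩
  rintro ⟨ν, V, hν, hP, hV', -, hsum, rfl⟩
  have hVm : ∀ n, MeasurableSet (V n) := fun n => by
    obtain ⟨m, -, h⟩ := hV' n
    rw [h]; exact (isOpen_effOpen _).measurableSet
  have hVeq := hV'.eq_opensOf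
  refine ⟨_, ⟨ν, fun x => ∑' n, (V n).indicator (1 : X → ℝ≥0∞) x, hν, hP,
    ⟨fun n => f (c.2, n), fun n x => tentSum_nonneg _ _ _, HF c.2 trivial, fun x => ?_⟩,
    fun σ => ?_, rfl⟩, fun x hx => tsum_indicator_eq_top hx⟩
  · exact (iSup_tentSum (K := fun n => K (c.2, n)) (fun n x => by rw [hVeq]; exact hV c.2 n x) x).symm
  · rw [lintegral_tsum fun n => (measurable_one.indicator (hVm n)).aemeasurable]
    refine le_trans (ENNReal.tsum_le_tsum fun n => ?_) (hsum σ)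
    rw [lintegral_indicator_one (hVm n), Measure.restrict_apply (hVm n)]

end ToIntegral

/-! ### From integral tests to bounded Martin-Löf tests -/

section ToMartinLof

variable {X : Type*} [MetricSpace X] [MeasurableSpace X] {a : ℕ → X} {μ : Measure X}

/-- The open half-lines with rational end points are uniformly effectively open. -/
theorem exists_code_Ioi : ∃ e : ℕ → Code, Computable e ∧
    ∀ q, effOpen realPts (e q) = {y | (ratCode q : ℝ) < y} := by
  obtain ⟨e, he, H⟩ := exists_code_of_rePred (a := realPts)
    (R := fun z : ℕ × (ℕ × ℕ) => (ratCode (ratAdd z.1 z.2.2) : ℝ) < ratCode z.2.1)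
    (rePred_ratLT (primrec_ratAdd.to_comp.comp Computable.fst
      (Computable.snd.comp Computable.snd)) (Computable.fst.comp Computable.snd))
  refine ⟨e, he, fun q => ?_⟩
  rw [H]
  ext y
  constructor
  · rintro ⟨i, n, h1, h2⟩
    dsimp only at h1
    rw [ratCode_ratAdd, Rat.cast_add] at h1
    have := (abs_lt.1 (show |y - ratCode i| < (ratCode n : ℝ) from h2)).1
    change (ratCode q : ℝ) < y
    linarith
  · intro (h : (ratCode q : ℝ) < y)
    obtain ⟨q', h1, h2⟩ := exists_ratCode_between h
    obtain ⟨i, h3, h4⟩ := exists_ratCode_between (show ((ratCode q' : ℝ) + y) / 2 < y by linarith)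
    refine ⟨i, ratAdd i (ratNeg q'), ?_, ?_⟩
    · dsimp only
      rw [ratCode_ratAdd, ratCode_ratAdd, ratCode_ratNeg]
      push_cast
      linarith
    · change |y - ratCode i| < _
      rw [ratCode_ratAdd, ratCode_ratNeg, abs_of_pos (sub_pos.2 h4)]
      push_cast
      linarith

variable [BorelSpace X]

/-- From an integral test, a bounded Martin-Löf test with the same bounding measure. -/
theorem exists_boundedML_of_integral (A : CellDecomposition a μ) :
    ∃ F : Code × Code → Code, Computable F ∧
      ∀ (P : (List Bool → ℝ) → Prop) (c : Code × Code) (S : Set X),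
        IntegralTest A P c S → ∃ S', BoundedMLTest A P (c.1, F c) S' ∧ S ⊆ S' := by
  obtain ⟨e, he, He⟩ := exists_code_Ioi
  -- the thresholds
  let t : (Code × Code) × ℕ → ℝ := fun y => max 1 (measureOf y.1.1 []) * (2 ^ y.2 : ℕ)
  have ht : CR (fun y : (Code × Code) × ℕ => IsMeasureCode y.1.1) t := by
    refine CR.mul_of_nonneg_right (CR.max ((CR.const_nat 1).congr fun _ _ => Nat.cast_one) ?_)
      (CR.natCast (primrec_two_pow.to_comp.comp Computable.snd)) fun _ _ => Nat.cast_nonneg _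
    exact CR.measureOf.comp (g := fun y : (Code × Code) × ℕ => (y.1.1, ([] : List Bool)))
      ((Computable.fst.comp Computable.fst).pair (Computable.const []))
  obtain ⟨T, hT, HT⟩ := (ht.2.comp (g := fun z : ((Code × Code) × ℕ) × ((ℕ × ℕ) × ℕ) => z.1)
    Computable.fst).exists_rePred (g := fun z => ratNeg z.2.1.2)
    (primrec_ratNeg.to_comp.comp (Computable.snd.comp (Computable.fst.comp Computable.snd)))
  have hmem : REPred fun z : ((Code × Code) × ℕ) × ((ℕ × ℕ) × ℕ) =>
      z.2.2 ∈ z.1.1.2.eval (Nat.pair z.2.1.1 (encode (e z.2.1.2))) :=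
    rePred_mem_eval.comp (f := fun z : ((Code × Code) × ℕ) × ((ℕ × ℕ) × ℕ) =>
      ((z.1.1.2, Nat.pair z.2.1.1 (encode (e z.2.1.2))), z.2.2))
      (((Computable.snd.comp (Computable.fst.comp Computable.fst)).pair
        (Primrec₂.natPair.to_comp.comp (Computable.fst.comp (Computable.fst.comp Computable.snd))
          (Computable.encode.comp (he.comp
            (Computable.snd.comp (Computable.fst.comp Computable.snd)))))).pair
        (Computable.snd.comp Computable.snd))
  have hU := SigmaOne.iUnion (D := fun _ : (Code × Code) × ℕ => True)
    (U := fun z : ((Code × Code) × ℕ) × ((ℕ × ℕ) × ℕ) => effOpen a (ofNat Code z.2.2))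
    (hT.and hmem) (SigmaOne.of_code
      (computable_code_ofNat (Computable.snd.comp Computable.snd)))
  obtain ⟨F, hF, HF⟩ := SigmaOne.exists_computesOpens (D := fun _ : Code × Code => True) hU
  refine ⟨F, hF, fun P c S => ?_⟩
  rintro ⟨ν, g, hν, hP, ⟨f, hf0, hf, hg⟩, hint, rfl⟩
  have hc := hν.isMeasureCode
  have hνc := hν.eq_measureOf
  have ht1 : ∀ n, t (c, n) = max 1 (ν []) * 2 ^ n := fun n => by
    simp only [t, hνc]; push_cast; rfl
  have hB : (0 : ℝ) < max 1 (ν []) := lt_max_of_lt_left one_pos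
  set U : ℕ → Set X := fun n => {x | ∃ b : (ℕ × ℕ) × ℕ, (T ((c, n), b) ∧
    b.2 ∈ c.2.eval (Nat.pair b.1.1 (encode (e b.1.2)))) ∧ x ∈ effOpen a (ofNat Code b.2)} with hUdef
  have hUopens : ComputesOpens a (F c) U := HF c trivial
  have hmemU : ∀ n x, x ∈ U n ↔ ∃ j, t (c, n) < f j x := by
    intro n x
    have key : ∀ j q m, m ∈ c.2.eval (Nat.pair j (encode (e q))) →
        (x ∈ effOpen a (ofNat Code m) ↔ (ratCode q : ℝ) < f j x) := by
      intro j q m hm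
      obtain ⟨m', hm', h⟩ := hf j (e q)
      rw [Part.mem_unique hm hm', ← h, Set.mem_preimage, He]
      rfl
    have keyT : ∀ b, T ((c, n), b) ↔ t (c, n) < (ratCode b.1.2 : ℝ) := by
      intro b
      rw [HT ((c, n), b) hc, ratCode_ratNeg, Rat.cast_neg, neg_lt_neg_iff]
    constructor
    · rintro ⟨b, ⟨h1, h2⟩, h3⟩
      exact ⟨b.1.1, ((keyT b).1 h1).trans ((key _ _ _ h2).1 h3)⟩
    · rintro ⟨j, hj⟩
      obtain ⟨q, h1, h2⟩ := exists_ratCode_between hj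
      obtain ⟨m, hm, -⟩ := hf j (e q)
      exact ⟨((j, q), m), ⟨(keyT _).2 h1, hm⟩, (key j q m hm).2 h2⟩
  have hUm : ∀ n, MeasurableSet (U n) := fun n => by
    obtain ⟨m, -, h⟩ := hUopens n
    rw [h]; exact (isOpen_effOpen _).measurableSet
  have hmarkov : ∀ n σ, max 1 (ν []) * 2 ^ n * μ.real (U n ∩ A.cell σ) ≤ ν σ := by
    intro n σ
    have h1 : ENNReal.ofReal (t (c, n)) * μ (U n ∩ A.cell σ) ≤ ENNReal.ofReal (ν σ) := by
      rw [← setLIntegral_const]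
      refine le_trans (setLIntegral_mono' ((hUm n).inter (A.measurableSet_cell σ))
        fun x hx => ?_) ((lintegral_mono_set Set.inter_subset_right).trans (hint σ))
      obtain ⟨j, hj⟩ := (hmemU n x).1 hx.1
      rw [hg]
      exact (ENNReal.ofReal_le_ofReal hj.le).trans (le_iSup (fun j => ENNReal.ofReal (f j x)) j)
    have h2 := ENNReal.toReal_mono ENNReal.ofReal_ne_top h1
    rwa [ENNReal.toReal_mul, ht1, ENNReal.toReal_ofReal (by positivity),
      ENNReal.toReal_ofReal (hν.2.1 σ)] at h2
  refine ⟨_, ⟨ν, U, hν, hP, hUopens, fun n => ?_, fun n σ => ?_, rfl⟩, fun x hx n => ?_⟩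
  · have h := hmarkov n []
    rw [A.cell_nil, Set.inter_univ, mul_assoc] at h
    have h2 : max 1 (ν []) * (2 ^ n * μ.real (U n)) ≤ max 1 (ν []) * 1 := by
      rw [mul_one]; exact h.trans (le_max_right _ _)
    have h3 := le_of_mul_le_mul_left h2 hB
    rw [inv_pow]
    exact (le_inv_mul_iff₀ (by positivity)).2 h3 |>.trans_eq (mul_one _)
  · have h := hmarkov n σ
    rw [inv_pow, le_inv_mul_iff₀ (by positivity)]
    refine le_trans ?_ h
    rw [mul_assoc]
    exact le_mul_of_one_le_left (by positivity) (le_max_left _ _)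
  · rw [hmemU]
    have h1 : g x = ⊤ := hx
    rw [hg] at h1
    obtain ⟨j, hj⟩ := lt_iSup_iff.1 (h1 ▸ ENNReal.ofReal_lt_top : ENNReal.ofReal (t (c, n)) <
      ⨆ j, ENNReal.ofReal (f j x))
    exact ⟨j, (ENNReal.ofReal_lt_ofReal_iff_of_nonneg (by rw [ht1]; positivity)).1 hj⟩

end ToMartinLof

/-! ### Reductions between tests -/

section Reductions

variable {X : Type*} [MetricSpace X] [MeasurableSpace X] {a : ℕ → X} {μ : Measure X}

/-- Codes of `Φ`-tests are computably translated to codes of `Ψ`-tests, such that the points with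
the property `Q` that fail the first test fail the second. -/
def Reduces (Q : X → Prop) (Φ Ψ : Code × Code → Set X → Prop) : Prop :=
  ∃ F : Code × Code → Code × Code, Computable F ∧
    ∀ c S, Φ c S → ∃ S', Ψ (F c) S' ∧ ∀ x, Q x → x ∈ S → x ∈ S'

variable {Q : X → Prop} {Φ Ψ Θ : Code × Code → Set X → Prop}

omit [MetricSpace X] [MeasurableSpace X] in
theorem Reduces.trans (h : Reduces Q Φ Ψ) (h' : Reduces Q Ψ Θ) : Reduces Q Φ Θ := by
  obtain ⟨F, hF, H⟩ := h
  obtain ⟨G, hG, H'⟩ := h'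
  refine ⟨fun c => G (F c), hG.comp hF, fun c S hS => ?_⟩
  obtain ⟨S', hS', h1⟩ := H c S hS
  obtain ⟨T, hT, h2⟩ := H' _ S' hS'
  exact ⟨T, hT, fun x hx hxS => h2 x hx (h1 x hx hxS)⟩

omit [MetricSpace X] [MeasurableSpace X] in
theorem Reduces.mono {Q' : X → Prop} (h : Reduces Q Φ Ψ) (hQ : ∀ x, Q' x → Q x) :
    Reduces Q' Φ Ψ := by
  obtain ⟨F, hF, H⟩ := h
  refine ⟨F, hF, fun c S hS => ?_⟩
  obtain ⟨S', hS', h1⟩ := H c S hS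
  exact ⟨S', hS', fun x hx => h1 x (hQ x hx)⟩

/-- `c.1` is a code of a measure, and `S` is the set of points at which the ratio of the measure
and `μ` is unbounded. -/
def MeasureTest (A : CellDecomposition a μ) (c : Code × Code) (S : Set X) : Prop :=
  IsMeasureCode c.1 ∧ S = {x | UnboundedAt A (measureOf c.1) x}

/-- The point `x` is represented and in no null cell. -/
def Regular (A : CellDecomposition a μ) (x : X) : Prop := ¬ A.Unrepresented x ∧ ¬ A.InNullCell x

variable (A : CellDecomposition a μ)

theorem reduces_savings_martingale : Reduces (Regular A) (SavingsTest A) (MartingaleTest A) := by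
  refine ⟨id, Computable.id, fun c S => ?_⟩
  rintro ⟨N, f, hN, hM, -, -, rfl⟩
  refine ⟨_, ⟨N, hN, hM, rfl⟩, fun x _ => ?_⟩
  rintro ⟨y, hy, h⟩
  exact ⟨y, hy, (ENNReal.tendsto_ofReal_atTop.comp h).limsup_eq⟩

variable {A} in
theorem BoundedMLTest.of_prob {P : (List Bool → ℝ) → Prop} {c : Code × Code} {S : Set X}
    (h : BoundedMLTest A P c S) : BoundedMLTest A (fun _ => True) c S := by
  obtain ⟨ν, U, h1, -, h2⟩ := h
  exact ⟨ν, U, h1, trivial, h2⟩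

variable {A} in
theorem IsTest.of_prob {P : (List Bool → ℝ) → Prop} {k : TestKind} {c : Code × Code} {S : Set X}
    (h : IsTest A P k c S) : IsTest A (fun _ => True) k c S := by
  cases k with
  | martingale => exact h
  | savings => exact h
  | integral =>
    obtain ⟨ν, g, h1, -, h2⟩ := h
    exact ⟨ν, g, h1, trivial, h2⟩
  | boundedML => exact BoundedMLTest.of_prob h
  | vitali =>
    obtain ⟨ν, V, h1, -, h2⟩ := h
    exact ⟨ν, V, h1, trivial, h2⟩

variable [BorelSpace X] [IsProbabilityMeasure μ] [CompleteSpace X]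

theorem reduces_martingale_measure (ha : IsComputablePolish a) (hμ : IsComputableMeasure a μ) :
    Reduces (Regular A) (MartingaleTest A) (MeasureTest A) := by
  obtain ⟨F, hF, H⟩ := exists_measure_of_martingale ha hμ A
  refine ⟨fun c => (F c.1, c.2), (hF.comp Computable.fst).pair Computable.snd, fun c S => ?_⟩
  rintro ⟨M, hc, hM, rfl⟩
  have h := H c.1 M hc hM
  refine ⟨_, ⟨h.isMeasureCode, rfl⟩, ?_⟩
  rintro x ⟨-, h0⟩ ⟨y, hy, hlim⟩ B
  dsimp only
  rw [← h.eq_measureOf]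
  obtain ⟨n, hn⟩ : ∃ n, ENNReal.ofReal B < ENNReal.ofReal (val M (initSeg y n)) := by
    by_contra hcon
    simp only [not_exists, not_lt] at hcon
    have hle : limsup (fun n => ENNReal.ofReal (val M (initSeg y n))) atTop ≤ ENNReal.ofReal B :=
      limsup_le_of_le (h := Eventually.of_forall hcon)
    rw [hlim] at hle
    exact ENNReal.ofReal_ne_top (top_le_iff.1 hle)
  exact ⟨_, hy n, mul_lt_mul_of_pos_right (ENNReal.ofReal_lt_ofReal_iff'.1 hn).1
    (mass_pos_of_not_inNullCell h0 (hy n))⟩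

theorem reduces_measure_savings (ha : IsComputablePolish a) (hμ : IsComputableMeasure a μ) :
    Reduces (Regular A) (MeasureTest A) (SavingsTest A) := by
  obtain ⟨F, hF, H⟩ := exists_savings_of_measure ha hμ A
  refine ⟨fun c => F c.1, hF.comp Computable.fst, fun c S => ?_⟩
  rintro ⟨hc, rfl⟩
  obtain ⟨S', hS', h⟩ := H c.1 hc
  exact ⟨S', hS', fun x hx => h x hx.1 hx.2⟩

theorem reduces_measure_vitali (ha : IsComputablePolish a) (hμ : IsComputableMeasure a μ) :
    Reduces (Regular A) (MeasureTest A) (VitaliTest A (ProbAC A)) := by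
  obtain ⟨F, hF, H⟩ := exists_vitali_of_measure ha hμ A
  refine ⟨F, hF, fun c S => ?_⟩
  rintro ⟨hc, rfl⟩
  obtain ⟨S', hS', h⟩ := H c hc
  exact ⟨S', hS', fun x hx hxS => h x hx.1 hx.2 (Or.inl hxS)⟩

theorem reduces_boundedML_vitali (ha : IsComputablePolish a) (hμ : IsComputableMeasure a μ) :
    Reduces (Regular A) (BoundedMLTest A fun _ => True) (VitaliTest A (ProbAC A)) := by
  obtain ⟨F, hF, H⟩ := exists_vitali_of_measure ha hμ A
  refine ⟨F, hF, fun c S => ?_⟩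
  rintro ⟨ν, U, hν, -, hU, -, hb, rfl⟩
  obtain ⟨S', hS', h⟩ := H c hν.isMeasureCode
  refine ⟨S', hS', fun x hx hxS => h x hx.1 hx.2 (Or.inr ?_)⟩
  rw [← hν.eq_measureOf, ← hU.eq_opensOf]
  exact ⟨hb, hxS⟩

omit [IsProbabilityMeasure μ] in
theorem reduces_vitali_integral (ha : IsComputablePolish a) (P : (List Bool → ℝ) → Prop) :
    Reduces (Regular A) (VitaliTest A P) (IntegralTest A P) := by
  obtain ⟨F, hF, H⟩ := exists_integral_of_vitali ha A
  refine ⟨fun c => (c.1, F c.2), Computable.fst.pair (hF.comp Computable.snd), fun c S hS => ?_⟩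
  obtain ⟨S', hS', h⟩ := H P c S hS
  exact ⟨S', hS', fun x _ hx => h hx⟩

omit [IsProbabilityMeasure μ] [CompleteSpace X] in
theorem reduces_integral_boundedML (P : (List Bool → ℝ) → Prop) :
    Reduces (Regular A) (IntegralTest A P) (BoundedMLTest A P) := by
  obtain ⟨F, hF, H⟩ := exists_boundedML_of_integral A
  refine ⟨fun c => (c.1, F c), Computable.fst.pair hF, fun c S hS => ?_⟩
  obtain ⟨S', hS', h⟩ := H P c S hS
  exact ⟨S', hS', fun x _ hx => h hx⟩

omit [CompleteSpace X] in
theorem reduces_boundedML_measure :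
    Reduces (fun x => Regular A x ∧ A.CellsShrinkTo x) (BoundedMLTest A fun _ => True)
      (MeasureTest A) := by
  refine ⟨id, Computable.id, fun c S => ?_⟩
  rintro ⟨ν, U, hν, -, hU, -, hb, rfl⟩
  refine ⟨_, ⟨hν.isMeasureCode, rfl⟩, fun x hx hxS B => ?_⟩
  change ∃ σ, x ∈ A.cell σ ∧ B * μ.real (A.cell σ) < measureOf c.1 σ
  rw [← hν.eq_measureOf]
  obtain ⟨n, hn⟩ := pow_unbounded_of_one_lt B (one_lt_two (α := ℝ))
  have hopen : IsOpen (U n) := by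
    obtain ⟨m, -, h⟩ := hU n
    rw [h]; exact isOpen_effOpen _
  obtain ⟨σ, hσ, hnull⟩ := hx.2 (U n) hopen (hxS n)
  have hpos := mass_pos_of_not_inNullCell hx.1.2 hσ
  refine ⟨σ, hσ, (mul_lt_mul_of_pos_right hn hpos).trans_le ?_⟩
  have e1 : μ.real (A.cell σ) ≤ μ.real (U n ∩ A.cell σ) := measureReal_le_inter_of_null hopen hnull
  have e2 := e1.trans (hb n σ)
  rwa [inv_pow, le_inv_mul_iff₀ (by positivity)] at e2

/-- All tests are reducible to Vitali cover tests with normalized bounding measures. -/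
theorem reduces_vitali (ha : IsComputablePolish a) (hμ : IsComputableMeasure a μ) (k : TestKind) :
    Reduces (Regular A) (IsTest A (fun _ => True) k) (VitaliTest A (ProbAC A)) := by
  have h1 := (reduces_martingale_measure A ha hμ).trans (reduces_measure_vitali A ha hμ)
  have h2 := (reduces_integral_boundedML A fun _ => True).trans (reduces_boundedML_vitali A ha hμ)
  cases k with
  | martingale => exact h1
  | savings => exact (reduces_savings_martingale A).trans h1
  | integral => exact h2
  | boundedML => exact reduces_boundedML_vitali A ha hμ
  | vitali => exact (reduces_vitali_integral A ha _).trans h2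

/-- All tests with bounding measures are reducible to measures at the points to which the cells
shrink. -/
theorem reduces_measure (ha : IsComputablePolish a) (hμ : IsComputableMeasure a μ) (k : TestKind) :
    Reduces (fun x => Regular A x ∧ (¬ k.IsMartingaleKind → A.CellsShrinkTo x))
      (IsTest A (fun _ => True) k) (MeasureTest A) := by
  have h1 := reduces_martingale_measure A ha hμ
  have h2 := ((reduces_integral_boundedML A fun _ => True).mono fun _ h => h.1).trans
    (reduces_boundedML_measure A)
  cases k with
  | martingale => exact h1.mono fun _ h => h.1
  | savings => exact ((reduces_savings_martingale A).trans h1).mono fun _ h => h.1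
  | integral => exact h2.mono fun _ h => ⟨h.1, h.2 id⟩
  | boundedML => exact (reduces_boundedML_measure A).mono fun _ h => ⟨h.1, h.2 id⟩
  | vitali =>
    exact (((reduces_vitali_integral A ha _).mono fun _ h => h.1).trans h2).mono
      fun _ h => ⟨h.1, h.2 id⟩

/-- Tests of any kind are reducible to tests of any other kind, with normalized bounding
measures. -/
theorem reduces_test (ha : IsComputablePolish a) (hμ : IsComputableMeasure a μ) (k k' : TestKind) :
    Reduces (fun x => Regular A x ∧
      (¬ k.IsMartingaleKind → k'.IsMartingaleKind → A.CellsShrinkTo x))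
      (IsTest A (fun _ => True) k) (IsTest A (ProbAC A) k') := by
  have h1 := reduces_vitali A ha hμ k
  have h2 := h1.trans (reduces_vitali_integral A ha (ProbAC A))
  have h3 := (reduces_measure A ha hμ k).trans
    ((reduces_measure_savings A ha hμ).mono fun _ h => h.1)
  have h4 := h3.trans ((reduces_savings_martingale A).mono fun _ h => h.1)
  cases k' with
  | martingale => exact h4.mono fun _ h => ⟨h.1, fun hk => h.2 hk trivial⟩
  | savings => exact h3.mono fun _ h => ⟨h.1, fun hk => h.2 hk trivial⟩
  | integral => exact h2.mono fun _ h => h.1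
  | boundedML => exact (h2.trans (reduces_integral_boundedML A _)).mono fun _ h => h.1
  | vitali => exact h1.mono fun _ h => h.1

variable {A} in
theorem FailsSome.transfer (ha : IsComputablePolish a) (hμ : IsComputableMeasure a μ)
    {P : (List Bool → ℝ) → Prop} {k : TestKind} {x : X} (h : FailsSome A P k x)
    (hx : Regular A x) (hs : A.CellsShrinkTo x) (k' : TestKind) : FailsSome A (ProbAC A) k' x := by
  obtain ⟨c, S, hS, hxS⟩ := h
  obtain ⟨F, -, H⟩ := reduces_test A ha hμ k k'
  obtain ⟨S', hS', h⟩ := H c S hS.of_prob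
  exact ⟨F c, S', hS', h x ⟨hx, fun _ _ => hs⟩ hxS⟩

variable {A} in
theorem failsSome_iff (ha : IsComputablePolish a) (hμ : IsComputableMeasure a μ) {x : X}
    (hx : Regular A x) (hs : A.CellsShrinkTo x) (k k' : TestKind) :
    (FailsSome A (fun _ => True) k x ↔ FailsSome A (ProbAC A) k' x) := by
  refine ⟨fun h => h.transfer ha hμ hx hs k', fun h => ?_⟩
  obtain ⟨c, S, hS, hxS⟩ := h.transfer ha hμ hx hs k
  exact ⟨c, S, hS.of_prob, hxS⟩

end Reductions
end CompRand

end

theorem mainTheorem2 {X : Type*} [MetricSpace X] [CompleteSpace X] [MeasurableSpace X]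
    [BorelSpace X] (a : ℕ → X) (ha : CompRand.IsComputablePolish a)
    (μ : Measure X) [IsProbabilityMeasure μ] (hμ : CompRand.IsComputableMeasure a μ)
    (A : CompRand.CellDecomposition a μ) :
    -- the equivalence of the five tests, also with normalized bounding measures
    (∀ x : X, ¬ A.Unrepresented x → ¬ A.InNullCell x → A.CellsShrinkTo x →
      List.TFAE [
        CompRand.FailsSome A (fun _ => True) .martingale x,
        CompRand.FailsSome A (fun _ => True) .savings x,
        CompRand.FailsSome A (fun _ => True) .integral x,
        CompRand.FailsSome A (fun _ => True) .boundedML x,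
        CompRand.FailsSome A (fun _ => True) .vitali x,
        CompRand.FailsSome A (CompRand.ProbAC A) .integral x,
        CompRand.FailsSome A (CompRand.ProbAC A) .boundedML x,
        CompRand.FailsSome A (CompRand.ProbAC A) .vitali x]) ∧
    -- uniformity: codes of tests of any kind are computably translated to codes of (normalized)
    -- tests of any other kind; the condition on shrinking cells is only needed for passing from
    -- a bounding measure to a martingale
    (∀ k k' : CompRand.TestKind,
      ∃ F : Nat.Partrec.Code × Nat.Partrec.Code → Nat.Partrec.Code × Nat.Partrec.Code,
        Computable F ∧
        ∀ c S, CompRand.IsTest A (fun _ => True) k c S →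
          ∃ S', CompRand.IsTest A (CompRand.ProbAC A) k' (F c) S' ∧
            ∀ x : X, ¬ A.Unrepresented x → ¬ A.InNullCell x →
              (¬ k.IsMartingaleKind → k'.IsMartingaleKind → A.CellsShrinkTo x) →
              x ∈ S → x ∈ S') ∧
    -- all Kurtz random points satisfy the three conditions
    (∀ x : X, CompRand.IsKurtzRandom a μ x →
      ¬ A.Unrepresented x ∧ ¬ A.InNullCell x ∧ A.CellsShrinkTo x) := by
  refine ⟨fun x h1 h2 hs => ?_, fun k k' => ?_, fun x hx =>
    ⟨hx.represented, hx.not_inNullCell ha, hx.cellsShrinkTo ha⟩⟩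
  · have hx : CompRand.Regular A x := ⟨h1, h2⟩
    have hiff := CompRand.failsSome_iff ha hμ hx hs
    refine List.tfae_of_forall (CompRand.FailsSome A (CompRand.ProbAC A) .vitali x) _ ?_
    simp only [List.forall_mem_cons]
    have h : ∀ k, (CompRand.FailsSome A (CompRand.ProbAC A) k x ↔
        CompRand.FailsSome A (CompRand.ProbAC A) .vitali x) := fun k =>
      (hiff .vitali k).symm.trans (hiff .vitali .vitali)
    exact ⟨hiff _ _, hiff _ _, hiff _ _, hiff _ _, hiff _ _, h _, h _, trivial, by simp⟩
  · obtain ⟨F, hF, H⟩ := CompRand.reduces_test A ha hμ k k'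
    refine ⟨F, hF, fun c S hS => ?_⟩
    obtain ⟨S', hS', h⟩ := H c S hS
    exact ⟨S', hS', fun x h1 h2 hs => h x ⟨⟨h1, h2⟩, hs⟩⟩
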